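/- **Lemma.** Let $\mathcal A$ be a $\mathbb Q$-linear symmetric monoidal pseudo-abelian category (additive, with split idempotents, and with $\mathbb Q$-bilinear tensor product), equipped with a Quillen exact structure for which $\otimes$ is exact in each variable (for example an abelian category with exact tensor product and all its short exact sequences, such as $\mathrm{Rep}_{\mathbb Q}(G)$ for a group $G$). Let $\mathrm{Ch}(\mathcal A)$ be the category of non-negatively graded cochain complexes in $\mathcal A$, with the tensor product of complexes and the symmetry given by the Koszul sign rule. For a Young diagram $\lambda$, and more generally a skew diagram $\lambda/\mu$ with $n$ cells, and an object $X$ of $\mathcal A$ or of $\mathrm{Ch}(\mathcal A)$, let $S_{\lambda/\mu}(X)$ be the image of the Young symmetrizer $c_{\lambda/\mu}\in\mathbb Q[\Sigma_n]$ acting on $X^{\otimes n}$ (and $S_\lambda=S_{\lambda/\emptyset}$). Let $$0\to A\to B\to C\to 0$$ be an extension in $\mathcal A$ (a short exact sequence of the exact structure) and let $\lambda$ be any partition. Then there exist a resolution $R$ of $S_\lambda(A)$ in $\mathrm{Ch}(\mathcal A)$, i.e. a complex $R$ with an exact sequence $0\to S_\lambda(A)\to R^0\to R^1\to\cdots$,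 and a finite filtration by subcomplexes $$R=F^0R\supseteq F^1R\supseteq\cdots\supseteq F^{|\lambda|}R\supseteq F^{|\lambda|+1}R=0,$$ with $0\to F^{k+1}R\to F^kR\to \mathrm{Gr}_F^kR\to 0$ exact in each degree, whose graded pieces are the complexes $$\mathrm{Gr}^k_F R\;\cong\bigoplus_{\mu\subseteq\lambda,\ |\mu|=k}S_{\lambda/\mu}(B)\otimes S_\mu(C[1]),\qquad 0\le k\le|\lambda|,$$ where $B$ is regarded as a complex in degree $0$ and $C[1]$ denotes $C$ put in degree $1$. -/

import Mathlib

open CategoryTheory Limits MonoidalCategory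

namespace SchurExt

section Coxeter

variable {M : Type*} [Monoid M]

/-- The product `s k * s (k+1) * ⋯ * s (k+d-1)`. -/
def run (s : ℕ → M) (k : ℕ) : ℕ → M
  | 0 => 1
  | d + 1 => s k * run s (k + 1) d

/-- The relations of the Coxeter presentation of the symmetric group on `n` letters, for the
generators `s 0, …, s (n - 2)`. -/
structure CoxeterRel (n : ℕ) (s : ℕ → M) : Prop where
  sq : ∀ i, i + 1 < n → s i * s i = 1
  comm : ∀ i j, i + 1 < j → j + 1 < n → s i * s j = s j * s i
  braid : ∀ i, i + 2 < n → s i * s (i + 1) * s i = s (i + 1) * s i * s (i + 1)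

theorem CoxeterRel.mono {n m : ℕ} {s : ℕ → M} (h : CoxeterRel n s) (hm : m ≤ n) :
    CoxeterRel m s :=
  ⟨fun i hi => h.sq i (by omega), fun i j h1 h2 => h.comm i j h1 (by omega),
    fun i hi => h.braid i (by omega)⟩

theorem CoxeterRel.low {n : ℕ} {s : ℕ → M} (h : CoxeterRel n s) (i k d : ℕ) (h1 : i + 1 < k)
    (h2 : k + d < n) : s i * run s k d = run s k d * s i := by
  induction d generalizing k with
  | zero => simp [run]
  | succ d ih =>
    rw [run, ← mul_assoc, h.comm i k h1 (by omega), mul_assoc, ih (k + 1) (by omega) (by omega),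
      mul_assoc]

theorem CoxeterRel.high {n : ℕ} {s : ℕ → M} (h : CoxeterRel n s) (i k d : ℕ) (h1 : k ≤ i)
    (h2 : i + 1 < k + d) (h3 : k + d < n) :
    s (i + 1) * run s k d = run s k d * s i := by
  induction d generalizing k with
  | zero => omega
  | succ d ih =>
    rcases h1.eq_or_lt with rfl | hlt
    · obtain ⟨e, rfl⟩ : ∃ e, d = e + 1 := ⟨d - 1, by omega⟩
      have hc := h.low k (k + 2) e (by omega) (by omega)
      calc s (k + 1) * (s k * (s (k + 1) * run s (k + 2) e))
          = (s (k + 1) * s k * s (k + 1)) * run s (k + 2) e := by simp only [mul_assoc]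
        _ = s k * s (k + 1) * s k * run s (k + 2) e := by rw [h.braid k (by omega)]
        _ = s k * (s (k + 1) * run s (k + 2) e) * s k := by
          rw [mul_assoc _ (s k), hc]; simp only [mul_assoc]
    · rw [run, ← mul_assoc, ← h.comm k (i + 1) (by omega) (by omega), mul_assoc,
        ih (k + 1) (by omega) (by omega) (by omega), mul_assoc]

open Classical in
/-- Normal forms for products of the generators. -/
noncomputable def normalForms (s : ℕ → M) : ℕ → Finset M
  | 0 => {1}
  | n + 1 => (Finset.range (n + 1) ×ˢ normalForms s n).image
      (fun p => run s p.1 (n - p.1) * p.2)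

theorem card_normalForms_le (s : ℕ → M) (n : ℕ) : (normalForms s n).card ≤ n.factorial := by
  classical
  induction n with
  | zero => simp [normalForms]
  | succ n ih =>
    refine Finset.card_image_le.trans ?_
    rw [Finset.card_product, Finset.card_range, Nat.factorial_succ]
    exact Nat.mul_le_mul_left _ ih

theorem one_mem_normalForms (s : ℕ → M) (n : ℕ) : 1 ∈ normalForms s n := by
  classical
  induction n with
  | zero => simp [normalForms]
  | succ n ih =>
    refine Finset.mem_image.2 ⟨(n, 1), by simp [ih], by simp [run]⟩

theorem CoxeterRel.mul_mem {n : ℕ} {s : ℕ → M} (h : CoxeterRel n s) (i : ℕ) (hi : i + 1 < n)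
    {w : M} (hw : w ∈ normalForms s n) : s i * w ∈ normalForms s n := by
  classical
  induction n generalizing i w with
  | zero => omega
  | succ n ih =>
    have ih' := ih (h.mono (Nat.le_succ n))
    obtain ⟨⟨k, v⟩, hp, rfl⟩ := Finset.mem_image.1 hw
    obtain ⟨hk, hv⟩ := Finset.mem_product.1 hp
    simp only [Finset.mem_range] at hk hv
    have key : ∀ (k' : ℕ) (v' : M), k' ≤ n → v' ∈ normalForms s n →
        run s k' (n - k') * v' ∈ normalForms s (n + 1) := fun k' v' h1 h2 =>
      Finset.mem_image.2 ⟨(k', v'), by simp [h2]; omega, rfl⟩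
    simp only
    rcases lt_or_ge (i + 1) k with h1 | h1
    · rw [← mul_assoc, h.low i k _ h1 (by omega), mul_assoc]
      exact key _ _ (by omega) (ih' i (by omega) hv)
    · rcases h1.eq_or_lt with h1 | h1
      · subst h1
        have := key i v (by omega) hv
        rwa [show n - i = (n - (i + 1)) + 1 by omega, run, mul_assoc] at this
      · rcases (Nat.lt_succ_iff.1 h1).eq_or_lt with h2 | h2
        · subst h2
          rw [show n - k = (n - (k + 1)) + 1 by omega, run, ← mul_assoc, ← mul_assoc,
            h.sq k (by omega), one_mul]
          exact key _ _ (by omega) hv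
        · obtain ⟨j, rfl⟩ : ∃ j, i = j + 1 := ⟨i - 1, by omega⟩
          rw [← mul_assoc, h.high j k _ (by omega) (by omega) (by omega), mul_assoc]
          exact key _ _ (by omega) (ih' j (by omega) hv)

/-- The adjacent transposition `(i i+1)` of `Fin n` (the identity if `n ≤ i + 1`). -/
def adjSwap (n i : ℕ) : Equiv.Perm (Fin n) :=
  if h : i + 1 < n then Equiv.swap ⟨i, by omega⟩ ⟨i + 1, h⟩ else 1

theorem adjSwap_coxeterRel (n : ℕ) : CoxeterRel n (adjSwap n) where
  sq i hi := by simp [adjSwap, hi]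
  comm i j hij hj := by
    rw [adjSwap, adjSwap, dif_pos hj, dif_pos (by omega)]
    refine Equiv.Perm.Disjoint.commute ?_
    intro x
    by_cases h1 : x = ⟨i, by omega⟩
    · right; subst h1; apply Equiv.swap_apply_of_ne_of_ne <;> simp [Fin.ext_iff] <;> omega
    by_cases h2 : x = ⟨i + 1, by omega⟩
    · right; subst h2; apply Equiv.swap_apply_of_ne_of_ne <;> simp [Fin.ext_iff] <;> omega
    · left; exact Equiv.swap_apply_of_ne_of_ne h1 h2
  braid i hi := by
    rw [adjSwap, adjSwap, dif_pos (by omega), dif_pos (by omega)]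
    set a : Fin n := ⟨i, by omega⟩
    set b : Fin n := ⟨i + 1, by omega⟩
    set c : Fin n := ⟨i + 1 + 1, by omega⟩
    have hab : a ≠ b := by simp [a, b]
    have hbc : b ≠ c := by simp [b, c]
    have hac : a ≠ c := by simp [a, c]; omega
    have h1 : Equiv.swap b a * Equiv.swap c b * Equiv.swap b a = Equiv.swap a c :=
      Equiv.swap_mul_swap_mul_swap hbc.symm hac.symm
    have h2 : Equiv.swap b c * Equiv.swap a b * Equiv.swap b c = Equiv.swap c a :=
      Equiv.swap_mul_swap_mul_swap hab hac
    rw [h2, Equiv.swap_comm c a, ← h1, Equiv.swap_comm b a, Equiv.swap_comm c b]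

theorem closure_adjSwap (n : ℕ) :
    Submonoid.closure (Set.range fun i : {i : ℕ // i + 1 < n} => adjSwap n i.1) = ⊤ := by
  cases n with
  | zero => exact Subsingleton.elim _ _
  | succ n =>
    rw [← Equiv.Perm.mclosure_swap_castSucc_succ n]
    congr 1
    ext σ
    constructor
    · rintro ⟨⟨i, hi⟩, rfl⟩
      refine ⟨⟨i, by omega⟩, ?_⟩
      simp [adjSwap, hi]
    · rintro ⟨i, rfl⟩
      refine ⟨⟨i.1, by omega⟩, ?_⟩
      simp [adjSwap]
      rfl

theorem exists_permHom (n : ℕ) (s : ℕ → M) (h : CoxeterRel n s) :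
    ∃ ρ : Equiv.Perm (Fin n) →* M, ∀ i, i + 1 < n → ρ (adjSwap n i) = s i := by
  classical
  let t : ℕ → Equiv.Perm (Fin n) × M := fun i => (adjSwap n i, s i)
  have ht : CoxeterRel n t :=
    ⟨fun i hi => Prod.ext ((adjSwap_coxeterRel n).sq i hi) (h.sq i hi),
      fun i j h1 h2 => Prod.ext ((adjSwap_coxeterRel n).comm i j h1 h2) (h.comm i j h1 h2),
      fun i hi => Prod.ext ((adjSwap_coxeterRel n).braid i hi) (h.braid i hi)⟩
  let L : Submonoid (Equiv.Perm (Fin n) × M) :=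
    Submonoid.closure (Set.range fun i : {i : ℕ // i + 1 < n} => t i.1)
  have hL : ∀ x ∈ L, x ∈ normalForms t n := by
    intro x hx
    induction hx using Submonoid.closure_induction_left with
    | one => exact one_mem_normalForms t n
    | mul_left x hx y hy ih =>
      obtain ⟨i, rfl⟩ := hx
      exact ht.mul_mem i.1 i.2 ih
  have hsurj : Function.Surjective ((MonoidHom.fst _ M).comp L.subtype) := by
    intro σ
    have hσ : σ ∈ Submonoid.closure
        (Set.range fun i : {i : ℕ // i + 1 < n} => adjSwap n i.1) := by
      rw [closure_adjSwap]; trivial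
    induction hσ using Submonoid.closure_induction with
    | mem x hx =>
      obtain ⟨i, rfl⟩ := hx
      exact ⟨⟨t i.1, Submonoid.subset_closure ⟨i, rfl⟩⟩, rfl⟩
    | one => exact ⟨1, rfl⟩
    | mul x y _ _ hx hy =>
      obtain ⟨a, rfl⟩ := hx
      obtain ⟨b, rfl⟩ := hy
      exact ⟨a * b, map_mul _ _ _⟩
  let j : L → normalForms t n := fun x => ⟨x.1, hL x.1 x.2⟩
  have hj : Function.Injective j := fun x y hxy => Subtype.ext (congrArg (fun z => z.1) hxy)
  have : Finite L := Finite.of_injective j hj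
  have hcard : Nat.card L ≤ Nat.card (Equiv.Perm (Fin n)) := by
    calc Nat.card L ≤ Nat.card (normalForms t n) := Nat.card_le_card_of_injective j hj
      _ = (normalForms t n).card := by simp
      _ ≤ n.factorial := card_normalForms_le t n
      _ = Nat.card (Equiv.Perm (Fin n)) := by simp [Fintype.card_perm]
  have hbij : Function.Bijective ((MonoidHom.fst _ M).comp L.subtype) :=
    (Nat.bijective_iff_surjective_and_card _).2
      ⟨hsurj, le_antisymm hcard (Nat.card_le_card_of_surjective _ hsurj)⟩
  let e := MulEquiv.ofBijective _ hbij
  refine ⟨((MonoidHom.snd _ M).comp L.subtype).comp e.symm.toMonoidHom, fun i hi => ?_⟩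
  have hmem : t i ∈ L := Submonoid.subset_closure ⟨⟨i, hi⟩, rfl⟩
  have : e.symm (adjSwap n i) = ⟨t i, hmem⟩ := by
    rw [MulEquiv.symm_apply_eq]; rfl
  change (e.symm (adjSwap n i)).1.2 = s i
  rw [this]

end Coxeter

section TensorPower

variable {𝒞 : Type*} [Category 𝒞] [MonoidalCategory 𝒞]

/-- The tensor power `X ⊗ (X ⊗ (⋯ ⊗ (X ⊗ 𝟙)))` with `n` factors `X`. -/
def tensorPow (X : 𝒞) : ℕ → 𝒞
  | 0 => 𝟙_ 𝒞
  | n + 1 => X ⊗ tensorPow X n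

variable [BraidedCategory 𝒞]

/-- The braiding of the first two factors in `X ⊗ (Y ⊗ T)`. -/
def braidFront (X Y T : 𝒞) : X ⊗ (Y ⊗ T) ⟶ Y ⊗ (X ⊗ T) :=
  (α_ X Y T).inv ≫ (β_ X Y).hom ▷ T ≫ (α_ Y X T).hom

/-- The exchange of the first two factors of `X^{⊗ (n + 1)}`, or the identity if `n = 0`. -/
def swapFront (X : 𝒞) : (n : ℕ) → End (tensorPow X (n + 1))
  | 0 => 𝟙 _
  | n + 1 => braidFront X X (tensorPow X n)

/-- The endomorphism of the tensor power `X^{⊗ n}` that exchanges the factors number `i` and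
`i + 1` (counted from `0`) by the braiding, and the identity if there are no such factors. -/
def adjBraid (X : 𝒞) : (n i : ℕ) → End (tensorPow X n)
  | 0, _ => 𝟙 _
  | n + 1, 0 => swapFront X n
  | n + 1, i + 1 => X ◁ adjBraid X n i

theorem braidFront_naturality (X Y : 𝒞) {T T' : 𝒞} (f : T ⟶ T') :
    braidFront X Y T ≫ Y ◁ (X ◁ f) = X ◁ (Y ◁ f) ≫ braidFront X Y T' := by
  simp only [braidFront, Category.assoc]
  rw [← MonoidalCategory.associator_naturality_right, ← whisker_exchange_assoc,
    MonoidalCategory.associator_inv_naturality_right_assoc]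

theorem braidFront_yang_baxter (X Y Z T : 𝒞) :
    braidFront X Y (Z ⊗ T) ≫ Y ◁ braidFront X Z T ≫ braidFront Y Z (X ⊗ T) =
      X ◁ braidFront Y Z T ≫ braidFront X Z (Y ⊗ T) ≫ Z ◁ braidFront X Y T := by
  have h := congrArg (fun f => (X ◁ (α_ Y Z T).inv) ≫ (α_ X (Y ⊗ Z) T).inv ≫ f ▷ T ≫
    (α_ Z (Y ⊗ X) T).hom ≫ Z ◁ (α_ Y X T).hom) (BraidedCategory.yang_baxter X Y Z)
  simp only [braidFront]
  calc _ = _ := ?_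
    _ = _ := h
    _ = _ := ?_
  · simp only [comp_whiskerRight, MonoidalCategory.whiskerLeft_comp, Category.assoc]
    monoidal
  · simp only [comp_whiskerRight, MonoidalCategory.whiskerLeft_comp, Category.assoc]
    monoidal

end TensorPower

section Action

variable {𝒞 : Type*} [Category 𝒞] [MonoidalCategory 𝒞] [SymmetricCategory 𝒞]

theorem braidFront_symmetry (X Y T : 𝒞) : braidFront X Y T ≫ braidFront Y X T = 𝟙 _ := by
  simp only [braidFront, Category.assoc, Iso.hom_inv_id_assoc]
  rw [← comp_whiskerRight_assoc, SymmetricCategory.symmetry]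
  simp

theorem adjBraid_coxeterRel (X : 𝒞) (n : ℕ) : CoxeterRel n (adjBraid X n) where
  sq := by
    induction n with
    | zero => intro i hi; omega
    | succ n ih =>
      intro i hi
      cases i with
      | zero =>
        obtain ⟨m, rfl⟩ : ∃ m, n = m + 1 := ⟨n - 1, by omega⟩
        exact braidFront_symmetry X X (tensorPow X m)
      | succ i =>
        have := ih i (by omega)
        rw [End.mul_def] at this ⊢
        change X ◁ adjBraid X n i ≫ X ◁ adjBraid X n i = 𝟙 _
        rw [← MonoidalCategory.whiskerLeft_comp, this]
        exact MonoidalCategory.whiskerLeft_id _ _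
  comm := by
    induction n with
    | zero => intro i j h1 h2; omega
    | succ n ih =>
      intro i j h1 h2
      obtain ⟨k, rfl⟩ : ∃ k, j = k + 1 := ⟨j - 1, by omega⟩
      cases i with
      | zero =>
        obtain ⟨m, rfl⟩ : ∃ m, n = m + 1 := ⟨n - 1, by omega⟩
        obtain ⟨l, rfl⟩ : ∃ l, k = l + 1 := ⟨k - 1, by omega⟩
        exact (braidFront_naturality X X (adjBraid X m l)).symm
      | succ i =>
        have := ih i k (by omega) (by omega)
        rw [End.mul_def, End.mul_def] at this ⊢
        change X ◁ adjBraid X n k ≫ X ◁ adjBraid X n i = X ◁ adjBraid X n i ≫ X ◁ adjBraid X n k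
        rw [← MonoidalCategory.whiskerLeft_comp, this, MonoidalCategory.whiskerLeft_comp]
  braid := by
    induction n with
    | zero => intro i h; omega
    | succ n ih =>
      intro i h
      cases i with
      | zero =>
        obtain ⟨m, rfl⟩ : ∃ m, n = m + 2 := ⟨n - 2, by omega⟩
        exact braidFront_yang_baxter X X X (tensorPow X m)
      | succ i =>
        have := ih i (by omega)
        simp only [End.mul_def] at this ⊢
        change X ◁ adjBraid X n i ≫ X ◁ adjBraid X n (i + 1) ≫ X ◁ adjBraid X n i =
          X ◁ adjBraid X n (i + 1) ≫ X ◁ adjBraid X n i ≫ X ◁ adjBraid X n (i + 1)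
        rw [← MonoidalCategory.whiskerLeft_comp, ← MonoidalCategory.whiskerLeft_comp, this,
          MonoidalCategory.whiskerLeft_comp, MonoidalCategory.whiskerLeft_comp]

/-- The action of the symmetric group on the tensor power `X^{⊗ n}`, given on adjacent
transpositions by the braiding. (On vector spaces, `σ` sends `v₁ ⊗ ⋯ ⊗ vₙ` to the tensor with
`vᵢ` in position `σ i`.) -/
noncomputable def permAction (X : 𝒞) (n : ℕ) : Equiv.Perm (Fin n) →* End (tensorPow X n) :=
  (exists_permHom n (adjBraid X n) (adjBraid_coxeterRel X n)).choose

theorem permAction_adjSwap (X : 𝒞) (n i : ℕ) (hi : i + 1 < n) :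
    permAction X n (adjSwap n i) = adjBraid X n i :=
  (exists_permHom n (adjBraid X n) (adjBraid_coxeterRel X n)).choose_spec i hi

end Action

section Schur

/-- The row symmetrizer `∑ p` of a finite set `D` of cells (`(i, j)` is the cell in row `i` and
column `j`): the sum of all permutations of the cells that preserve the rows. -/
noncomputable def rowSymmetrizer (D : Finset (ℕ × ℕ)) : MonoidAlgebra ℚ (Equiv.Perm D) := by
  classical
  exact ∑ p : Equiv.Perm D with ∀ x, (p x).1.1 = x.1.1, MonoidAlgebra.of ℚ _ p

/-- The column antisymmetrizer `∑ sgn(q) q` of a finite set `D` of cells: the signed sum of all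
permutations of the cells that preserve the columns. -/
noncomputable def colAntisymmetrizer (D : Finset (ℕ × ℕ)) :
    MonoidAlgebra ℚ (Equiv.Perm D) := by
  classical
  exact ∑ q : Equiv.Perm D with ∀ x, (q x).1.2 = x.1.2,
    ((Equiv.Perm.sign q : ℤ) : ℚ) • MonoidAlgebra.of ℚ _ q

variable {𝒞 : Type*} [Category 𝒞] [Preadditive 𝒞] [Linear ℚ 𝒞] [MonoidalCategory 𝒞]
  [SymmetricCategory 𝒞]

/-- The action of the group algebra of the permutations of the cells of `D` on the tensor power
of `X` with one factor for each cell. -/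
noncomputable def cellAction (D : Finset (ℕ × ℕ)) (X : 𝒞) :
    MonoidAlgebra ℚ (Equiv.Perm D) →ₐ[ℚ] End (tensorPow X D.card) :=
  MonoidAlgebra.lift ℚ _ _ ((permAction X D.card).comp D.equivFin.permCongrHom.toMonoidHom)

/-- The Young symmetrizer `c = a b` (`a` the row symmetrizer, `b` the column antisymmetrizer) of
`D` as an endomorphism of the tensor power of `X`. As usual, it acts from the right, where
`v · σ = σ⁻¹ v`; since `a` and `b` are fixed by `σ ↦ σ⁻¹`, this is the left action of `b a`. -/
noncomputable def youngEnd (D : Finset (ℕ × ℕ)) (X : 𝒞) :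
    tensorPow X D.card ⟶ tensorPow X D.card :=
  cellAction D X (colAntisymmetrizer D * rowSymmetrizer D)

theorem exists_regular {G : Type*} [Group G] [Finite G] (c : MonoidAlgebra ℚ G) :
    ∃ x : MonoidAlgebra ℚ G, c * x * c = c := by
  obtain ⟨J, hJ⟩ := exists_isCompl (Ideal.span {c})
  obtain ⟨u, hu, v, hv, huv⟩ := Submodule.mem_sup.1
    (show (1 : MonoidAlgebra ℚ G) ∈ Ideal.span {c} ⊔ J by rw [hJ.sup_eq_top]; trivial)
  obtain ⟨x, rfl⟩ := Ideal.mem_span_singleton'.1 hu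
  refine ⟨x, ?_⟩
  have h1 : c * v = c - c * x * c := by
    rw [eq_sub_iff_add_eq', mul_assoc, ← mul_add, huv, mul_one]
  have h2 : c * v ∈ Ideal.span {c} := by
    rw [h1]
    exact Ideal.mem_span_singleton'.2 ⟨1 - c * x, by rw [sub_mul, one_mul]⟩
  have h3 := Submodule.disjoint_def.1 hJ.disjoint _ h2 (J.smul_mem c hv)
  rw [h1, sub_eq_zero] at h3
  exact h3.symm

/-- In a `ℚ`-linear category with split idempotents, the Young symmetrizer has an image, by a
split epimorphism followed by a split monomorphism. -/
theorem exists_schur [IsIdempotentComplete 𝒞] (D : Finset (ℕ × ℕ)) (X : 𝒞) :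
    ∃ (Y : 𝒞) (p : tensorPow X D.card ⟶ Y) (i : Y ⟶ tensorPow X D.card),
      IsSplitEpi p ∧ IsSplitMono i ∧ p ≫ i = youngEnd D X := by
  obtain ⟨x, hx⟩ := exists_regular (colAntisymmetrizer D * rowSymmetrizer D)
  have h := congrArg (cellAction D X) hx
  rw [map_mul, map_mul, End.mul_def, End.mul_def] at h
  set g : tensorPow X D.card ⟶ tensorPow X D.card := youngEnd D X with hg
  set y : tensorPow X D.card ⟶ tensorPow X D.card := cellAction D X x
  have h' : g ≫ y ≫ g = g := h
  obtain ⟨Y, i, e, h1, h2⟩ :=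
    IsIdempotentComplete.idempotents_split _ (y ≫ g) (by rw [Category.assoc, h'])
  refine ⟨Y, g ≫ e, i, ⟨⟨⟨i ≫ y, ?_⟩⟩⟩, ⟨⟨⟨e, h1⟩⟩⟩, ?_⟩
  · rw [Category.assoc, ← Category.assoc y, ← h2, Category.assoc, h1, Category.comp_id, h1]
  · rw [Category.assoc, h2, h']

/-- The Schur functor of a finite set `D` of cells at the object `X`: the image of the Young
symmetrizer of `D` on the tensor power of `X` with one factor for each cell. -/
noncomputable def schurObj [IsIdempotentComplete 𝒞] (D : Finset (ℕ × ℕ)) (X : 𝒞) : 𝒞 :=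
  (exists_schur D X).choose

end Schur

/-- The signs `(-1)^i` that enter the differential of the tensor product of cochain complexes. -/
instance : ComplexShape.TensorSigns (ComplexShape.up ℕ) where
  ε' := MonoidHom.mk' (fun (i : ℕ) => (-1 : ℤˣ) ^ i) (pow_add (-1 : ℤˣ))
  rel_add p q r (hpq : p + 1 = q) := by change p + r + 1 = q + r; lia
  add_rel p q r (hpq : p + 1 = q) := by change r + p + 1 = r + q; lia
  ε'_succ := by
    rintro p _ rfl
    change (-1 : ℤˣ) ^ (p + 1) = - (-1 : ℤˣ) ^ p
    rw [pow_succ, mul_neg_one]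

section Signs

variable {𝒞 : Type*} [Category 𝒞] [Preadditive 𝒞] [MonoidalCategory 𝒞] [MonoidalPreadditive 𝒞]

theorem units_smul_whiskerRight (u : ℤˣ) {X Y : 𝒞} (f : X ⟶ Y) (Z : 𝒞) :
    (u • f) ▷ Z = u • (f ▷ Z) := by
  rcases Int.units_eq_one_or u with rfl | rfl
  · simp
  · rw [Units.neg_smul, Units.neg_smul, one_smul, one_smul]
    exact (tensoringRight 𝒞).obj Z |>.map_neg

theorem whiskerLeft_units_smul (u : ℤˣ) (Z : 𝒞) {X Y : 𝒞} (f : X ⟶ Y) :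
    Z ◁ (u • f) = u • (Z ◁ f) := by
  rcases Int.units_eq_one_or u with rfl | rfl
  · simp
  · rw [Units.neg_smul, Units.neg_smul, one_smul, one_smul]
    exact (tensoringLeft 𝒞).obj Z |>.map_neg

end Signs

section Koszul

open HomologicalComplex

variable {𝒞 : Type*} [Category 𝒞] [Preadditive 𝒞] [HasFiniteBiproducts 𝒞] [MonoidalCategory 𝒞]
  [MonoidalPreadditive 𝒞]

instance : HasFiniteBiproducts (CochainComplex 𝒞 ℕ) :=
  have : HasFiniteCoproducts (CochainComplex 𝒞 ℕ) :=
    ⟨fun _ => inferInstance⟩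
  HasFiniteBiproducts.of_hasFiniteCoproducts

/-- The inclusion of the summand `K.X i ⊗ L.X j` of the tensor product of complexes. -/
noncomputable abbrev ιT (K L : CochainComplex 𝒞 ℕ) (i j n : ℕ) (h : i + j = n) :
    K.X i ⊗ L.X j ⟶ (K ⊗ L).X n := ιTensorObj K L i j n h

theorem ιT_d (K L : CochainComplex 𝒞 ℕ) (i j n : ℕ) (h : i + j = n) :
    ιT K L i j n h ≫ (K ⊗ L).d n (n + 1) =
      K.d i (i + 1) ▷ L.X j ≫ ιT K L (i + 1) j (n + 1) (by omega) +
        ((-1 : ℤˣ) ^ i) • (K.X i ◁ L.d j (j + 1) ≫ ιT K L i (j + 1) (n + 1) (by omega)) := by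
  have h1 := mapBifunctor.d₁_eq K L (curriedTensor 𝒞) (ComplexShape.up ℕ) (i₁ := i) (i₁' := i + 1)
    rfl j (n + 1) (by change i + 1 + j = n + 1; omega)
  have h2 := mapBifunctor.d₂_eq K L (curriedTensor 𝒞) (ComplexShape.up ℕ) i (i₂ := j) (i₂' := j + 1)
    rfl (n + 1) (by change i + (j + 1) = n + 1; omega)
  change ιMapBifunctor K L (curriedTensor 𝒞) (ComplexShape.up ℕ) i j n h ≫
    (mapBifunctor K L (curriedTensor 𝒞) (ComplexShape.up ℕ)).d n (n + 1) = _
  rw [mapBifunctor.d_eq, Preadditive.comp_add, mapBifunctor.ι_D₁, mapBifunctor.ι_D₂, h1, h2]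
  change (1 : ℤˣ) • _ + _ = _
  rw [one_smul]
  rfl

theorem ιT_ext {K L : CochainComplex 𝒞 ℕ} {n : ℕ} {A : 𝒞} {f g : (K ⊗ L).X n ⟶ A}
    (h : ∀ i j (hij : i + j = n), ιT K L i j n hij ≫ f = ιT K L i j n hij ≫ g) : f = g :=
  mapBifunctor.hom_ext (fun i j hij => h i j hij)

variable [SymmetricCategory 𝒞]

/-- The Koszul braiding in degree `n`. -/
noncomputable def koszulX (K L : CochainComplex 𝒞 ℕ) (n : ℕ) : (K ⊗ L).X n ⟶ (L ⊗ K).X n :=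
  mapBifunctorDesc (fun i j h => ((-1 : ℤˣ) ^ (i * j)) • ((β_ (K.X i) (L.X j)).hom ≫
    ιT L K j i n (by rw [add_comm]; exact h)))

theorem ιT_koszulX (K L : CochainComplex 𝒞 ℕ) (i j n : ℕ) (h : i + j = n) :
    ιT K L i j n h ≫ koszulX K L n = ((-1 : ℤˣ) ^ (i * j)) • ((β_ (K.X i) (L.X j)).hom ≫
      ιT L K j i n (by omega)) :=
  ι_mapBifunctorDesc _ _ _ _

theorem koszulX_comp (K L : CochainComplex 𝒞 ℕ) (n : ℕ) :
    koszulX K L n ≫ koszulX L K n = 𝟙 _ := by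
  apply ιT_ext
  intro i j h
  rw [← Category.assoc, ιT_koszulX, Linear.units_smul_comp, Category.assoc, ιT_koszulX,
    Linear.comp_units_smul, smul_smul, mul_comm j i, Int.units_mul_self, one_smul,
    SymmetricCategory.symmetry_assoc, Category.comp_id]

theorem koszulX_d (K L : CochainComplex 𝒞 ℕ) (n : ℕ) :
    koszulX K L n ≫ (L ⊗ K).d n (n + 1) = (K ⊗ L).d n (n + 1) ≫ koszulX K L (n + 1) := by
  apply ιT_ext
  intro i j h
  rw [← Category.assoc, ιT_koszulX, Linear.units_smul_comp, Category.assoc, ιT_d,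
    ← Category.assoc, ιT_d, Preadditive.add_comp, Linear.units_smul_comp, Category.assoc,
    Category.assoc, ιT_koszulX, ιT_koszulX, Preadditive.comp_add, smul_add]
  refine (add_comm _ _).trans ?_
  congr 1
  · rw [Linear.comp_units_smul, Linear.comp_units_smul, smul_smul,
      BraidedCategory.braiding_naturality_left_assoc]
    congr 1
    rw [add_mul, one_mul, pow_add]
  · rw [Linear.comp_units_smul, smul_smul, BraidedCategory.braiding_naturality_right_assoc]
    congr 1
    rw [mul_add, mul_one, pow_add, mul_left_comm, Int.units_mul_self, mul_one]

/-- The Koszul braiding of the tensor product of complexes: on `K.X i ⊗ L.X j` it is `(-1)^(i j)`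
times the braiding of `𝒞`. -/
noncomputable def koszulBraiding (K L : CochainComplex 𝒞 ℕ) : K ⊗ L ≅ L ⊗ K where
  hom := { f := koszulX K L, comm' := by rintro i _ rfl; exact koszulX_d K L i }
  inv := { f := koszulX L K, comm' := by rintro i _ rfl; exact koszulX_d L K i }
  hom_inv_id := by ext n; exact koszulX_comp K L n
  inv_hom_id := by ext n; exact koszulX_comp L K n

theorem ιT_whiskerRight {K K' : CochainComplex 𝒞 ℕ} (f : K ⟶ K') (L : CochainComplex 𝒞 ℕ)
    (i j n : ℕ) (h : i + j = n) :
    ιT K L i j n h ≫ (f ▷ L).f n = f.f i ▷ L.X j ≫ ιT K' L i j n h := by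
  refine (ι_mapBifunctorMap f (𝟙 L) (curriedTensor 𝒞) (ComplexShape.up ℕ) i j n h).trans ?_
  change f.f i ▷ L.X j ≫ K'.X i ◁ 𝟙 (L.X j) ≫ ιT K' L i j n h = _
  rw [MonoidalCategory.whiskerLeft_id, Category.id_comp]

theorem ιT_whiskerLeft (K : CochainComplex 𝒞 ℕ) {L L' : CochainComplex 𝒞 ℕ} (f : L ⟶ L')
    (i j n : ℕ) (h : i + j = n) :
    ιT K L i j n h ≫ (K ◁ f).f n = K.X i ◁ f.f j ≫ ιT K L' i j n h := by
  refine (ι_mapBifunctorMap (𝟙 K) f (curriedTensor 𝒞) (ComplexShape.up ℕ) i j n h).trans ?_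
  change 𝟙 (K.X i) ▷ L.X j ≫ K.X i ◁ f.f j ≫ ιT K L' i j n h = _
  rw [MonoidalCategory.id_whiskerRight, Category.id_comp]

theorem ιT_associator_hom (K L M : CochainComplex 𝒞 ℕ) (i j k ij jk n : ℕ) (hij : i + j = ij)
    (hjk : j + k = jk) (h : i + j + k = n) :
    ιT K L i j ij hij ▷ M.X k ≫ ιT (K ⊗ L) M ij k n (by omega) ≫ (α_ K L M).hom.f n =
      (α_ (K.X i) (L.X j) (M.X k)).hom ≫ K.X i ◁ ιT L M j k jk hjk ≫
        ιT K (L ⊗ M) i jk n (by omega) := by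
  have h1 := ι_mapBifunctorAssociatorX_hom (curriedAssociatorNatIso 𝒞) K L M
    (ComplexShape.up ℕ) (ComplexShape.up ℕ) (ComplexShape.up ℕ) i j k n h
  have h2 := mapBifunctor₁₂.ι_eq (curriedTensor 𝒞) (curriedTensor 𝒞) K L M
    (ComplexShape.up ℕ) (ComplexShape.up ℕ) i j k ij n hij (by change ij + k = n; omega)
  have h3 := mapBifunctor₂₃.ι_eq (curriedTensor 𝒞) (curriedTensor 𝒞) K L M
    (ComplexShape.up ℕ) (ComplexShape.up ℕ) (ComplexShape.up ℕ) i j k jk n hjk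
    (by change i + jk = n; omega)
  refine Eq.trans ?_ (h1.trans ?_)
  · refine (Category.assoc _ _ _).symm.trans ?_
    exact congrArg (fun f => f ≫ (α_ K L M).hom.f n) h2.symm
  · exact congrArg (fun f => (α_ (K.X i) (L.X j) (M.X k)).hom ≫ f) h3

theorem ιT_ext₃ {K L M : CochainComplex 𝒞 ℕ} {n : ℕ} {A : 𝒞} {f g : ((K ⊗ L) ⊗ M).X n ⟶ A}
    (H : ∀ i j k (h : i + j + k = n),
      ιT K L i j (i + j) rfl ▷ M.X k ≫ ιT (K ⊗ L) M (i + j) k n h ≫ f =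
      ιT K L i j (i + j) rfl ▷ M.X k ≫ ιT (K ⊗ L) M (i + j) k n h ≫ g) : f = g := by
  refine mapBifunctor₁₂.hom_ext (F₁₂ := curriedTensor 𝒞) (G := curriedTensor 𝒞)
    (K₁ := K) (K₂ := L) (K₃ := M) (c₁₂ := ComplexShape.up ℕ) (c₄ := ComplexShape.up ℕ) ?_
  intro i j k h
  have h2 := mapBifunctor₁₂.ι_eq (curriedTensor 𝒞) (curriedTensor 𝒞) K L M
    (ComplexShape.up ℕ) (ComplexShape.up ℕ) i j k (i + j) n rfl h
  rw [h2]
  refine (Category.assoc _ _ _).trans ((H i j k h).trans (Category.assoc _ _ _).symm)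

theorem ιT_koszulX_tensor_right (K L M : CochainComplex 𝒞 ℕ) (i jk n : ℕ) (h : i + jk = n)
  {A : 𝒞} (f : A ⟶ (L ⊗ M).X jk) :
    K.X i ◁ f ≫ ιT K (L ⊗ M) i jk n h ≫ koszulX K (L ⊗ M) n =
      ((-1 : ℤˣ) ^ (i * jk)) • ((β_ (K.X i) A).hom ≫ f ▷ K.X i ≫
        ιT (L ⊗ M) K jk i n (by omega)) := by
  rw [ιT_koszulX, Linear.comp_units_smul, BraidedCategory.braiding_naturality_right_assoc]

theorem hexagon (K L M : CochainComplex 𝒞 ℕ) :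
    (α_ K L M).hom ≫ (koszulBraiding K (L ⊗ M)).hom ≫ (α_ L M K).hom =
      (koszulBraiding K L).hom ▷ M ≫ (α_ L K M).hom ≫ L ◁ (koszulBraiding K M).hom := by
  ext n
  apply ιT_ext₃
  intro i j k h
  change ιT K L i j (i + j) rfl ▷ M.X k ≫ ιT (K ⊗ L) M (i + j) k n h ≫ (α_ K L M).hom.f n ≫
    koszulX K (L ⊗ M) n ≫ (α_ L M K).hom.f n =
    ιT K L i j (i + j) rfl ▷ M.X k ≫ ιT (K ⊗ L) M (i + j) k n h ≫
      ((koszulBraiding K L).hom ▷ M).f n ≫ (α_ L K M).hom.f n ≫ (L ◁ (koszulBraiding K M).hom).f n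
  have e1 := ιT_associator_hom K L M i j k (i + j) (j + k) n rfl rfl h
  have e2 := ιT_associator_hom L M K j k i (j + k) (k + i) n rfl rfl (by omega)
  have e3 := ιT_associator_hom L K M j i k (i + j) (i + k) n (by omega) rfl (by omega)
  have r1 := congrArg (fun f => f ≫ koszulX K (L ⊗ M) n ≫ (α_ L M K).hom.f n) e1
  simp only [Category.assoc] at r1
  rw [r1]
  have r2 := congrArg (fun f => f ≫ (α_ L M K).hom.f n)
    (ιT_koszulX_tensor_right K L M i (j + k) n (by omega) (ιT L M j k (j + k) rfl))
  simp only [Category.assoc, Linear.units_smul_comp] at r2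
  rw [r2, e2]
  have r3 := congrArg (fun f => f ≫ (α_ L K M).hom.f n ≫ (L ◁ (koszulBraiding K M).hom).f n)
    (ιT_whiskerRight (koszulBraiding K L).hom M (i + j) k n h)
  simp only [Category.assoc] at r3
  rw [r3]
  have r4 : ιT K L i j (i + j) rfl ▷ M.X k ≫ (koszulBraiding K L).hom.f (i + j) ▷ M.X k =
      ((-1 : ℤˣ) ^ (i * j)) • ((β_ (K.X i) (L.X j)).hom ▷ M.X k ≫
        ιT L K j i (i + j) (by omega) ▷ M.X k) := by
    rw [← comp_whiskerRight, ← comp_whiskerRight, ← units_smul_whiskerRight]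
    exact congrArg (fun f => f ▷ M.X k) (ιT_koszulX K L i j (i + j) rfl)
  have r5 := congrArg (fun f => f ≫ ιT (L ⊗ K) M (i + j) k n h ≫ (α_ L K M).hom.f n ≫
    (L ◁ (koszulBraiding K M).hom).f n) r4
  simp only [Category.assoc, Linear.units_smul_comp] at r5
  rw [r5]
  have r6 := congrArg (fun f => f ≫ (L ◁ (koszulBraiding K M).hom).f n) e3
  simp only [Category.assoc] at r6
  rw [r6, ιT_whiskerLeft]
  have r7 : L.X j ◁ ιT K M i k (i + k) rfl ≫ L.X j ◁ (koszulBraiding K M).hom.f (i + k) =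
      ((-1 : ℤˣ) ^ (i * k)) • (L.X j ◁ (β_ (K.X i) (M.X k)).hom ≫
        L.X j ◁ ιT M K k i (i + k) (by omega)) := by
    rw [← MonoidalCategory.whiskerLeft_comp, ← MonoidalCategory.whiskerLeft_comp,
      ← whiskerLeft_units_smul]
    exact congrArg (fun f => L.X j ◁ f) (ιT_koszulX K M i k (i + k) rfl)
  have r8 := congrArg (fun f => f ≫ ιT L (M ⊗ K) j (i + k) n (by omega)) r7
  simp only [Category.assoc, Linear.units_smul_comp] at r8
  rw [r8]
  simp only [Linear.comp_units_smul, smul_smul, ← pow_add, ← mul_add]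
  congr 1
  rw [BraidedCategory.braiding_tensor_right_hom]
  simp only [Category.assoc, Iso.hom_inv_id_assoc, Iso.inv_hom_id_assoc]
  have r9 : ∀ (a b : ℕ) (hab : a = b) (h1 : k + i = a) (h2 : k + i = b) (h3 : j + a = n)
      (h4 : j + b = n), L.X j ◁ ιT M K k i a h1 ≫ ιT L (M ⊗ K) j a n h3 =
        L.X j ◁ ιT M K k i b h2 ≫ ιT L (M ⊗ K) j b n h4 := by
    rintro a _ rfl h1 h2 h3 h4; rfl
  rw [r9 (k + i) (i + k) (by omega) _ (by omega) _ (by omega)]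

/-- The symmetric monoidal category of (non-negatively graded) cochain complexes, with the Koszul
sign rule. -/
noncomputable instance : SymmetricCategory (CochainComplex 𝒞 ℕ) where
  braiding := koszulBraiding
  braiding_naturality_right K L L' f := by
    ext n
    apply ιT_ext
    intro i j h
    change ιT K L i j n h ≫ (K ◁ f).f n ≫ koszulX K L' n =
      ιT K L i j n h ≫ koszulX K L n ≫ (f ▷ K).f n
    rw [← Category.assoc, ιT_whiskerLeft, Category.assoc, ιT_koszulX, ← Category.assoc,
      ιT_koszulX, Linear.units_smul_comp, Linear.comp_units_smul, Category.assoc,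
      ιT_whiskerRight, BraidedCategory.braiding_naturality_right_assoc]
  braiding_naturality_left {K K'} f L := by
    ext n
    apply ιT_ext
    intro i j h
    change ιT K L i j n h ≫ (f ▷ L).f n ≫ koszulX K' L n =
      ιT K L i j n h ≫ koszulX K L n ≫ (L ◁ f).f n
    rw [← Category.assoc, ιT_whiskerRight, Category.assoc, ιT_koszulX, ← Category.assoc,
      ιT_koszulX, Linear.units_smul_comp, Linear.comp_units_smul, Category.assoc,
      ιT_whiskerLeft, BraidedCategory.braiding_naturality_left_assoc]
  hexagon_forward := hexagon
  hexagon_reverse K L M := by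
    have h : α_ M K L ≪≫ koszulBraiding M (K ⊗ L) ≪≫ α_ K L M =
        whiskerRightIso (koszulBraiding M K) L ≪≫ α_ K M L ≪≫
          whiskerLeftIso K (koszulBraiding M L) := Iso.ext (hexagon M K L)
    have h' := congrArg Iso.inv h
    simp only [Iso.trans_inv, whiskerRightIso_inv, whiskerLeftIso_inv, Category.assoc] at h'
    exact h'
  symmetry K L := (koszulBraiding K L).hom_inv_id

end Koszul

section Exact

variable {𝒞 : Type*} [Category 𝒞] [Preadditive 𝒞]

/-- The admissible monomorphisms of a class `E` of short complexes. -/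
def IsInflation (E : ShortComplex 𝒞 → Prop) {X Y : 𝒞} (f : X ⟶ Y) : Prop :=
  ∃ (Z : 𝒞) (g : Y ⟶ Z) (w : f ≫ g = 0), E (ShortComplex.mk f g w)

/-- The admissible epimorphisms of a class `E` of short complexes. -/
def IsDeflation (E : ShortComplex 𝒞 → Prop) {Y Z : 𝒞} (g : Y ⟶ Z) : Prop :=
  ∃ (X : 𝒞) (f : X ⟶ Y) (w : f ≫ g = 0), E (ShortComplex.mk f g w)

/-- Quillen exact structures on an additive category: the members of `E` are the exact sequences
`0 → X → Y → Z → 0` of the structure. -/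
structure IsExactStructure (E : ShortComplex 𝒞 → Prop) : Prop where
  of_iso : ∀ S T : ShortComplex 𝒞, (S ≅ T) → E S → E T
  isKernel : ∀ S : ShortComplex 𝒞, E S → Nonempty (IsLimit (KernelFork.ofι S.f S.zero))
  isCokernel : ∀ S : ShortComplex 𝒞, E S → Nonempty (IsColimit (CokernelCofork.ofπ S.g S.zero))
  id_inflation : ∀ X : 𝒞, IsInflation E (𝟙 X)
  id_deflation : ∀ X : 𝒞, IsDeflation E (𝟙 X)
  comp_inflation : ∀ {X Y Z : 𝒞} (f : X ⟶ Y) (g : Y ⟶ Z),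
    IsInflation E f → IsInflation E g → IsInflation E (f ≫ g)
  comp_deflation : ∀ {X Y Z : 𝒞} (f : X ⟶ Y) (g : Y ⟶ Z),
    IsDeflation E f → IsDeflation E g → IsDeflation E (f ≫ g)
  pushout : ∀ {X Y X' : 𝒞} (i : X ⟶ Y) (f : X ⟶ X'), IsInflation E i →
    ∃ (Y' : 𝒞) (f' : Y ⟶ Y') (i' : X' ⟶ Y'), IsPushout i f f' i' ∧ IsInflation E i'
  pullback : ∀ {Y Z Z' : 𝒞} (p : Y ⟶ Z) (f : Z' ⟶ Z), IsDeflation E p →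
    ∃ (Y' : 𝒞) (f' : Y' ⟶ Y) (p' : Y' ⟶ Z'), IsPullback f' p' p f ∧ IsDeflation E p'

/-- The tensor product is exact for `E` in its second variable; in a symmetric monoidal category
it is then exact in each variable. -/
def TensorExact [MonoidalCategory 𝒞] [MonoidalPreadditive 𝒞] (E : ShortComplex 𝒞 → Prop) : Prop :=
  ∀ (X : 𝒞) (S : ShortComplex 𝒞), E S → E (S.map (tensorLeft X))

/-- `R` is a resolution of `A`: the sequence `0 → A → R⁰ → R¹ → ⋯` is exact for `E`, that is, it is
obtained by splicing exact sequences `0 → Z n → Rⁿ → Z (n + 1) → 0` with `Z 0 ≅ A`. -/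
def IsResolution (E : ShortComplex 𝒞 → Prop) (A : 𝒞) (R : CochainComplex 𝒞 ℕ) : Prop :=
  ∃ (Z : ℕ → 𝒞) (i : ∀ n, Z n ⟶ R.X n) (p : ∀ n, R.X n ⟶ Z (n + 1)) (w : ∀ n, i n ≫ p n = 0),
    Nonempty (A ≅ Z 0) ∧ (∀ n, E (ShortComplex.mk (i n) (p n) (w n))) ∧
      ∀ n, R.d n (n + 1) = p n ≫ i (n + 1)

/-- Exactness of a short sequence of complexes: exactness in each degree. -/
def DegreewiseExact (E : ShortComplex 𝒞 → Prop) (S : ShortComplex (CochainComplex 𝒞 ℕ)) : Prop :=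
  ∀ n, E (S.map (HomologicalComplex.eval 𝒞 (ComplexShape.up ℕ) n))

end Exact

section Pieces

instance (lam : YoungDiagram) (k : ℕ) : Finite {μ : YoungDiagram // μ ≤ lam ∧ μ.card = k} :=
  Finite.of_injective
    (fun μ => (⟨μ.1.cells, Finset.mem_powerset.2 (YoungDiagram.cells_subset_iff.2 μ.2.1)⟩ :
      lam.cells.powerset))
    (fun _ _ h => Subtype.ext (YoungDiagram.ext (congrArg (fun z => z.1) h)))

variable {𝒞 : Type*} [Category 𝒞] [Preadditive 𝒞] [Linear ℚ 𝒞] [HasFiniteBiproducts 𝒞]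
  [MonoidalCategory 𝒞] [MonoidalPreadditive 𝒞] [SymmetricCategory 𝒞]

/-- The object `X` as a complex concentrated in degree `n`. -/
noncomputable abbrev inDegree (n : ℕ) (X : 𝒞) : CochainComplex 𝒞 ℕ :=
  (HomologicalComplex.single 𝒞 (ComplexShape.up ℕ) n).obj X

/-- The complex `⨁ S_{λ/μ}(B) ⊗ S_μ(C[1])`, the sum being over the Young diagrams `μ ⊆ λ` with `k`
cells. Here `B` is in degree `0`, and `C[1]` is `C` in degree `1`. -/
noncomputable def gradedPiece [IsIdempotentComplete 𝒞] (lam : YoungDiagram) (k : ℕ) (B C : 𝒞) :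
    CochainComplex 𝒞 ℕ :=
  ⨁ fun μ : {μ : YoungDiagram // μ ≤ lam ∧ μ.card = k} =>
    schurObj (lam.cells \ μ.1.cells) (inDegree 0 B) ⊗ schurObj μ.1.cells (inDegree 1 C)

end Pieces

end SchurExt

/-! Let `K` be the complex `B → C` in degrees 0 and 1. The resolution is `R = S_λ(K)`, and the
filtration is that by stupid truncations. Two facts make this work.

First, `S_λ(K)` resolves `S_λ(A)`. The complex `K` resolves `A`, and by exactness of the tensor
product `K^{⊗m}` resolves `A^{⊗m}` (`resolvesVia_powAug`, by induction with `ResolvesVia.tensor`,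
which realises the cocycles of `K ⊗ R` as fibre products). The augmentation is equivariant, because
Koszul signs are trivial in degree 0. The rational group algebra is semisimple, so the Young
symmetrizer `c` satisfies `c x c = c` for some `x`; the Schur functor is then cut out by the
idempotent `x c`, the same for `A` and `K`, and a direct summand of a resolution is a resolution
(`ResolvesVia.retract`, which rests on the stability of exact sequences under retracts).

Second, the `k`-th graded piece of the truncation filtration is `R^k` in degree `k`, and `R^k` has
to be identified. The terms of `S_λ(K)` do not depend on the differential of `K`
(`exists_schur_X_iso`), so `K` may be replaced by `B ⊕ C[1]`. Then the branching rule `S_λ(X ⊕ Y) ≅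
⨁_{μ ⊆ λ} S_{λ/μ}(X) ⊗ S_μ(Y)` applies (`exists_schur_sum_decomposition`), and with `X = B`, `Y =
C[1]` the summand of `μ` lives in degree `|μ|` only.

The branching rule is proved inside an algebra `Λ` that contains an action of the permutations of
the cells and orthogonal idempotents `E w`, one for each set `w` of cells (`SubsetSystem`); for `(X
⊕ Y)^{⊗n}` the idempotent `E w` selects the factors in which `Y` is taken. On the sets `w` that are
lower in rows and columns, the blocks `E u c E w` are triangular for the sum of the row numbers, and
the diagonal block at `w` is the product of the Young symmetrizers of the complement and of `w`
(`E_mul_young_mul_E_eq_zero`, `E_mul_young_mul_E_self`). With `δ` the sum of these diagonal blocks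
and `y` a quasi-inverse, triangularity gives `v δ y c y δ = δ` for some `v` (`exists_unipotent`).

For the converse, `c` must lie in `c y δ Λ` (`exists_factorization`). In the regular representation
this is a count: standard tableaux bound the rank of `c` from above by Garnir straightening
(`youngElt_mul_of_mem_span`), and the rank of `δ` from below by a triangularity argument
(`linearIndependent_diagonal_std`). The regular representation maps to every `SubsetSystem` by
`orbitMap`, which carries the factorization over. Together the two relations make the images of `c`
and `δ` isomorphic (`exists_image_comparison`). -/

namespace SchurExt

/-! ### Sets of cells and the sum of their row numbers -/

section Words

/-- The sum of the values of `R` over the set with indicator function `v`. -/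
def wordWeight {ι : Type*} [Fintype ι] (R : ι → ℕ) (v : ι → Bool) : ℕ :=
  ∑ x, if v x then R x else 0

theorem wordWeight_perm {ι : Type*} [Fintype ι] (R : ι → ℕ) (p : Equiv.Perm ι)
    (hp : ∀ x, R (p x) = R x) (v v' : ι → Bool) (hv : ∀ x, v' (p x) = v x) :
    wordWeight R v' = wordWeight R v := by
  unfold wordWeight
  rw [← Equiv.sum_comp p]
  simp only [hp, hv]

/-- If `v'` is obtained from `v` by moving elements inside the fibres of `C`, and if `v'` is a
lower set in each fibre, then `v'` has the smaller weight. -/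
theorem wordWeight_le_of_low {ι : Type*} [Fintype ι] (R C : ι → ℕ) (p : Equiv.Perm ι)
    (hp : ∀ x, C (p x) = C x) (v v' : ι → Bool) (hv : ∀ x, v' (p x) = v x)
    (hlow : ∀ x y, C x = C y → R x ≤ R y → v' y → v' x) :
    wordWeight R v' ≤ wordWeight R v ∧ (wordWeight R v' = wordWeight R v → v' = v) := by
  classical
  -- A lower set of a fibre is cut off at a height `τ`; the `+ 1` makes the inequality strict and
  -- gives `τ = 0` on the fibres that `v'` misses.
  let τ : ℕ → ℕ := fun j => (Finset.univ.filter fun x => C x = j ∧ v' x).sup fun x => R x + 1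
  have hτ : ∀ x, v' x ↔ R x < τ (C x) := by
    intro x
    constructor
    · intro hx
      exact Nat.lt_of_succ_le
        (Finset.le_sup (f := fun x => R x + 1) (by simp [hx]))
    · intro hx
      obtain ⟨y, hy, hxy⟩ := (Finset.lt_sup_iff).1 hx
      simp only [Finset.mem_filter, Finset.mem_univ, true_and] at hy
      exact hlow x y hy.1.symm (by omega) hy.2
  let b : (ι → Bool) → ι → ℤ := fun v x => if v x then 1 else 0
  -- An odd number, hence never zero, and negative exactly where `v'` holds. So every exchange of an
  -- element of `v'` for one outside has a strictly positive cost.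
  let h : ι → ℤ := fun x => 2 * (R x : ℤ) + 1 - 2 * τ (C x)
  have hterm : ∀ x, 0 ≤ (b v x - b v' x) * h x ∧ ((b v x - b v' x) * h x = 0 → v' x = v x) := by
    intro x
    have := hτ x
    simp only [b, h]
    cases hv1 : v x <;> cases hv2 : v' x <;> simp [hv2] at this ⊢ <;> omega
  -- Both sets have the same number of elements in each fibre, so the part of `h` that depends only
  -- on the fibre cancels in the difference.
  have hre : ∀ f : ℕ → ℤ, ∑ x, b v' x * f (C x) = ∑ x, b v x * f (C x) := by
    intro f
    rw [← Equiv.sum_comp p]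
    simp only [hp, b, hv]
  have hw : ∀ v : ι → Bool, (wordWeight R v : ℤ) = ∑ x, b v x * (R x : ℤ) := by
    intro v
    simp only [wordWeight, b]
    push_cast
    refine Finset.sum_congr rfl fun x _ => ?_
    split_ifs <;> simp
  have hsum : ∑ x, (b v x - b v' x) * h x = 2 * ((wordWeight R v : ℤ) - wordWeight R v') := by
    have e : ∀ v : ι → Bool, ∑ x, b v x * h x =
        2 * (wordWeight R v : ℤ) + ∑ x, b v x * (fun j => 1 - 2 * (τ j : ℤ)) (C x) := by
      intro v
      rw [hw, Finset.mul_sum, ← Finset.sum_add_distrib]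
      refine Finset.sum_congr rfl fun x _ => ?_
      simp only [h]; ring
    simp only [sub_mul, Finset.sum_sub_distrib]
    rw [e, e, hre fun j => 1 - 2 * (τ j : ℤ)]; ring
  have hnn : 0 ≤ ∑ x, (b v x - b v' x) * h x := Finset.sum_nonneg fun x _ => (hterm x).1
  refine ⟨by omega, fun he => ?_⟩
  have h0 : ∑ x, (b v x - b v' x) * h x = 0 := by omega
  rw [Finset.sum_eq_zero_iff_of_nonneg (fun x _ => (hterm x).1)] at h0
  funext x
  exact (hterm x).2 (h0 x (Finset.mem_univ x))

variable {D : Finset (ℕ × ℕ)}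

/-- The lower sets in rows and columns. -/
structure IsLow (w : D → Bool) : Prop where
  row : ∀ x y : D, x.1.1 = y.1.1 → x.1.2 ≤ y.1.2 → w y → w x
  col : ∀ x y : D, x.1.2 = y.1.2 → x.1.1 ≤ y.1.1 → w y → w x

/-- The sum of the row numbers. -/
def rowWeight (w : D → Bool) : ℕ := wordWeight (fun x : D => x.1.1) w

/-- The row permutation `p` does not change the row weight, and the column permutation `q` then
pushes the set up to a lower set, which is extremal. In the equality case `q` does nothing to the
moved set `u`, so `u` is itself lower in rows; comparing column numbers in both directions within
the rows forces `u = w`. This is the source of all triangularity below. -/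
theorem rowWeight_le_of_low {p q : Equiv.Perm D} (hp : ∀ x, (p x).1.1 = x.1.1)
    (hq : ∀ x, (q x).1.2 = x.1.2) {w w' : D → Bool} (hw : IsLow w) (hw' : IsLow w')
    (h : ∀ x, w' (q (p x)) = w x) :
    rowWeight w' ≤ rowWeight w ∧
      (rowWeight w' = rowWeight w → w' = w ∧ ∀ x, w (p x) = w x) := by
  let u : D → Bool := fun x => w (p.symm x)
  have hu : ∀ x, u (p x) = w x := fun x => by simp [u]
  have h1 : rowWeight u = rowWeight w := wordWeight_perm _ p hp _ _ hu
  have h2 := wordWeight_le_of_low (fun x : D => x.1.1) (fun x => x.1.2) q hq u w'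
    (fun x => by simpa [u] using h (p.symm x)) hw'.col
  refine ⟨h2.1.trans h1.le, fun he => ?_⟩
  have h3 : w' = u := h2.2 (he.trans h1.symm)
  have h4 := wordWeight_le_of_low (fun x : D => x.1.2) (fun x => x.1.1) p hp w u hu
    (h3 ▸ hw'.row)
  have h5 := wordWeight_le_of_low (fun x : D => x.1.2) (fun x => x.1.1) p.symm
    (fun x => by simpa using (hp (p.symm x)).symm) u w (fun x => rfl) hw.row
  have h6 : u = w := h4.2 (le_antisymm h4.1 h5.1)
  exact ⟨h3.trans h6, fun x => (congrFun h6 (p x)).symm.trans (hu x)⟩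

end Words

/-! ### Standard tableaux and their dominance order -/

section Tableaux

variable {D : Finset (ℕ × ℕ)}

/-- The permutation `g` is a standard tableau if the entries `ℓ x` in the cells `g x` increase
along the rows and columns. -/
structure IsStd (ℓ : D → ℕ) (g : Equiv.Perm D) : Prop where
  row : ∀ x y : D, (g x).1.1 = (g y).1.1 → (g x).1.2 < (g y).1.2 → ℓ x < ℓ y
  col : ∀ x y : D, (g x).1.2 = (g y).1.2 → (g x).1.1 < (g y).1.1 → ℓ x < ℓ y

/-- The cells of the tableau `g` with entries less than `j`. -/
def below (ℓ : D → ℕ) (g : Equiv.Perm D) (j : ℕ) : D → Bool := fun x => decide (ℓ (g.symm x) < j)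

theorem IsStd.isLow_below {ℓ : D → ℕ} {g : Equiv.Perm D} (h : IsStd ℓ g) (j : ℕ) :
    IsLow (below ℓ g j) := by
  constructor
  · intro x y hxy hle hy
    simp only [below, decide_eq_true_eq] at hy ⊢
    rcases hle.eq_or_lt with he | hlt
    · rwa [show x = y from Subtype.ext (Prod.ext hxy he)]
    · exact (h.row (g.symm x) (g.symm y) (by simpa using hxy) (by simpa using hlt)).trans hy
  · intro x y hxy hle hy
    simp only [below, decide_eq_true_eq] at hy ⊢
    rcases hle.eq_or_lt with he | hlt
    · rwa [show x = y from Subtype.ext (Prod.ext he hxy)]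
    · exact (h.col (g.symm x) (g.symm y) (by simpa using hxy) (by simpa using hlt)).trans hy

/-- A numerical measure of the dominance order of tableaux. -/
def tableauWeight (ℓ : D → ℕ) (g : Equiv.Perm D) : ℕ :=
  -- The bound `+ 2` includes `j = ℓ x + 1` for the largest entry, so that these sets determine the
  -- tableau.
  ∑ j ∈ Finset.range (Finset.univ.sup ℓ + 2), rowWeight (below ℓ g j)

theorem eq_of_below_eq {ℓ : D → ℕ} (hℓ : Function.Injective ℓ) {g g' : Equiv.Perm D}
    (h : ∀ j ∈ Finset.range (Finset.univ.sup ℓ + 2), below ℓ g j = below ℓ g' j) : g = g' := by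
  have key : ∀ x, ℓ (g.symm x) = ℓ (g'.symm x) := by
    intro x
    have hb : ∀ y, ℓ y ≤ Finset.univ.sup ℓ := fun y => Finset.le_sup (Finset.mem_univ y)
    have h1 := hb (g.symm x)
    have h2 := hb (g'.symm x)
    have h3 := congrFun (h (ℓ (g.symm x) + 1) (Finset.mem_range.2 (by omega))) x
    have h4 := congrFun (h (ℓ (g'.symm x) + 1) (Finset.mem_range.2 (by omega))) x
    simp only [below, decide_eq_decide] at h3 h4
    omega
  have : g.symm = g'.symm := Equiv.ext fun x => hℓ (key x)
  rw [← Equiv.symm_symm g, this, Equiv.symm_symm]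

/-- Apply `rowWeight_le_of_low` to the lower set of entries less than `j`, for each `j`. If the
total does not drop, then no set moves, and the sets recover the tableau. -/
theorem tableauWeight_le {ℓ : D → ℕ} (hℓ : Function.Injective ℓ) {p q g g' : Equiv.Perm D}
    (hp : ∀ x, (p x).1.1 = x.1.1) (hq : ∀ x, (q x).1.2 = x.1.2) (hg : IsStd ℓ g)
    (hg' : IsStd ℓ g') (h : q * p * g = g') :
    tableauWeight ℓ g' < tableauWeight ℓ g ∨ g' = g := by
  subst h
  have hj : ∀ j x, below ℓ (q * p * g) j (q (p x)) = below ℓ g j x := by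
    intro j x
    simp only [below]
    have : (q * p * g).symm (q (p x)) = g.symm x := by
      rw [Equiv.symm_apply_eq]; simp
    rw [this]
  have key := fun j => rowWeight_le_of_low hp hq (hg.isLow_below j) (hg'.isLow_below j) (hj j)
  have hle : tableauWeight ℓ (q * p * g) ≤ tableauWeight ℓ g :=
    Finset.sum_le_sum fun j _ => (key j).1
  rcases hle.lt_or_eq with hlt | heq
  · exact Or.inl hlt
  · right
    have := (Finset.sum_eq_sum_iff_of_le fun j _ => (key j).1).1 heq
    exact eq_of_below_eq hℓ fun j hj' => ((key j).2 (this j hj')).1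

theorem eq_one_of_row_col {p q : Equiv.Perm D} (hp : ∀ x, (p x).1.1 = x.1.1)
    (hq : ∀ x, (q x).1.2 = x.1.2) (h : q * p = 1) : p = 1 := by
  ext1 x
  have h1 : q (p x) = x := by simpa using Equiv.congr_fun h x
  have h2 := hq (p x)
  rw [h1] at h2
  exact Subtype.ext (Prod.ext (hp x) h2.symm)

end Tableaux

/-! ### Garnir relations and straightening -/

section Garnir

variable {D : Finset (ℕ × ℕ)}

theorem rowSymmetrizer_mul_of {p : Equiv.Perm D} (hp : ∀ x, (p x).1.1 = x.1.1) :
    rowSymmetrizer D * MonoidAlgebra.of ℚ _ p = rowSymmetrizer D := by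
  classical
  unfold rowSymmetrizer
  rw [Finset.sum_mul]
  refine Finset.sum_bij' (fun r _ => r * p) (fun r _ => r * p⁻¹) ?_ ?_ ?_ ?_ ?_
  · intro r hr
    simp only [Finset.mem_filter, Finset.mem_univ, true_and] at hr ⊢
    intro x
    rw [Equiv.Perm.mul_apply, hr, hp]
  · intro r hr
    simp only [Finset.mem_filter, Finset.mem_univ, true_and] at hr ⊢
    intro x
    rw [Equiv.Perm.mul_apply, hr, ← hp (p⁻¹ x)]
    simp
  · intro r _; simp
  · intro r _; simp
  · intro r _; rw [map_mul]

theorem colAntisymmetrizer_mul_of {q : Equiv.Perm D} (hq : ∀ x, (q x).1.2 = x.1.2) :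
    colAntisymmetrizer D * MonoidAlgebra.of ℚ _ q =
      ((Equiv.Perm.sign q : ℤ) : ℚ) • colAntisymmetrizer D := by
  classical
  unfold colAntisymmetrizer
  rw [Finset.sum_mul, Finset.smul_sum]
  refine Finset.sum_bij' (fun r _ => r * q) (fun r _ => r * q⁻¹) ?_ ?_ ?_ ?_ ?_
  · intro r hr
    simp only [Finset.mem_filter, Finset.mem_univ, true_and] at hr ⊢
    intro x
    rw [Equiv.Perm.mul_apply, hr, hq]
  · intro r hr
    simp only [Finset.mem_filter, Finset.mem_univ, true_and] at hr ⊢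
    intro x
    rw [Equiv.Perm.mul_apply, hr, ← hq (q⁻¹ x)]
    simp
  · intro r _; simp
  · intro r _; simp
  · intro r _
    rw [smul_mul_assoc, smul_smul, Equiv.Perm.sign_mul, map_mul]
    congr 1
    rcases Int.units_eq_one_or (Equiv.Perm.sign q) with h | h <;> simp [h]

/-- The Young symmetrizer, as an element of the group algebra. -/
noncomputable def youngElt (D : Finset (ℕ × ℕ)) : MonoidAlgebra ℚ (Equiv.Perm D) :=
  colAntisymmetrizer D * rowSymmetrizer D

theorem youngElt_mul_of {p : Equiv.Perm D} (hp : ∀ x, (p x).1.1 = x.1.1) :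
    youngElt D * MonoidAlgebra.of ℚ _ p = youngElt D := by
  rw [youngElt, mul_assoc, rowSymmetrizer_mul_of hp]

/-- The sum of the permutations that fix all cells outside `X`. -/
noncomputable def fixingSum (X : D → Prop) : MonoidAlgebra ℚ (Equiv.Perm D) := by
  classical
  exact ∑ t : Equiv.Perm D with ∀ x, ¬ X x → t x = x, MonoidAlgebra.of ℚ _ t

theorem of_swap_mul_fixingSum [DecidableEq D] {X : D → Prop} {x y : D} (hx : X x) (hy : X y) :
    MonoidAlgebra.of ℚ _ (Equiv.swap x y) * fixingSum X = fixingSum X := by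
  classical
  have hs : ∀ t : Equiv.Perm D, (∀ z, ¬ X z → t z = z) →
      ∀ z, ¬ X z → (Equiv.swap x y * t) z = z := by
    intro t ht z hz
    rw [Equiv.Perm.mul_apply, ht z hz, Equiv.swap_apply_of_ne_of_ne]
    · rintro rfl; exact hz hx
    · rintro rfl; exact hz hy
  unfold fixingSum
  rw [Finset.mul_sum]
  refine Finset.sum_bij' (fun r _ => Equiv.swap x y * r) (fun r _ => Equiv.swap x y * r)
    ?_ ?_ ?_ ?_ ?_
  · intro r hr
    simp only [Finset.mem_filter, Finset.mem_univ, true_and] at hr ⊢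
    exact hs r hr
  · intro r hr
    simp only [Finset.mem_filter, Finset.mem_univ, true_and] at hr ⊢
    exact hs r hr
  · intro r _; simp
  · intro r _; simp
  · intro r _; rw [map_mul]

/-- For each row permutation `p`, the transposition of `x` and `y` is absorbed by the sum over the
permutations of `X`. Moved to the left of `p` it becomes the transposition of `p x` and `p y`, which
preserves columns and is turned into `-1` by the column antisymmetrizer. So each summand equals its
own negative. -/
theorem youngElt_mul_fixingSum {X : D → Prop}
    (h : ∀ p : Equiv.Perm D, (∀ x, (p x).1.1 = x.1.1) →
      ∃ x y, X x ∧ X y ∧ x ≠ y ∧ (p x).1.2 = (p y).1.2) :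
    youngElt D * fixingSum X = 0 := by
  classical
  rw [youngElt, mul_assoc, rowSymmetrizer, Finset.sum_mul, Finset.mul_sum]
  refine Finset.sum_eq_zero fun p hp => ?_
  simp only [Finset.mem_filter, Finset.mem_univ, true_and] at hp
  obtain ⟨x, y, hx, hy, hxy, hc⟩ := h p hp
  have hq : ∀ z, (Equiv.swap (p x) (p y) z).1.2 = z.1.2 := by
    intro z
    rcases Equiv.swap_apply_eq_iff.1 (rfl : Equiv.swap (p x) (p y) z = _) with _
    by_cases h1 : z = p x
    · rw [h1, Equiv.swap_apply_left, hc]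
    by_cases h2 : z = p y
    · rw [h2, Equiv.swap_apply_right, hc]
    rw [Equiv.swap_apply_of_ne_of_ne h1 h2]
  have e : colAntisymmetrizer D * (MonoidAlgebra.of ℚ _ p * fixingSum X) =
      - (colAntisymmetrizer D * (MonoidAlgebra.of ℚ _ p * fixingSum X)) := by
    conv_lhs => rw [← of_swap_mul_fixingSum hx hy, ← mul_assoc (MonoidAlgebra.of ℚ _ p),
      ← map_mul, Equiv.mul_swap_eq_swap_mul, map_mul, mul_assoc, ← mul_assoc,
      colAntisymmetrizer_mul_of hq, Equiv.Perm.sign_swap (p.injective.ne hxy)]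
    simp
  have e2 : (2 : ℚ) • (colAntisymmetrizer D * (MonoidAlgebra.of ℚ _ p * fixingSum X)) = 0 := by
    rw [two_smul]
    exact add_eq_zero_iff_eq_neg.2 e
  exact (smul_eq_zero.1 e2).resolve_left two_ne_zero

/-- Moving large labels to places of large value increases the sum of the products. -/
theorem sum_mul_lt_of_perm {ι : Type*} [Fintype ι] (L C : ι → ℕ) (t : Equiv.Perm ι) (θ : ℕ)
    (h : ∀ z, (L z ≤ θ → C (t z) ≤ C z) ∧ (θ < L z → C z ≤ C (t z)))
    (h' : ∃ z, C (t z) ≠ C z) : ∑ z, L z * C z < ∑ z, L z * C (t z) := by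
  -- The labels are compared with `θ + 1/2`, doubled to stay in the integers. The constant
  -- contributes nothing to the sum, since `t` only permutes the values of `C`.
  have h1 : ∀ z, 0 ≤ (2 * (L z : ℤ) - 2 * θ - 1) * ((C (t z) : ℤ) - C z) := by
    intro z
    rcases Nat.lt_or_ge θ (L z) with hz | hz
    · exact mul_nonneg (by omega) (by have := (h z).2 hz; omega)
    · exact mul_nonneg_of_nonpos_of_nonpos (by omega) (by have := (h z).1 hz; omega)
  obtain ⟨z₀, hz₀⟩ := h'
  have h2 : (2 * (L z₀ : ℤ) - 2 * θ - 1) * ((C (t z₀) : ℤ) - C z₀) ≠ 0 :=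
    mul_ne_zero (by omega) (by omega)
  have h3 : 0 < ∑ z, (2 * (L z : ℤ) - 2 * θ - 1) * ((C (t z) : ℤ) - C z) :=
    Finset.sum_pos' (fun z _ => h1 z) ⟨z₀, Finset.mem_univ _, lt_of_le_of_ne (h1 z₀) h2.symm⟩
  have h4 : ∑ z, ((C (t z) : ℤ)) = ∑ z, (C z : ℤ) := Equiv.sum_comp t (fun z => (C z : ℤ))
  have h5 : ∑ z, (2 * (L z : ℤ) - 2 * θ - 1) * ((C (t z) : ℤ) - C z) =
      2 * (∑ z, (L z : ℤ) * C (t z) - ∑ z, (L z : ℤ) * C z) -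
        (2 * θ + 1) * (∑ z, (C (t z) : ℤ) - ∑ z, (C z : ℤ)) := by
    rw [← Finset.sum_sub_distrib, ← Finset.sum_sub_distrib, Finset.mul_sum, Finset.mul_sum,
      ← Finset.sum_sub_distrib]
    exact Finset.sum_congr rfl fun z _ => by ring
  rw [h4, sub_self, mul_zero, sub_zero] at h5
  have h6 : (∑ z, (L z : ℤ) * C z) < ∑ z, (L z : ℤ) * C (t z) := by omega
  exact_mod_cast h6

/-- The sum of the products of the entries of the tableau `g` with the values `C` of the cells. -/
def entrySum (ℓ C : D → ℕ) (g : Equiv.Perm D) : ℕ := ∑ x, ℓ x * C (g x)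

theorem entrySum_lt (ℓ C : D → ℕ) (t g : Equiv.Perm D) (θ : ℕ)
    (h : ∀ z, (ℓ z ≤ θ → C (t (g z)) ≤ C (g z)) ∧ (θ < ℓ z → C (g z) ≤ C (t (g z))))
    (h' : ∃ z, C (t z) ≠ C z) : entrySum ℓ C g < entrySum ℓ C (t * g) := by
  have e : ∀ f : D → ℕ, ∑ x, ℓ x * f (g x) = ∑ z, ℓ (g.symm z) * f z := by
    intro f
    rw [← Equiv.sum_comp g.symm]
    simp
  have := sum_mul_lt_of_perm (fun z => ℓ (g.symm z)) C t θ
    (fun z => by simpa using h (g.symm z)) h'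
  unfold entrySum
  rw [e C]
  refine this.trans_eq ?_
  exact (e fun z => C (t z)).symm

/-- Pigeonhole for the Garnir set: the part of row `i` from column `j` on together with the part of
row `i'` up to column `j` has one cell more than row `i`. After a row permutation, every column met
by this set is a column of row `i`, because `D` is a lower set. -/
theorem exists_same_column (hD : IsLowerSet (D : Set (ℕ × ℕ))) {i i' j : ℕ} (hi : i < i')
    (hz : (i', j) ∈ D) (p : Equiv.Perm D) (hp : ∀ x, (p x).1.1 = x.1.1) :
    ∃ x y : D, (x.1.1 = i ∧ j ≤ x.1.2 ∨ x.1.1 = i' ∧ x.1.2 ≤ j) ∧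
      (y.1.1 = i ∧ j ≤ y.1.2 ∨ y.1.1 = i' ∧ y.1.2 ≤ j) ∧ x ≠ y ∧ (p x).1.2 = (p y).1.2 := by
  classical
  by_contra! hcon
  let X := {x : D // x.1.1 = i ∧ j ≤ x.1.2 ∨ x.1.1 = i' ∧ x.1.2 ≤ j}
  let Y := {x : D // x.1.1 = i}
  have hφ : ∀ x : X, (i, (p x.1).1.2) ∈ D := by
    intro x
    refine hD (show (i, (p x.1).1.2) ≤ (p x.1).1 from ⟨?_, le_rfl⟩) (p x.1).2
    rw [hp]
    rcases x.2 with h | h <;> simp only <;> omega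
  let φ : X → Y := fun x => ⟨⟨(i, (p x.1).1.2), hφ x⟩, rfl⟩
  have hφi : Function.Injective φ := by
    intro x y hxy
    by_contra hne
    exact hcon x.1 y.1 x.2 y.2 (fun h => hne (Subtype.ext h))
      (congrArg (fun z : Y => z.1.1.2) hxy)
  have hψ : ∀ y : Y, y.1.1.2 ≤ j → (i', y.1.1.2) ∈ D := fun y hy =>
    hD (show (i', y.1.1.2) ≤ (i', j) from ⟨le_rfl, hy⟩) hz
  -- An injection of row `i` into the Garnir set which misses `(i', j)`: the cells left of column
  -- `j` are pushed down to row `i'`.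
  let ψ : Y → X := fun y => if h : j ≤ y.1.1.2 then ⟨y.1, Or.inl ⟨y.2, h⟩⟩ else
    ⟨⟨(i', y.1.1.2), hψ y (by omega)⟩, Or.inr ⟨rfl, by simp only; omega⟩⟩
  have hψi : Function.Injective ψ := by
    intro y y' h
    have h2 : y.1.1.2 = y'.1.1.2 := by
      have := congrArg (fun z : X => z.1.1.2) h
      simp only [ψ] at this
      split_ifs at this <;> exact this
    exact Subtype.ext (Subtype.ext (Prod.ext (y.2.trans y'.2.symm) h2))
  have hsurj := Finite.surjective_of_injective (hψi.comp hφi)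
  obtain ⟨x, hx⟩ := hsurj ⟨⟨(i', j), hz⟩, Or.inr ⟨rfl, le_rfl⟩⟩
  have h1 := congrArg (fun z : X => z.1.1) hx
  simp only [Function.comp, ψ] at h1
  split_ifs at h1 with h
  · have := congrArg Prod.fst h1
    rw [(φ x).2] at this
    simp only at this
    omega
  · have := congrArg Prod.snd h1
    simp only at this
    omega

/-- The straightening of tableaux. -/
theorem youngElt_mul_of_mem_span (hD : IsLowerSet (D : Set (ℕ × ℕ))) {ℓ : D → ℕ}
    (hℓ : Function.Injective ℓ) (g : Equiv.Perm D) :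
    youngElt D * MonoidAlgebra.of ℚ _ g ∈
      Submodule.span ℚ (Set.range fun s : {s : Equiv.Perm D // IsStd ℓ s} =>
        youngElt D * MonoidAlgebra.of ℚ _ s.1) := by
  classical
  set V := Submodule.span ℚ (Set.range fun s : {s : Equiv.Perm D // IsStd ℓ s} =>
    youngElt D * MonoidAlgebra.of ℚ _ s.1)
  -- A counterexample with maximal key is shown to be standard. Large entries far down raise the
  -- first component, and large entries far to the right raise the second.
  let key : Equiv.Perm D → ℕ ×ₗ ℕ := fun g =>
    toLex (entrySum ℓ (fun x => x.1.1) g, entrySum ℓ (fun x => x.1.2) g)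
  by_contra hcon
  obtain ⟨g, hg, hmax⟩ := Finset.exists_max_image
    (Finset.univ.filter fun g => youngElt D * MonoidAlgebra.of ℚ _ g ∉ V) key
    ⟨g, by simpa using hcon⟩
  simp only [Finset.mem_filter, Finset.mem_univ, true_and] at hg hmax
  have hgood : ∀ g', key g < key g' → youngElt D * MonoidAlgebra.of ℚ _ g' ∈ V := by
    intro g' h
    by_contra h'
    exact (hmax g' h').not_gt h
  have hrow : ∀ x y : D, (g x).1.1 = (g y).1.1 → (g x).1.2 < (g y).1.2 → ℓ x < ℓ y := by
    intro x y h1 h2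
    by_contra h3
    have hne : x ≠ y := by rintro rfl; omega
    have h4 : ℓ y < ℓ x := lt_of_le_of_ne (not_lt.1 h3) (hℓ.ne hne.symm)
    have hp : ∀ z, (Equiv.swap (g x) (g y) z).1.1 = z.1.1 := by
      intro z
      by_cases e1 : z = g x
      · rw [e1, Equiv.swap_apply_left, h1]
      by_cases e2 : z = g y
      · rw [e2, Equiv.swap_apply_right, h1]
      rw [Equiv.swap_apply_of_ne_of_ne e1 e2]
    refine hg ?_
    -- The row transposition is absorbed by the Young symmetrizer. It fixes the first component of
    -- the key and raises the second.
    rw [← youngElt_mul_of hp, mul_assoc, ← map_mul]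
    refine hgood _ (Prod.Lex.toLex_lt_toLex.2 (Or.inr ⟨?_, ?_⟩))
    · simp only [entrySum, Equiv.Perm.mul_apply, hp]
    · refine entrySum_lt ℓ (fun x => x.1.2) _ g (ℓ y) (fun z => ?_)
        ⟨g x, by rw [Equiv.swap_apply_left]; omega⟩
      by_cases e1 : z = x
      · subst e1
        rw [Equiv.swap_apply_left]
        exact ⟨fun h => by omega, fun _ => h2.le⟩
      by_cases e2 : z = y
      · subst e2
        rw [Equiv.swap_apply_right]
        exact ⟨fun _ => h2.le, fun h => by omega⟩
      rw [Equiv.swap_apply_of_ne_of_ne (g.injective.ne e1) (g.injective.ne e2)]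
      exact ⟨fun _ => le_rfl, fun _ => le_rfl⟩
  refine hg (Submodule.subset_span ⟨⟨g, hrow, ?_⟩, rfl⟩)
  intro x y h1 h2
  by_contra h3
  have hne : x ≠ y := by rintro rfl; omega
  have h4 : ℓ y < ℓ x := lt_of_le_of_ne (not_lt.1 h3) (hℓ.ne hne.symm)
  -- The Garnir set of a descent in a column.
  let X : D → Prop := fun z => z.1.1 = (g x).1.1 ∧ (g x).1.2 ≤ z.1.2 ∨
    z.1.1 = (g y).1.1 ∧ z.1.2 ≤ (g x).1.2
  have h0 : youngElt D * fixingSum X = 0 :=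
    youngElt_mul_fixingSum fun p hp => exists_same_column hD h2
      (by rw [h1]; exact (g y).2) p hp
  have hsum : ∑ t : Equiv.Perm D with ∀ x, ¬ X x → t x = x,
      youngElt D * MonoidAlgebra.of ℚ _ (t * g) = 0 := by
    have : youngElt D * fixingSum X * MonoidAlgebra.of ℚ _ g = 0 := by rw [h0, zero_mul]
    rw [← this, fixingSum, Finset.mul_sum, Finset.sum_mul]
    refine Finset.sum_congr (by ext; simp) fun t _ => ?_
    rw [map_mul, mul_assoc]
  -- The entry `ℓ y` separates the two halves of the Garnir set, by the monotonicity along rows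
  -- already obtained. Hence a permutation of the set can only move larger entries down and smaller
  -- ones up, and it raises the first component of the key unless it preserves rows.
  have hX1 : ∀ z, (g z).1.1 = (g x).1.1 → (g x).1.2 ≤ (g z).1.2 → ℓ y < ℓ z := by
    intro z e1 e2
    rcases e2.eq_or_lt with e3 | e3
    · have : g z = g x := Subtype.ext (Prod.ext e1 e3.symm)
      rwa [g.injective this]
    · exact h4.trans (hrow x z e1.symm e3)
  have hX2 : ∀ z, (g z).1.1 = (g y).1.1 → (g z).1.2 ≤ (g x).1.2 → ℓ z ≤ ℓ y := by
    intro z e1 e2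
    rcases e2.eq_or_lt with e3 | e3
    · have : g z = g y := Subtype.ext (Prod.ext e1 (e3.trans h1))
      rw [g.injective this]
    · exact (hrow z y e1 (e3.trans_eq h1)).le
  have hmem : ∀ t ∈ (Finset.univ.filter fun t : Equiv.Perm D => ∀ x, ¬ X x → t x = x),
      ¬ (∀ z, (t z).1.1 = z.1.1) → youngElt D * MonoidAlgebra.of ℚ _ (t * g) ∈ V := by
    intro t ht hrowt
    simp only [Finset.mem_filter, Finset.mem_univ, true_and] at ht
    have htX : ∀ z, X z → X (t z) := by
      intro z hz
      by_contra hn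
      have := t.injective (ht _ hn)
      exact hn (by rwa [this])
    refine hgood _ (Prod.Lex.toLex_lt_toLex.2 (Or.inl ?_))
    refine entrySum_lt ℓ (fun x => x.1.1) t g (ℓ y) (fun z => ?_) (not_forall.1 hrowt)
    by_cases hz : X (g z)
    · have := htX _ hz
      rcases hz with ⟨e1, e2⟩ | ⟨e1, e2⟩
      · have h5 := hX1 z e1 e2
        refine ⟨fun h => by omega, fun _ => ?_⟩
        rcases this with ⟨e3, -⟩ | ⟨e3, -⟩ <;> omega
      · have h5 := hX2 z e1 e2
        refine ⟨fun _ => ?_, fun h => by omega⟩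
        rcases this with ⟨e3, -⟩ | ⟨e3, -⟩ <;> omega
    · rw [ht _ hz]
      exact ⟨fun _ => le_rfl, fun _ => le_rfl⟩
  rw [← Finset.sum_filter_add_sum_filter_not _ (fun t : Equiv.Perm D => ∀ z, (t z).1.1 = z.1.1)]
    at hsum
  have hconst : ∀ t ∈ ((Finset.univ.filter fun t : Equiv.Perm D => ∀ x, ¬ X x → t x = x).filter
      fun t : Equiv.Perm D => ∀ z, (t z).1.1 = z.1.1),
      youngElt D * MonoidAlgebra.of ℚ _ (t * g) = youngElt D * MonoidAlgebra.of ℚ _ g := by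
    intro t ht
    rw [map_mul, ← mul_assoc, youngElt_mul_of (Finset.mem_filter.1 ht).2]
  -- The row-preserving terms of the Garnir relation all equal the given element. The identity is
  -- among them, so their number `m` is nonzero and the relation can be solved for that element.
  rw [Finset.sum_congr rfl hconst, Finset.sum_const, ← Nat.cast_smul_eq_nsmul ℚ] at hsum
  set m := ((Finset.univ.filter fun t : Equiv.Perm D => ∀ x, ¬ X x → t x = x).filter
      fun t : Equiv.Perm D => ∀ z, (t z).1.1 = z.1.1).card
  have hm : (m : ℚ) ≠ 0 := by
    have : 0 < m := Finset.card_pos.2 ⟨1, by simp⟩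
    positivity
  have hV : (m : ℚ) • (youngElt D * MonoidAlgebra.of ℚ _ g) ∈ V := by
    rw [eq_neg_of_add_eq_zero_left hsum]
    refine V.neg_mem (V.sum_mem fun t ht => ?_)
    rw [Finset.mem_filter] at ht
    exact hmem t ht.1 ht.2
  exact hg ((V.smul_mem_iff hm).1 hV)

end Garnir

/-! ### Subsets of cells and products of Young symmetrizers -/

section Restriction

variable {A B D : Finset (ℕ × ℕ)}

/-- The extension of permutations of the cells of `A` by the identity. -/
noncomputable def inclHom (h : A ⊆ D) : Equiv.Perm A →* Equiv.Perm D :=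
  Equiv.Perm.viaEmbeddingHom ⟨fun x => ⟨x.1, h x.2⟩, fun _ _ e =>
    Subtype.ext (congrArg (fun z : D => z.1) e)⟩

theorem inclHom_apply (h : A ⊆ D) (a : Equiv.Perm A) (x : D) (hx : x.1 ∈ A) :
    inclHom h a x = ⟨(a ⟨x.1, hx⟩).1, h (a ⟨x.1, hx⟩).2⟩ :=
  Equiv.Perm.viaEmbedding_apply a ⟨fun x : A => (⟨x.1, h x.2⟩ : D), _⟩ ⟨x.1, hx⟩

theorem inclHom_apply_of_notMem (h : A ⊆ D) (a : Equiv.Perm A) (x : D) (hx : x.1 ∉ A) :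
    inclHom h a x = x :=
  Equiv.Perm.viaEmbedding_apply_of_notMem a _ x (by rintro ⟨y, rfl⟩; exact hx y.2)

theorem sign_inclHom (h : A ⊆ D) (a : Equiv.Perm A) :
    Equiv.Perm.sign (inclHom h a) = Equiv.Perm.sign a := by
  classical
  refine Eq.trans ?_ (Equiv.Perm.sign_extendDomain a (Equiv.ofInjective
    (fun x : A => (⟨x.1, h x.2⟩ : D)) fun _ _ e => Subtype.ext (congrArg (fun z : D => z.1) e)))
  refine congrArg Equiv.Perm.sign ?_
  rw [inclHom, Equiv.Perm.viaEmbeddingHom_apply, Equiv.Perm.viaEmbedding]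
  congr!

theorem inclHom_mem (h : A ⊆ D) (a : Equiv.Perm A) (x : D) : (inclHom h a x).1 ∈ A ↔ x.1 ∈ A := by
  by_cases hx : x.1 ∈ A
  · rw [inclHom_apply h a x hx]; simp [hx]
  · rw [inclHom_apply_of_notMem h a x hx]

/-- The extension of elements of the group algebra. -/
noncomputable def inclAlg (h : A ⊆ D) :
    MonoidAlgebra ℚ (Equiv.Perm A) →ₐ[ℚ] MonoidAlgebra ℚ (Equiv.Perm D) :=
  MonoidAlgebra.lift ℚ _ _ ((MonoidAlgebra.of ℚ _).comp (inclHom h))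

theorem inclAlg_of (h : A ⊆ D) (a : Equiv.Perm A) :
    inclAlg h (MonoidAlgebra.of ℚ _ a) = MonoidAlgebra.of ℚ _ (inclHom h a) := by
  simp [inclAlg]

theorem inclHom_commute (hA : A ⊆ D) (hB : B ⊆ D) (hAB : Disjoint A B) (a : Equiv.Perm A)
    (b : Equiv.Perm B) : inclHom hA a * inclHom hB b = inclHom hB b * inclHom hA a := by
  refine Equiv.Perm.Disjoint.commute fun x => ?_
  by_cases hx : x.1 ∈ A
  · exact Or.inr (inclHom_apply_of_notMem hB b x fun h => Finset.disjoint_left.1 hAB hx h)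
  · exact Or.inl (inclHom_apply_of_notMem hA a x hx)

theorem inclAlg_commute (hA : A ⊆ D) (hB : B ⊆ D) (hAB : Disjoint A B)
    (a : MonoidAlgebra ℚ (Equiv.Perm A)) (b : MonoidAlgebra ℚ (Equiv.Perm B)) :
    Commute (inclAlg hA a) (inclAlg hB b) := by
  induction a using MonoidAlgebra.induction_on with
  | of a =>
    induction b using MonoidAlgebra.induction_on with
    | of b =>
      rw [inclAlg_of, inclAlg_of]
      change _ * _ = _ * _
      rw [← map_mul, ← map_mul, inclHom_commute hA hB hAB]
    | add x y hx hy => rw [map_add]; exact hx.add_right hy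
    | smul r x hx => rw [map_smul]; exact hx.smul_right r
  | add x y hx hy => rw [map_add]; exact hx.add_left hy
  | smul r x hx => rw [map_smul]; exact hx.smul_left r

/-- The restriction of a permutation to a stable subset. -/
def restrictPerm (p : Equiv.Perm D) (h : A ⊆ D) (hp : ∀ x, (p x).1 ∈ A ↔ x.1 ∈ A) :
    Equiv.Perm A where
  toFun x := ⟨(p ⟨x.1, h x.2⟩).1, (hp _).2 x.2⟩
  invFun x := ⟨(p.symm ⟨x.1, h x.2⟩).1, (hp _).1 (by simp)⟩
  left_inv x := by simp
  right_inv x := by simp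

/-- The stabilizer of `B` is the product of the permutation groups of `D \ B` and of `B`. -/
theorem sum_stabilizer {N : Type*} [AddCommMonoid N] (hB : B ⊆ D) (F : Equiv.Perm D → N)
    [DecidablePred fun p : Equiv.Perm D => ∀ x, (p x).1 ∈ B ↔ x.1 ∈ B] :
    ∑ p : Equiv.Perm D with (∀ x, (p x).1 ∈ B ↔ x.1 ∈ B), F p =
      ∑ a : Equiv.Perm ↥(D \ B), ∑ b : Equiv.Perm B,
        F (inclHom Finset.sdiff_subset a * inclHom hB b) := by
  classical
  rw [← Finset.sum_product', eq_comm]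
  have hd : ∀ x : D, x.1 ∈ D \ B ↔ x.1 ∉ B := fun x => by simp
  have happ : ∀ (a : Equiv.Perm ↥(D \ B)) (b : Equiv.Perm B) (x : D),
      (∀ h : x.1 ∈ B, ((inclHom Finset.sdiff_subset a * inclHom hB b : Equiv.Perm D) x).1 =
        (b ⟨x.1, h⟩).1) ∧
      (∀ h : x.1 ∈ D \ B, ((inclHom Finset.sdiff_subset a * inclHom hB b : Equiv.Perm D) x).1 =
        (a ⟨x.1, h⟩).1) := by
    intro a b x
    constructor
    · intro h
      rw [Equiv.Perm.mul_apply, inclHom_apply_of_notMem, inclHom_apply _ _ _ h]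
      rw [hd, not_not, inclHom_mem]
      exact h
    · intro h
      rw [Equiv.Perm.mul_apply, inclHom_apply_of_notMem hB b x ((hd x).1 h), inclHom_apply _ _ _ h]
  have hst : ∀ (a : Equiv.Perm ↥(D \ B)) (b : Equiv.Perm B) (x : D),
      ((inclHom Finset.sdiff_subset a * inclHom hB b : Equiv.Perm D) x).1 ∈ B ↔ x.1 ∈ B := by
    intro a b x
    by_cases h : x.1 ∈ B
    · rw [(happ a b x).1 h]; simp [h]
    · rw [(happ a b x).2 ((hd x).2 h)]
      simp only [h, iff_false]
      exact (Finset.mem_sdiff.1 (a ⟨x.1, (hd x).2 h⟩).2).2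
  refine Finset.sum_bij' (fun ab _ => inclHom Finset.sdiff_subset ab.1 * inclHom hB ab.2)
    (fun p hp => (restrictPerm p Finset.sdiff_subset (fun x => by
      rw [hd, hd, (Finset.mem_filter.1 hp).2]), restrictPerm p hB (Finset.mem_filter.1 hp).2))
    ?_ ?_ ?_ ?_ ?_
  · rintro ⟨a, b⟩ _
    simp only [Finset.mem_filter, Finset.mem_univ, true_and]
    exact hst a b
  · intro p hp; simp
  · rintro ⟨a, b⟩ _
    refine Prod.ext (Equiv.ext fun x => Subtype.ext ?_) (Equiv.ext fun x => Subtype.ext ?_)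
    · exact (happ a b ⟨x.1, Finset.sdiff_subset x.2⟩).2 x.2
    · exact (happ a b ⟨x.1, hB x.2⟩).1 x.2
  · intro p hp
    refine Equiv.ext fun x => Subtype.ext ?_
    by_cases h : x.1 ∈ B
    · exact (happ _ _ x).1 h
    · exact (happ _ _ x).2 ((hd x).2 h)
  · intros; rfl

theorem forall_incl_iff (hB : B ⊆ D) (a : Equiv.Perm ↥(D \ B)) (b : Equiv.Perm B) (f : ℕ × ℕ → ℕ) :
    (∀ x, f ((inclHom Finset.sdiff_subset a * inclHom hB b : Equiv.Perm D) x).1 = f x.1) ↔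
      (∀ x, f (a x).1 = f x.1) ∧ ∀ x, f (b x).1 = f x.1 := by
  have h1 : ∀ x : D, ∀ h : x.1 ∈ B,
      ((inclHom Finset.sdiff_subset a * inclHom hB b : Equiv.Perm D) x).1 = (b ⟨x.1, h⟩).1 := by
    intro x h
    rw [Equiv.Perm.mul_apply, inclHom_apply_of_notMem, inclHom_apply _ _ _ h]
    rw [Finset.mem_sdiff, not_and_not_right, inclHom_mem]
    exact fun _ => h
  have h2 : ∀ x : D, ∀ h : x.1 ∈ D \ B,
      ((inclHom Finset.sdiff_subset a * inclHom hB b : Equiv.Perm D) x).1 = (a ⟨x.1, h⟩).1 := by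
    intro x h
    rw [Equiv.Perm.mul_apply, inclHom_apply_of_notMem hB b x (Finset.mem_sdiff.1 h).2,
      inclHom_apply _ _ _ h]
  constructor
  · intro h
    refine ⟨fun x => ?_, fun x => ?_⟩
    · have := h ⟨x.1, Finset.sdiff_subset x.2⟩
      rwa [h2 _ x.2] at this
    · have := h ⟨x.1, hB x.2⟩
      rwa [h1 _ x.2] at this
  · rintro ⟨ha, hb⟩ x
    by_cases h : x.1 ∈ B
    · rw [h1 x h, hb]
    · rw [h2 x (Finset.mem_sdiff.2 ⟨x.2, h⟩), ha]

-- A permutation that stabilizes `B` preserves rows exactly when both of its components do, so this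
-- part of the row symmetrizer factors.
open Classical in
theorem rowSymmetrizer_stabilizer (hB : B ⊆ D) :
    ∑ p : Equiv.Perm D with (∀ x, (p x).1 ∈ B ↔ x.1 ∈ B),
      (if ∀ x, (p x).1.1 = x.1.1 then MonoidAlgebra.of ℚ _ p else 0) =
      inclAlg Finset.sdiff_subset (rowSymmetrizer (D \ B)) * inclAlg hB (rowSymmetrizer B) := by
  rw [sum_stabilizer hB, rowSymmetrizer, rowSymmetrizer, map_sum, map_sum, Finset.sum_mul_sum,
    Finset.sum_filter]
  refine Finset.sum_congr rfl fun a _ => ?_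
  rw [← Finset.sum_filter_add_sum_filter_not Finset.univ
    (fun b : Equiv.Perm B => ∀ x, (b x).1.1 = x.1.1)]
  have h2 := fun b => forall_incl_iff hB a b Prod.fst
  rw [Finset.sum_eq_zero (s := Finset.univ.filter fun b : Equiv.Perm B => ¬ _), add_zero]
  · split_ifs with ha
    · refine Finset.sum_congr rfl fun b hb => ?_
      rw [if_pos ((h2 b).2 ⟨ha, (Finset.mem_filter.1 hb).2⟩), inclAlg_of, inclAlg_of, map_mul]
    · exact Finset.sum_eq_zero fun b _ => if_neg fun h => ha ((h2 b).1 h).1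
  · exact fun b hb => if_neg fun h => (Finset.mem_filter.1 hb).2 ((h2 b).1 h).2

open Classical in
theorem colAntisymmetrizer_stabilizer (hB : B ⊆ D) :
    ∑ q : Equiv.Perm D with (∀ x, (q x).1 ∈ B ↔ x.1 ∈ B),
      (if ∀ x, (q x).1.2 = x.1.2 then
        ((Equiv.Perm.sign q : ℤ) : ℚ) • MonoidAlgebra.of ℚ _ q else 0) =
      inclAlg Finset.sdiff_subset (colAntisymmetrizer (D \ B)) *
        inclAlg hB (colAntisymmetrizer B) := by
  rw [sum_stabilizer hB, colAntisymmetrizer, colAntisymmetrizer, map_sum, map_sum,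
    Finset.sum_mul_sum, Finset.sum_filter]
  refine Finset.sum_congr rfl fun a _ => ?_
  rw [← Finset.sum_filter_add_sum_filter_not Finset.univ
    (fun b : Equiv.Perm B => ∀ x, (b x).1.2 = x.1.2)]
  have h2 := fun b => forall_incl_iff hB a b Prod.snd
  rw [Finset.sum_eq_zero (s := Finset.univ.filter fun b : Equiv.Perm B => ¬ _), add_zero]
  · split_ifs with ha
    · refine Finset.sum_congr rfl fun b hb => ?_
      rw [if_pos ((h2 b).2 ⟨ha, (Finset.mem_filter.1 hb).2⟩), map_smul, map_smul, inclAlg_of,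
        inclAlg_of, smul_mul_smul_comm, map_mul, map_mul, sign_inclHom, sign_inclHom]
      push_cast
      rfl
    · exact Finset.sum_eq_zero fun b _ => if_neg fun h => ha ((h2 b).1 h).1
  · exact fun b hb => if_neg fun h => (Finset.mem_filter.1 hb).2 ((h2 b).1 h).2

/-- The product of the Young symmetrizers of `D \ B` and `B` in the group algebra of `D`. -/
noncomputable def splitYoungElt (hB : B ⊆ D) : MonoidAlgebra ℚ (Equiv.Perm D) :=
  inclAlg Finset.sdiff_subset (youngElt (D \ B)) * inclAlg hB (youngElt B)

/-- The two factors commute, so their quasi-inverses may be multiplied. The quasi-inverse is kept in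
the product form because such elements commute with the idempotent of `B` (`commute_split`). -/
theorem exists_splitYoungElt_regular (hB : B ⊆ D) :
    ∃ (x₁ : MonoidAlgebra ℚ (Equiv.Perm ↥(D \ B))) (x₂ : MonoidAlgebra ℚ (Equiv.Perm B)),
      splitYoungElt hB * (inclAlg Finset.sdiff_subset x₁ * inclAlg hB x₂) * splitYoungElt hB =
        splitYoungElt hB := by
  obtain ⟨x₁, h₁⟩ := exists_regular (youngElt (D \ B))
  obtain ⟨x₂, h₂⟩ := exists_regular (youngElt B)
  refine ⟨x₁, x₂, ?_⟩
  have hc := fun x y =>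
    (inclAlg_commute (D := D) Finset.sdiff_subset hB Finset.sdiff_disjoint x y).eq
  unfold splitYoungElt
  set κ₁ := inclAlg (A := D \ B) (D := D) Finset.sdiff_subset
  set κ₂ := inclAlg hB
  calc _ = κ₁ (youngElt (D \ B)) * (κ₂ (youngElt B) * κ₁ x₁) * (κ₂ x₂ * κ₁ (youngElt (D \ B))) *
        κ₂ (youngElt B) := by simp only [mul_assoc]
    _ = κ₁ (youngElt (D \ B)) * κ₁ x₁ * (κ₂ (youngElt B) * κ₁ (youngElt (D \ B))) * κ₂ x₂ *
        κ₂ (youngElt B) := by rw [← hc, ← hc]; simp only [mul_assoc]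
    _ = κ₁ (youngElt (D \ B) * x₁ * youngElt (D \ B)) * κ₂ (youngElt B * x₂ * youngElt B) := by
      rw [← hc]; simp only [map_mul, mul_assoc]
    _ = _ := by rw [h₁, h₂]

end Restriction

/-! ### Blocks of the Young symmetrizer -/

section System

variable {D : Finset (ℕ × ℕ)}

/-- A complete system of orthogonal idempotents indexed by the subsets of `D`, in an algebra with
an action of the permutations of `D`. -/
structure SubsetSystem (D : Finset (ℕ × ℕ)) (Λ : Type*) [Ring Λ] [Algebra ℚ Λ] where
  /-- the action of the permutations -/
  ρ : MonoidAlgebra ℚ (Equiv.Perm D) →ₐ[ℚ] Λ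
  /-- the idempotents -/
  E : (D → Bool) → Λ
  idem : ∀ w, E w * E w = E w
  orth : ∀ w w', w ≠ w' → E w * E w' = 0
  sum : ∑ w, E w = 1
  conj : ∀ g w, ρ (MonoidAlgebra.of ℚ _ g) * E w =
    E (fun x => w (g.symm x)) * ρ (MonoidAlgebra.of ℚ _ g)

/-- The cells where `w` is true. -/
def wordCells (w : D → Bool) : Finset (ℕ × ℕ) :=
  (Finset.univ.filter fun x => w x = true).map (Function.Embedding.subtype _)

theorem mem_wordCells (w : D → Bool) (x : D) : x.1 ∈ wordCells w ↔ w x = true := by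
  simp [wordCells]

theorem wordCells_subset (w : D → Bool) : wordCells w ⊆ D := by
  intro x hx
  obtain ⟨y, -, rfl⟩ := Finset.mem_map.1 hx
  exact y.2

namespace SubsetSystem

variable {Λ : Type*} [Ring Λ] [Algebra ℚ Λ] (S : SubsetSystem D Λ)

open Classical in
theorem E_mul_of_mul_E (u w : D → Bool) (g : Equiv.Perm D) :
    S.E u * S.ρ (MonoidAlgebra.of ℚ _ g) * S.E w =
      if ∀ x, u (g x) = w x then S.ρ (MonoidAlgebra.of ℚ _ g) * S.E w else 0 := by
  rw [mul_assoc, S.conj, ← mul_assoc]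
  split_ifs with h
  · have : u = fun x => w (g.symm x) := funext fun x => by rw [← h]; simp
    rw [← this, S.idem]
  · rw [S.orth, zero_mul]
    rintro rfl
    exact h fun x => by simp

/-- Permutations of cells on which `w` is constant leave `w` unchanged. -/
theorem commute_inclAlg {A : Finset (ℕ × ℕ)} (h : A ⊆ D) (a : MonoidAlgebra ℚ (Equiv.Perm A))
    (w : D → Bool) (hw : ∀ x y : D, x.1 ∈ A → y.1 ∈ A → w x = w y) :
    Commute (S.ρ (inclAlg h a)) (S.E w) := by
  induction a using MonoidAlgebra.induction_on with
  | of a =>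
    rw [inclAlg_of]
    refine (S.conj _ _).trans ?_
    congr 2
    funext x
    have h1 := inclHom_mem h a ((inclHom h a).symm x)
    rw [Equiv.apply_symm_apply] at h1
    by_cases hx : x.1 ∈ A
    · exact hw _ _ (h1.1 hx) hx
    · have := inclHom_apply_of_notMem h a _ (mt h1.2 hx)
      rw [Equiv.apply_symm_apply] at this
      rw [← this]
  | add x y hx hy => rw [map_add, map_add]; exact hx.add_left hy
  | smul r x hx => rw [map_smul, map_smul]; exact hx.smul_left r

theorem commute_split (w : D → Bool) (x₁ : MonoidAlgebra ℚ (Equiv.Perm ↥(D \ wordCells w)))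
    (x₂ : MonoidAlgebra ℚ (Equiv.Perm ↥(wordCells w))) :
    Commute (S.ρ (inclAlg Finset.sdiff_subset x₁ * inclAlg (wordCells_subset w) x₂)) (S.E w) := by
  rw [map_mul]
  refine Commute.mul_left (S.commute_inclAlg _ _ _ ?_) (S.commute_inclAlg _ _ _ ?_)
  · intro x y hx hy
    have h1 := mt (mem_wordCells w x).2 (Finset.mem_sdiff.1 hx).2
    have h2 := mt (mem_wordCells w y).2 (Finset.mem_sdiff.1 hy).2
    rw [Bool.not_eq_true] at h1 h2
    rw [h1, h2]
  · intro x y hx hy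
    rw [(mem_wordCells w x).1 hx, (mem_wordCells w y).1 hy]

open Classical in
theorem E_mul_young_mul_E (u w : D → Bool) :
    S.E u * S.ρ (youngElt D) * S.E w =
      ∑ q : Equiv.Perm D with ∀ x, (q x).1.2 = x.1.2,
        ∑ p : Equiv.Perm D with ∀ x, (p x).1.1 = x.1.1,
          if ∀ x, u (q (p x)) = w x then ((Equiv.Perm.sign q : ℤ) : ℚ) •
            (S.ρ (MonoidAlgebra.of ℚ _ q) * S.ρ (MonoidAlgebra.of ℚ _ p) * S.E w) else 0 := by
  rw [youngElt, colAntisymmetrizer, rowSymmetrizer, Finset.sum_mul_sum, map_sum, Finset.mul_sum,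
    Finset.sum_mul]
  refine Finset.sum_congr (by ext; simp) fun q _ => ?_
  rw [map_sum, Finset.mul_sum, Finset.sum_mul]
  refine Finset.sum_congr (by ext; simp) fun p _ => ?_
  have := S.E_mul_of_mul_E u w (q * p)
  rw [smul_mul_assoc, ← map_mul, map_smul, mul_smul_comm, smul_mul_assoc, this, ← map_mul,
    ← map_mul]
  by_cases h : ∀ x, u (q (p x)) = w x
  · rw [if_pos h, if_pos (show ∀ x, u ((q * p) x) = w x from h)]
  · rw [if_neg h, if_neg (show ¬ ∀ x, u ((q * p) x) = w x from h), smul_zero]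

/-- Triangularity: a nonzero block needs `q` and `p` with `u ∘ q ∘ p = w`, which
`rowWeight_le_of_low` permits only when the row weight drops or `u = w`. -/
theorem E_mul_young_mul_E_eq_zero {u w : D → Bool} (hu : IsLow u) (hw : IsLow w) (hne : u ≠ w)
    (hle : ¬ rowWeight u < rowWeight w) : S.E u * S.ρ (youngElt D) * S.E w = 0 := by
  classical
  rw [E_mul_young_mul_E]
  refine Finset.sum_eq_zero fun q hq => Finset.sum_eq_zero fun p hp => if_neg fun h => ?_
  have := rowWeight_le_of_low (Finset.mem_filter.1 hp).2 (Finset.mem_filter.1 hq).2 hw hu h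
  exact hne (this.2 (by omega)).1

/-- By the equality case of `rowWeight_le_of_low`, a product `q p` fixes `w` only if `q` and `p`
both do. The double sum of the block therefore splits into a column part and a row part, and each is
a product over the complement and `w`; the two middle factors commute. -/
theorem E_mul_young_mul_E_self {w : D → Bool} (hw : IsLow w) :
    S.E w * S.ρ (youngElt D) * S.E w = S.ρ (splitYoungElt (wordCells_subset w)) * S.E w := by
  classical
  have hst : ∀ q p : Equiv.Perm D, (∀ x, (q x).1.2 = x.1.2) → (∀ x, (p x).1.1 = x.1.1) →
      ((∀ x, w (q (p x)) = w x) ↔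
        (∀ x, (q x).1 ∈ wordCells w ↔ x.1 ∈ wordCells w) ∧
          ∀ x, (p x).1 ∈ wordCells w ↔ x.1 ∈ wordCells w) := by
    intro q p hq hp
    have hiff : ∀ x y : D, (x.1 ∈ wordCells w ↔ y.1 ∈ wordCells w) ↔ w x = w y := fun x y => by
      rw [mem_wordCells, mem_wordCells]
      cases w x <;> cases w y <;> simp
    simp only [hiff]
    constructor
    · intro h
      have h1 := ((rowWeight_le_of_low hp hq hw hw h).2 rfl).2
      refine ⟨fun x => ?_, fun x => by rw [h1]⟩
      have h2 := h (p.symm x)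
      rw [← h1 (p.symm x)] at h2
      simpa using h2
    · rintro ⟨h1, h2⟩ x
      rw [h1, h2]
  have hsplit : splitYoungElt (wordCells_subset w) =
      (∑ q : Equiv.Perm D with (∀ x, (q x).1 ∈ wordCells w ↔ x.1 ∈ wordCells w),
        (if ∀ x, (q x).1.2 = x.1.2 then
          ((Equiv.Perm.sign q : ℤ) : ℚ) • MonoidAlgebra.of ℚ _ q else 0)) *
      ∑ p : Equiv.Perm D with (∀ x, (p x).1 ∈ wordCells w ↔ x.1 ∈ wordCells w),
        (if ∀ x, (p x).1.1 = x.1.1 then MonoidAlgebra.of ℚ _ p else 0) := by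
    have hc := fun x y => (inclAlg_commute (D := D) Finset.sdiff_subset (wordCells_subset w)
      Finset.sdiff_disjoint x y).eq
    rw [colAntisymmetrizer_stabilizer (wordCells_subset w),
      rowSymmetrizer_stabilizer (wordCells_subset w), splitYoungElt, youngElt,
      youngElt, map_mul, map_mul, mul_assoc, mul_assoc, ← mul_assoc (inclAlg _ (rowSymmetrizer _)),
      hc (rowSymmetrizer _)]
    simp only [mul_assoc]
  rw [hsplit, E_mul_young_mul_E, ← Finset.sum_filter, ← Finset.sum_filter, Finset.sum_mul_sum,
    map_sum, Finset.sum_mul, Finset.filter_filter, Finset.filter_filter]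
  have hcomm : (Finset.univ.filter fun q : Equiv.Perm D =>
      (∀ x, (q x).1 ∈ wordCells w ↔ x.1 ∈ wordCells w) ∧ ∀ x, (q x).1.2 = x.1.2) =
      (Finset.univ.filter fun q : Equiv.Perm D => ∀ x, (q x).1.2 = x.1.2).filter
        fun q => ∀ x, (q x).1 ∈ wordCells w ↔ x.1 ∈ wordCells w := by
    ext q; simp only [Finset.mem_filter, Finset.mem_univ, true_and]; tauto
  rw [hcomm]
  conv_rhs => rw [Finset.sum_filter]
  refine Finset.sum_congr rfl fun q hq => ?_
  replace hq := (Finset.mem_filter.1 hq).2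
  by_cases hqw : ∀ x, (q x).1 ∈ wordCells w ↔ x.1 ∈ wordCells w
  · rw [if_pos hqw, map_sum, Finset.sum_mul]
    have hcomm2 : (Finset.univ.filter fun q : Equiv.Perm D =>
        (∀ x, (q x).1 ∈ wordCells w ↔ x.1 ∈ wordCells w) ∧ ∀ x, (q x).1.1 = x.1.1) =
        (Finset.univ.filter fun q : Equiv.Perm D => ∀ x, (q x).1.1 = x.1.1).filter
          fun q => ∀ x, (q x).1 ∈ wordCells w ↔ x.1 ∈ wordCells w := by
      ext q; simp only [Finset.mem_filter, Finset.mem_univ, true_and]; tauto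
    rw [hcomm2]
    conv_rhs => rw [Finset.sum_filter]
    refine Finset.sum_congr rfl fun p hp => ?_
    replace hp := (Finset.mem_filter.1 hp).2
    by_cases hpw : ∀ x, (p x).1 ∈ wordCells w ↔ x.1 ∈ wordCells w
    · rw [if_pos hpw, if_pos ((hst q p hq hp).2 ⟨hqw, hpw⟩), smul_mul_assoc, map_smul,
        smul_mul_assoc, map_mul S.ρ]
    · rw [if_neg hpw, if_neg fun h => hpw ((hst q p hq hp).1 h).2]
  · rw [if_neg hqw]
    refine Finset.sum_eq_zero fun p hp => if_neg fun h => hqw ?_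
    exact ((hst q p hq (Finset.mem_filter.1 hp).2).1 h).1

/-- If `n` strictly lowers a bounded weight, then it is nilpotent. -/
theorem isNilpotent_of_lower (n : Λ)
    (h : ∀ u w, ¬ rowWeight u < rowWeight w → S.E u * n * S.E w = 0) : IsNilpotent n := by
  -- Each factor `n` accounts for at least one unit of weight, so a power beyond the maximal weight
  -- has no nonzero block.
  have key : ∀ m u w, ¬ rowWeight u + m ≤ rowWeight w → S.E u * n ^ m * S.E w = 0 := by
    intro m
    induction m with
    | zero =>
      intro u w huw
      rw [pow_zero, mul_one, S.orth]
      rintro rfl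
      omega
    | succ m ih =>
      intro u w huw
      have : S.E u * n ^ (m + 1) * S.E w = ∑ t, S.E u * n ^ m * S.E t * (S.E t * n * S.E w) := by
        calc S.E u * n ^ (m + 1) * S.E w = S.E u * n ^ m * 1 * n * S.E w := by
              rw [pow_succ, mul_one]; simp only [mul_assoc]
          _ = _ := by
            rw [← S.sum, Finset.mul_sum, Finset.sum_mul, Finset.sum_mul]
            refine Finset.sum_congr rfl fun t _ => ?_
            conv_lhs => rw [← S.idem t]
            simp only [mul_assoc]
      rw [this]
      refine Finset.sum_eq_zero fun t _ => ?_
      by_cases h1 : rowWeight u + m ≤ rowWeight t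
      · rw [h t w (by omega), mul_zero]
      · rw [ih u t h1, zero_mul]
  refine ⟨Finset.univ.sup (fun w : D → Bool => rowWeight w) + 1, ?_⟩
  set m := Finset.univ.sup (fun w : D → Bool => rowWeight w) + 1
  have hm : ∀ w : D → Bool, rowWeight w < m := fun w =>
    Nat.lt_succ_of_le (Finset.le_sup (f := fun w : D → Bool => rowWeight w) (Finset.mem_univ w))
  calc n ^ m = 1 * n ^ m * 1 := by rw [one_mul, mul_one]
    _ = ∑ u, ∑ w, S.E u * n ^ m * S.E w := by
      rw [← S.sum, Finset.sum_mul, Finset.sum_mul]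
      simp only [Finset.mul_sum]
    _ = 0 := Finset.sum_eq_zero fun u _ => Finset.sum_eq_zero fun w _ =>
      key m u w (by have := hm w; omega)

/-- The block diagonal part of the Young symmetrizer. -/
noncomputable def diagonal : Λ := by
  classical
  exact ∑ w : D → Bool with IsLow w, S.ρ (splitYoungElt (wordCells_subset w)) * S.E w

/-- A quasi-inverse of the block diagonal part of the Young symmetrizer. -/
noncomputable def diagonalInv : Λ := by
  classical
  exact ∑ w : D → Bool with IsLow w, S.ρ (inclAlg Finset.sdiff_subset
    (exists_splitYoungElt_regular (wordCells_subset w)).choose *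
      inclAlg (wordCells_subset w)
        (exists_splitYoungElt_regular (wordCells_subset w)).choose_spec.choose) * S.E w

end SubsetSystem

end System

/-! ### Inverting the diagonal blocks; the system on the regular representation -/

section System

variable {D : Finset (ℕ × ℕ)}

namespace SubsetSystem

variable {Λ : Type*} [Ring Λ] [Algebra ℚ Λ] (S : SubsetSystem D Λ)

theorem sum_mul_sum_low (a b : (D → Bool) → Λ) (hb : ∀ w, Commute (b w) (S.E w))
    [DecidablePred fun w : D → Bool => IsLow w] :
    (∑ w : D → Bool with IsLow w, a w * S.E w) * (∑ w : D → Bool with IsLow w, b w * S.E w) =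
      ∑ w : D → Bool with IsLow w, a w * b w * S.E w := by
  rw [Finset.sum_mul_sum]
  refine Finset.sum_congr rfl fun w hw => ?_
  rw [Finset.sum_eq_single w]
  · rw [mul_assoc, (hb w).eq, ← mul_assoc (S.E w), S.idem, mul_assoc, ← (hb w).eq]
  · intro u _ hu
    rw [mul_assoc, (hb u).eq, ← mul_assoc (S.E w), S.orth _ _ hu.symm, zero_mul, mul_zero]
  · exact fun h => (h hw).elim

theorem E_mul_sum_low (b : (D → Bool) → Λ) (hb : ∀ w, Commute (b w) (S.E w))
    [DecidablePred fun w : D → Bool => IsLow w] (u : D → Bool) :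
    S.E u * (∑ w : D → Bool with IsLow w, b w * S.E w) = if IsLow u then b u * S.E u else 0 := by
  rw [Finset.mul_sum]
  split_ifs with hu
  · rw [Finset.sum_eq_single u]
    · rw [(hb u).eq, ← mul_assoc, S.idem]
    · intro w _ hw
      rw [(hb w).eq, ← mul_assoc, S.orth _ _ hw.symm, zero_mul]
    · exact fun h => (h (by simpa using hu)).elim
  · refine Finset.sum_eq_zero fun w hw => ?_
    rw [(hb w).eq, ← mul_assoc, S.orth, zero_mul]
    rintro rfl
    exact hu (Finset.mem_filter.1 hw).2

theorem sum_low_mul_E (b : (D → Bool) → Λ) [DecidablePred fun w : D → Bool => IsLow w]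
    (u : D → Bool) :
    (∑ w : D → Bool with IsLow w, b w * S.E w) * S.E u = if IsLow u then b u * S.E u else 0 := by
  rw [Finset.sum_mul]
  split_ifs with hu
  · rw [Finset.sum_eq_single u]
    · rw [mul_assoc, S.idem]
    · intro w _ hw
      rw [mul_assoc, S.orth _ _ hw, mul_zero]
    · exact fun h => (h (by simpa using hu)).elim
  · refine Finset.sum_eq_zero fun w hw => ?_
    rw [mul_assoc, S.orth, mul_zero]
    rintro rfl
    exact hu (Finset.mem_filter.1 hw).2

theorem commute_splitYoungElt (w : D → Bool) :
    Commute (S.ρ (splitYoungElt (wordCells_subset w))) (S.E w) :=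
  S.commute_split w _ _

theorem diagonal_mul_diagonalInv_mul_diagonal :
    S.diagonal * S.diagonalInv * S.diagonal = S.diagonal := by
  classical
  unfold diagonal diagonalInv
  rw [S.sum_mul_sum_low _ _ (fun w => S.commute_split w _ _),
    S.sum_mul_sum_low _ _ S.commute_splitYoungElt]
  refine Finset.sum_congr rfl fun w _ => ?_
  rw [← map_mul, ← map_mul,
    (exists_splitYoungElt_regular (wordCells_subset w)).choose_spec.choose_spec]

/-- With `δ`, `y`, `c` for the diagonal, its quasi-inverse and the Young symmetrizer, `δ y c y δ =
(1 + n) δ` where `n = δ y (c - δ) y`. The factors `y` confine everything to lower sets, where `c -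
δ` is strictly triangular; so `n` is nilpotent and `1 + n` is invertible. -/
theorem exists_unipotent : ∃ v : Λ,
    v * (S.diagonal * S.diagonalInv * S.ρ (youngElt D) * S.diagonalInv * S.diagonal) =
      S.diagonal := by
  classical
  set δ := S.diagonal with hδ
  set y := S.diagonalInv with hy
  set c := S.ρ (youngElt D)
  have hδy := S.diagonal_mul_diagonalInv_mul_diagonal
  rw [← hδ, ← hy] at hδy
  have hδE : ∀ u, S.E u * δ = δ * S.E u := fun u => by
    rw [hδ, diagonal, S.E_mul_sum_low _ S.commute_splitYoungElt, S.sum_low_mul_E]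
  have hyE : ∀ u, S.E u * y = y * S.E u := fun u => by
    rw [hy, diagonalInv, S.E_mul_sum_low _ (fun w => S.commute_split w _ _), S.sum_low_mul_E]
  have hδ0 : ∀ u, ¬ IsLow u → δ * S.E u = 0 := fun u hu => by
    rw [hδ, diagonal, S.sum_low_mul_E, if_neg hu]
  have hy0 : ∀ u, ¬ IsLow u → y * S.E u = 0 := fun u hu => by
    rw [hy, diagonalInv, S.sum_low_mul_E, if_neg hu]
  have hδu : ∀ u, IsLow u → δ * S.E u = S.E u * c * S.E u := fun u hu => by
    rw [hδ, diagonal, S.sum_low_mul_E, if_pos hu, S.E_mul_young_mul_E_self hu]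
  have hE : ∀ u w, u ≠ w → S.E u * δ * S.E w = 0 := fun u w h => by
    rw [mul_assoc, ← hδE, ← mul_assoc, S.orth _ _ h, zero_mul]
  set n := δ * y * (c - δ) * y with hn
  have hnil : IsNilpotent n := by
    refine S.isNilpotent_of_lower n fun u w huw => ?_
    have h1 : S.E u * n * S.E w = δ * y * (S.E u * (c - δ) * S.E w) * y := by
      rw [hn]
      calc _ = (S.E u * δ) * y * (c - δ) * (y * S.E w) := by simp only [mul_assoc]
        _ = δ * (S.E u * y) * (c - δ) * (y * S.E w) := by rw [hδE]; simp only [mul_assoc]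
        _ = _ := by rw [hyE u, ← hyE w]; simp only [mul_assoc]
    rw [h1]
    -- For lower sets this is triangularity, and the diagonal block of `c - δ` vanishes by the
    -- choice of `δ`. A set that is not lower is killed by `y`.
    by_cases hu : IsLow u
    · by_cases hw : IsLow w
      · have : S.E u * (c - δ) * S.E w = 0 := by
          rw [mul_sub, sub_mul]
          by_cases h : u = w
          · subst h
            rw [hδE, mul_assoc δ, S.idem, hδu u hu, sub_self]
          · rw [hE u w h, sub_zero]
            exact S.E_mul_young_mul_E_eq_zero hu hw h huw
        rw [this, mul_zero, zero_mul]
      · calc _ = δ * y * S.E u * (c - δ) * (S.E w * y) := by simp only [mul_assoc]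
          _ = 0 := by rw [hyE, hy0 w hw, mul_zero]
    · calc _ = δ * (y * S.E u) * (c - δ) * (S.E w * y) := by simp only [mul_assoc]
        _ = 0 := by rw [hy0 u hu]; simp
  obtain ⟨v, hv⟩ := (hnil.isUnit_one_add).exists_left_inv
  refine ⟨v, ?_⟩
  have h2 : δ * y * c * y * δ = (1 + n) * δ := by
    have : δ * y * c * y * δ = δ * y * δ * y * δ + δ * y * (c - δ) * y * δ := by
      rw [mul_sub, sub_mul, sub_mul]; abel
    rw [this, hδy, hδy, add_mul, one_mul]
  rw [h2, ← mul_assoc, hv, one_mul]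

end SubsetSystem

/-- The left translation action on functions. -/
noncomputable def translation (G : Type*) [Group G] :
    MonoidAlgebra ℚ G →ₐ[ℚ] Module.End ℚ (G → ℚ) :=
  MonoidAlgebra.lift ℚ _ _
    { toFun := fun g => LinearMap.funLeft ℚ ℚ fun x => g⁻¹ * x
      map_one' := by ext; simp
      map_mul' := fun g h => by ext; simp [mul_assoc, LinearMap.funLeft] }

theorem translation_of_apply {G : Type*} [Group G] (g : G) (f : G → ℚ) (x : G) :
    translation G (MonoidAlgebra.of ℚ G g) f x = f (g⁻¹ * x) := by
  simp [translation, LinearMap.funLeft]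

/-- The subset system on the functions on the permutations, where the idempotents are the
restrictions to the permutations that carry `w₀` to a given subset. -/
noncomputable def translationSystem (w₀ : D → Bool) :
    SubsetSystem D (Module.End ℚ (Equiv.Perm D → ℚ)) where
  ρ := translation _
  E w := by
    classical
    exact LinearMap.pi fun g => if w = (fun x => w₀ (g.symm x)) then LinearMap.proj g else 0
  idem w := by
    ext f g
    simp only [LinearMap.comp_apply, LinearMap.pi_apply, Module.End.mul_apply]
    split_ifs <;> simp [*]
  orth w w' h := by
    ext f g
    simp only [LinearMap.comp_apply, LinearMap.pi_apply, Module.End.mul_apply]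
    split_ifs with h1
    · simp only [LinearMap.proj_apply, LinearMap.pi_apply]
      rw [if_neg fun h2 => h (h1.trans h2.symm)]
      simp
    · simp
  sum := by
    ext f g
    simp only [LinearMap.comp_apply, LinearMap.sum_apply, Finset.sum_apply, LinearMap.pi_apply]
    rw [Finset.sum_eq_single (fun x => w₀ (g.symm x))]
    · simp
    · intro w _ hw
      rw [if_neg hw]; rfl
    · simp
  conj g w := by
    ext f h
    simp only [LinearMap.comp_apply, Module.End.mul_apply, LinearMap.pi_apply,
      translation_of_apply]
    have : (w = fun x => w₀ ((g⁻¹ * h).symm x)) ↔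
        (fun x => w (g.symm x)) = fun x => w₀ (h.symm x) := by
      constructor
      · rintro rfl
        funext x
        change w₀ (h.symm (g (g.symm x))) = _
        rw [Equiv.apply_symm_apply]
      · intro e
        funext x
        have := congrFun e (g x)
        simp only [Equiv.symm_apply_apply] at this
        rw [this]
        rfl
    by_cases hc : (fun x => w (g.symm x)) = fun x => w₀ (h.symm x)
    · rw [if_pos hc, if_pos (this.2 hc)]
      exact (translation_of_apply g (Pi.single f 1) h).symm
    · rw [if_neg hc, if_neg (mt this.1 hc)]
      simp

theorem translationSystem_E_apply (w₀ w : D → Bool) (f : Equiv.Perm D → ℚ) (g : Equiv.Perm D)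
    [Decidable (w = fun x => w₀ (g.symm x))] :
    (translationSystem w₀).E w f g = if w = (fun x => w₀ (g.symm x)) then f g else 0 := by
  change (LinearMap.pi _ : (Equiv.Perm D → ℚ) →ₗ[ℚ] _) f g = _
  rw [LinearMap.pi_apply]
  split_ifs <;> simp

end System

/-! ### The rank count in the regular representation and its transfer -/

section Universal

variable {D : Finset (ℕ × ℕ)}

/-- In a relation take an index `j` with nonzero coefficient and maximal rank; evaluated at `e j`,
only the term of `j` survives. -/
theorem linearIndependent_of_triangular {ι κ : Type*} [Finite ι] (v : ι → κ → ℚ) (e : ι → κ)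
    (r : ι → ℕ) (h1 : ∀ i, v i (e i) ≠ 0) (h2 : ∀ i j, v i (e j) ≠ 0 → r j < r i ∨ j = i) :
    LinearIndependent ℚ v := by
  classical
  have := Fintype.ofFinite ι
  rw [Fintype.linearIndependent_iff]
  intro a ha
  by_contra! hne
  obtain ⟨j, hj, hmax⟩ := Finset.exists_max_image (Finset.univ.filter fun i => a i ≠ 0) r
    (by obtain ⟨i, hi⟩ := hne; exact ⟨i, by simpa using hi⟩)
  simp only [Finset.mem_filter, Finset.mem_univ, true_and] at hj hmax
  have h3 := congrFun ha (e j)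
  rw [Finset.sum_apply, Finset.sum_eq_single j] at h3
  · exact mul_ne_zero hj (h1 j) (by simpa using h3)
  · intro i _ hi
    rw [Pi.smul_apply, smul_eq_mul]
    by_contra hc
    obtain ⟨h4, h5⟩ := mul_ne_zero_iff.1 hc
    rcases h2 i j h5 with h | h
    · exact (hmax i h4).not_gt h
    · exact hi h.symm
  · simp

theorem translation_single {G : Type*} [Group G] [DecidableEq G] (g h : G) :
    translation G (MonoidAlgebra.of ℚ G g) (Pi.single h 1) = Pi.single (g * h) 1 := by
  funext x
  rw [translation_of_apply, Pi.single_apply, Pi.single_apply]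
  simp only [inv_mul_eq_iff_eq_mul]

open Classical in
theorem translation_young_single (g h : Equiv.Perm D) :
    translation _ (youngElt D) (Pi.single g 1) h =
      ∑ q : Equiv.Perm D with ∀ x, (q x).1.2 = x.1.2,
        ∑ p : Equiv.Perm D with ∀ x, (p x).1.1 = x.1.1,
          if h = q * p * g then ((Equiv.Perm.sign q : ℤ) : ℚ) else 0 := by
  rw [youngElt, colAntisymmetrizer, rowSymmetrizer, Finset.sum_mul_sum, map_sum,
    LinearMap.sum_apply, Finset.sum_apply]
  refine Finset.sum_congr (by ext; simp) fun q _ => ?_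
  rw [map_sum, LinearMap.sum_apply, Finset.sum_apply]
  refine Finset.sum_congr (by ext; simp) fun p _ => ?_
  rw [smul_mul_assoc, ← map_mul, map_smul, LinearMap.smul_apply, translation_single,
    Pi.smul_apply, Pi.single_apply, smul_eq_mul, mul_ite, mul_one, mul_zero]

/-- The identity has a single expression as a column permutation times a row permutation, and it
carries the coefficient 1. -/
theorem translation_young_single_self (g : Equiv.Perm D) :
    translation _ (youngElt D) (Pi.single g 1) g = 1 := by
  classical
  rw [translation_young_single, Finset.sum_eq_single 1, Finset.sum_eq_single 1]
  · simp
  · intro p hp hp1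
    refine if_neg fun h => hp1 ?_
    rw [one_mul, eq_comm, mul_eq_right] at h
    exact h
  · intro h; exact (h (by simp)).elim
  · intro q hq hq1
    refine Finset.sum_eq_zero fun p hp => if_neg fun h => hq1 ?_
    rw [eq_comm, mul_eq_right] at h
    have := eq_one_of_row_col (Finset.mem_filter.1 hp).2 (Finset.mem_filter.1 hq).2 h
    rwa [this, mul_one] at h
  · intro h; exact (h (by simp)).elim

/-- The cells of `w₀` get the smallest labels. For a standard tableau `s`, the image of `w₀` under
`s` is then the set of entries below `k`, which is a lower set. -/
theorem exists_labels (w₀ : D → Bool) :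
    ∃ (ℓ : D → ℕ) (k : ℕ), Function.Injective ℓ ∧ ∀ x, w₀ x = decide (ℓ x < k) := by
  refine ⟨fun x => if w₀ x then (D.equivFin x : ℕ) else D.card + D.equivFin x, D.card, ?_, ?_⟩
  · intro x y h
    have hx := (D.equivFin x).2
    have hy := (D.equivFin y).2
    refine D.equivFin.injective (Fin.ext ?_)
    simp only at h
    split_ifs at h <;> omega
  · intro x
    have hx := (D.equivFin x).2
    cases h : w₀ x <;> simp [h, hx]

/-- The delta function at `s` lies in the image of the idempotent of the lower set below `k`. So
`diagonal` acts on it as the Young symmetrizer, cut off to permutations with the same lower set. The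
value at `s` is 1, and it is nonzero at another standard `t` only if the tableau weight of `t` is
smaller. -/
theorem linearIndependent_diagonal_std {w₀ : D → Bool} {ℓ : D → ℕ} {k : ℕ}
    (hℓ : Function.Injective ℓ) (hk : ∀ x, w₀ x = decide (ℓ x < k)) :
    LinearIndependent ℚ fun s : {s : Equiv.Perm D // IsStd ℓ s} =>
      (translationSystem w₀).diagonal (Pi.single s.1 1) := by
  classical
  have hbel : ∀ g : Equiv.Perm D, (fun x => w₀ (g.symm x)) = below ℓ g k := fun g =>
    funext fun x => hk _
  have hv : ∀ (s : {s : Equiv.Perm D // IsStd ℓ s}) (h : Equiv.Perm D),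
      (translationSystem w₀).diagonal (Pi.single s.1 1) h =
        if below ℓ s.1 k = below ℓ h k then
          translation _ (youngElt D) (Pi.single s.1 1) h else 0 := by
    intro s h
    have hlow := s.2.isLow_below k
    have h1 : (translationSystem w₀).E (below ℓ s.1 k) (Pi.single s.1 1) = Pi.single s.1 1 := by
      funext x
      rw [translationSystem_E_apply, hbel]
      by_cases hx : x = s.1
      · subst hx; simp
      · simp [hx]
    have h2 := (translationSystem w₀).sum_low_mul_E
      (fun w => (translationSystem w₀).ρ (splitYoungElt (wordCells_subset w))) (below ℓ s.1 k)
    rw [if_pos hlow, ← SubsetSystem.E_mul_young_mul_E_self _ hlow] at h2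
    have h3 := LinearMap.congr_fun h2 (Pi.single s.1 1)
    rw [Module.End.mul_apply, Module.End.mul_apply, Module.End.mul_apply, h1] at h3
    refine (congrFun h3 h).trans ?_
    rw [translationSystem_E_apply, hbel]
    rfl
  refine linearIndependent_of_triangular _ (fun s => s.1) (fun s => tableauWeight ℓ s.1) ?_ ?_
  · intro s
    rw [hv, if_pos rfl, translation_young_single_self]
    exact one_ne_zero
  · intro s t h
    rw [hv] at h
    have h2 : translation _ (youngElt D) (Pi.single s.1 1) t.1 ≠ 0 := by
      intro h0
      rw [h0, ite_self] at h
      exact h rfl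
    rw [translation_young_single] at h2
    obtain ⟨q, hq, h3⟩ := Finset.exists_ne_zero_of_sum_ne_zero h2
    obtain ⟨p, hp, h4⟩ := Finset.exists_ne_zero_of_sum_ne_zero h3
    have h5 : t.1 = q * p * s.1 := by
      by_contra h6
      exact h4 (if_neg h6)
    rcases tableauWeight_le hℓ (Finset.mem_filter.1 hp).2 (Finset.mem_filter.1 hq).2 s.2 t.2
      h5.symm with h6 | h6
    · exact Or.inl h6
    · exact Or.inr (Subtype.ext h6)

theorem finrank_range_young_le (hD : IsLowerSet (D : Set (ℕ × ℕ))) {ℓ : D → ℕ}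
    (hℓ : Function.Injective ℓ) :
    Module.finrank ℚ (LinearMap.range (translation _ (youngElt D))) ≤
      Nat.card {s : Equiv.Perm D // IsStd ℓ s} := by
  classical
  let v : {s : Equiv.Perm D // IsStd ℓ s} → Equiv.Perm D → ℚ := fun s =>
    translation _ (youngElt D) (Pi.single s.1 1)
  have hle : LinearMap.range (translation _ (youngElt D)) ≤ Submodule.span ℚ (Set.range v) := by
    rw [LinearMap.range_eq_map, ← (Pi.basisFun ℚ (Equiv.Perm D)).span_eq, Submodule.map_span,
      Submodule.span_le]
    rintro _ ⟨_, ⟨g, rfl⟩, rfl⟩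
    rw [Pi.basisFun_apply]
    -- Acting on the delta function at 1 carries the straightening relations from the group algebra
    -- to the regular representation.
    let f : MonoidAlgebra ℚ (Equiv.Perm D) →ₗ[ℚ] (Equiv.Perm D → ℚ) :=
      (LinearMap.applyₗ (Pi.single 1 1)) ∘ₗ (translation (Equiv.Perm D)).toLinearMap
    have hf : ∀ s, f (youngElt D * MonoidAlgebra.of ℚ _ s) =
        translation _ (youngElt D) (Pi.single s 1) := by
      intro s
      change translation _ _ _ = _
      rw [map_mul, Module.End.mul_apply, translation_single, mul_one]
    have h1 := Submodule.mem_map_of_mem (f := f) (youngElt_mul_of_mem_span hD hℓ g)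
    rw [Submodule.map_span, ← Set.range_comp, hf] at h1
    refine (Submodule.span_mono ?_) h1
    rintro _ ⟨s, rfl⟩
    exact ⟨s, (hf s.1).symm⟩
  have := Fintype.ofFinite {s : Equiv.Perm D // IsStd ℓ s}
  calc _ ≤ _ := Submodule.finrank_mono hle
    _ ≤ _ := finrank_range_le_card v
    _ = _ := (Nat.card_eq_fintype_card).symm

theorem exists_translation_lift (hD : IsLowerSet (D : Set (ℕ × ℕ))) (w₀ : D → Bool)
    :
    ∃ z : Equiv.Perm D → ℚ, ((translationSystem w₀).ρ (youngElt D) *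
      (translationSystem w₀).diagonalInv * (translationSystem w₀).diagonal) z =
        (translationSystem w₀).ρ (youngElt D) (Pi.single 1 1) := by
  classical
  obtain ⟨ℓ, k, hℓ, hk⟩ := exists_labels w₀
  set S := translationSystem w₀
  obtain ⟨v, hv⟩ := S.exists_unipotent
  have hle : LinearMap.range (S.ρ (youngElt D) * S.diagonalInv * S.diagonal) ≤
      LinearMap.range (S.ρ (youngElt D)) := by
    rintro _ ⟨x, rfl⟩
    exact ⟨S.diagonalInv (S.diagonal x), rfl⟩
  have h1 : Nat.card {s : Equiv.Perm D // IsStd ℓ s} ≤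
      Module.finrank ℚ (LinearMap.range S.diagonal) := by
    have := Fintype.ofFinite {s : Equiv.Perm D // IsStd ℓ s}
    have hli := linearIndependent_diagonal_std hℓ hk
    rw [Nat.card_eq_fintype_card]
    have hli' : LinearIndependent ℚ fun s : {s : Equiv.Perm D // IsStd ℓ s} =>
        (⟨S.diagonal (Pi.single s.1 1), ⟨_, rfl⟩⟩ : LinearMap.range S.diagonal) :=
      LinearIndependent.of_comp (LinearMap.range S.diagonal).subtype hli
    exact hli'.fintype_card_le_finrank
  -- The relation of `exists_unipotent` exhibits the diagonal as a map applied after `c y δ`.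
  have h2 : Module.finrank ℚ (LinearMap.range S.diagonal) ≤
      Module.finrank ℚ (LinearMap.range (S.ρ (youngElt D) * S.diagonalInv * S.diagonal)) := by
    have h3 : S.diagonal = (v * (S.diagonal * S.diagonalInv)) ∘ₗ
        (S.ρ (youngElt D) * S.diagonalInv * S.diagonal) := by
      conv_lhs => rw [← hv]
      simp only [← Module.End.mul_eq_comp, mul_assoc]
    conv_lhs => rw [h3, LinearMap.range_comp]
    exact Submodule.finrank_map_le _ _
  -- The chain rank `c` ≤ number of standard tableaux ≤ rank `δ` ≤ rank `c y δ` closes up, so the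
  -- inclusion of ranges is an equality.
  have h4 := Submodule.eq_of_le_of_finrank_le hle
    (((finrank_range_young_le hD hℓ).trans h1).trans h2)
  have h5 : S.ρ (youngElt D) (Pi.single 1 1) ∈
    LinearMap.range (S.ρ (youngElt D) * S.diagonalInv * S.diagonal) := by
    rw [h4]
    exact ⟨_, rfl⟩
  exact h5

namespace SubsetSystem

variable {Λ : Type*} [Ring Λ] [Algebra ℚ Λ] (S : SubsetSystem D Λ)

/-- The comparison of the universal subset system with a given one. -/
noncomputable def orbitMap (w₀ : D → Bool) : (Equiv.Perm D → ℚ) →ₗ[ℚ] Λ :=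
  ∑ g : Equiv.Perm D, (LinearMap.toSpanSingleton ℚ Λ (S.ρ (MonoidAlgebra.of ℚ _ g) * S.E w₀)) ∘ₗ
    LinearMap.proj g

theorem orbitMap_apply (w₀ : D → Bool) (f : Equiv.Perm D → ℚ) :
    S.orbitMap w₀ f = ∑ g : Equiv.Perm D, f g • (S.ρ (MonoidAlgebra.of ℚ _ g) * S.E w₀) := by
  simp [orbitMap, LinearMap.sum_apply]

theorem orbitMap_ρ (w₀ : D → Bool) (a : MonoidAlgebra ℚ (Equiv.Perm D)) (f : Equiv.Perm D → ℚ) :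
    S.orbitMap w₀ ((translationSystem w₀).ρ a f) = S.ρ a * S.orbitMap w₀ f := by
  induction a using MonoidAlgebra.induction_on with
  | of g =>
    rw [orbitMap_apply, orbitMap_apply, Finset.mul_sum, ← Equiv.sum_comp (Equiv.mulLeft g)]
    refine Finset.sum_congr rfl fun h _ => ?_
    have : (translationSystem w₀).ρ (MonoidAlgebra.of ℚ _ g) f (Equiv.mulLeft g h) = f h := by
      refine (translation_of_apply g f _).trans ?_
      simp
    rw [this, mul_smul_comm, ← mul_assoc, ← map_mul, ← map_mul]
    rfl
  | add x y hx hy => rw [map_add, LinearMap.add_apply, map_add, hx, hy, map_add, add_mul]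
  | smul r x hx => rw [map_smul, LinearMap.smul_apply, map_smul, hx, map_smul, smul_mul_assoc]

/-- The product `E w * g * E w₀` is `g * E w₀` or zero, according to whether `g` carries `w₀` to
`w`; this is how the idempotents of the regular representation were chosen. -/
theorem orbitMap_E (w₀ w : D → Bool) (f : Equiv.Perm D → ℚ) :
    S.orbitMap w₀ ((translationSystem w₀).E w f) = S.E w * S.orbitMap w₀ f := by
  classical
  rw [orbitMap_apply, orbitMap_apply, Finset.mul_sum]
  refine Finset.sum_congr rfl fun h _ => ?_
  rw [translationSystem_E_apply, mul_smul_comm, S.conj, ← mul_assoc]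
  split_ifs with hc
  · rw [← hc, S.idem]
  · rw [S.orth _ _ hc, zero_mul, smul_zero, zero_smul]

theorem orbitMap_diagonal (w₀ : D → Bool) (f : Equiv.Perm D → ℚ) :
    S.orbitMap w₀ ((translationSystem w₀).diagonal f) = S.diagonal * S.orbitMap w₀ f := by
  unfold diagonal
  rw [LinearMap.sum_apply, map_sum, Finset.sum_mul]
  refine Finset.sum_congr rfl fun w _ => ?_
  rw [Module.End.mul_apply, orbitMap_ρ, orbitMap_E, mul_assoc]

theorem orbitMap_diagonalInv (w₀ : D → Bool) (f : Equiv.Perm D → ℚ) :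
    S.orbitMap w₀ ((translationSystem w₀).diagonalInv f) = S.diagonalInv * S.orbitMap w₀ f := by
  unfold diagonalInv
  rw [LinearMap.sum_apply, map_sum, Finset.sum_mul]
  refine Finset.sum_congr rfl fun w _ => ?_
  rw [Module.End.mul_apply, orbitMap_ρ, orbitMap_E, mul_assoc]

/-- For a Young diagram, the Young symmetrizer factors through its block diagonal part. -/
theorem exists_factorization (hD : IsLowerSet (D : Set (ℕ × ℕ))) :
    ∃ z : Λ, S.ρ (youngElt D) * S.diagonalInv * S.diagonal * z = S.ρ (youngElt D) := by
  classical
  choose z hz using exists_translation_lift hD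
  -- The comparison for `w` sends the delta function at 1 to `E w`, so it yields the factorization
  -- on `E w`; these add up because the idempotents sum to 1.
  refine ⟨∑ w, S.orbitMap w (z w), ?_⟩
  have h1 : ∀ w, S.orbitMap w (Pi.single 1 1) = S.E w := by
    intro w
    rw [orbitMap_apply, Finset.sum_eq_single 1]
    · rw [Pi.single_eq_same, map_one, map_one, one_mul, one_smul]
    · intro g _ hg
      simp [hg]
    · simp
  have h2 : ∀ w, S.ρ (youngElt D) * S.diagonalInv * S.diagonal * S.orbitMap w (z w) =
      S.ρ (youngElt D) * S.E w := by
    intro w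
    rw [← h1, ← orbitMap_ρ, ← hz w, Module.End.mul_apply, Module.End.mul_apply, orbitMap_ρ,
      orbitMap_diagonalInv, orbitMap_diagonal]
    simp only [mul_assoc]
  rw [Finset.mul_sum, Finset.sum_congr rfl fun w _ => h2 w, ← Finset.mul_sum, S.sum, mul_one]

end SubsetSystem

end Universal

/-! ### Image of the Young symmetrizer and images of the blocks -/

section Decomposition

variable {D : Finset (ℕ × ℕ)}

namespace SubsetSystem

variable {Λ : Type*} [Ring Λ] [Algebra ℚ Λ] (S : SubsetSystem D Λ)

-- Up to the split projections, `f` and `g` give inverse isomorphisms between the image of `c` and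
-- that of `δ`: `δ g c f δ = δ` and `c f δ g c = c`. The first relation is stated block by block, as
-- needed for the separate summands.
open Classical in
theorem exists_image_comparison (hD : IsLowerSet (D : Set (ℕ × ℕ))) :
    ∃ f g : Λ,
      (∀ w w', IsLow w → IsLow w' → S.ρ (splitYoungElt (wordCells_subset w')) * S.E w' * g *
        S.ρ (youngElt D) * f * (S.ρ (splitYoungElt (wordCells_subset w)) * S.E w) =
          if w' = w then S.ρ (splitYoungElt (wordCells_subset w)) * S.E w else 0) ∧
      S.ρ (youngElt D) * f * S.diagonal * g * S.ρ (youngElt D) = S.ρ (youngElt D) := by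
  obtain ⟨v, hv⟩ := S.exists_unipotent
  obtain ⟨z, hz⟩ := S.exists_factorization hD
  obtain ⟨x, hx⟩ := exists_regular (youngElt D)
  have hx' := congrArg S.ρ hx
  rw [map_mul, map_mul] at hx'
  set c := S.ρ (youngElt D)
  set y := S.diagonalInv
  refine ⟨y, z * S.ρ x, ?_, ?_⟩
  · have key : S.diagonal * z * S.ρ x * c * y * S.diagonal = S.diagonal := by
      -- The unipotence relation lets `c y δ` be cancelled on the left, at the price of leaving `δ`.
      have h1 : ∀ u, v * (S.diagonal * y * (c * y * S.diagonal * u)) = S.diagonal * u := by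
        intro u
        conv_rhs => rw [← hv]
        simp only [mul_assoc]
      have h2 := h1 (z * S.ρ x * c * y * S.diagonal)
      have h3 : c * y * S.diagonal * (z * S.ρ x * c * y * S.diagonal) = c * y * S.diagonal * 1 := by
        calc _ = c * y * S.diagonal * z * S.ρ x * c * y * S.diagonal := by simp only [mul_assoc]
          _ = _ := by rw [hz, hx', mul_one]
      rw [h3, h1, mul_one] at h2
      conv_rhs => rw [h2]
      simp only [mul_assoc]
    intro w w' hw hw'
    have e1 : ∀ u, IsLow u → S.diagonal * S.E u =
        S.ρ (splitYoungElt (wordCells_subset u)) * S.E u := fun u hu => by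
      rw [diagonal, S.sum_low_mul_E, if_pos hu]
    have e2 : ∀ u, S.E u * S.diagonal = S.diagonal * S.E u := fun u => by
      rw [diagonal, S.sum_low_mul_E, S.E_mul_sum_low _ S.commute_splitYoungElt]
    rw [← e1 w hw, ← e1 w' hw', ← e2]
    calc _ = S.E w' * (S.diagonal * z * S.ρ x * c * y * S.diagonal) * S.E w := by
          simp only [mul_assoc]
      _ = _ := by
        rw [key, e2, mul_assoc]
        split_ifs with h
        · rw [h, S.idem]
        · rw [S.orth _ _ h, mul_zero]
  · calc _ = c * y * S.diagonal * z * S.ρ x * c := by simp only [mul_assoc]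
      _ = c := by rw [hz, hx']

end SubsetSystem

variable {𝒞 : Type*} [Category 𝒞] [Preadditive 𝒞] [Linear ℚ 𝒞]

open Classical in
/-- The image of the Young symmetrizer is the direct sum of the images of its diagonal blocks. -/
theorem exists_decomposition (hD : IsLowerSet (D : Set (ℕ × ℕ))) {P R : 𝒞}
    (S : SubsetSystem D (End P)) (π : P ⟶ R) (ι : R ⟶ P) [IsSplitEpi π] [IsSplitMono ι]
    (hπι : π ≫ ι = S.ρ (youngElt D)) (M : {w : D → Bool // IsLow w} → 𝒞)
    (π' : ∀ w, P ⟶ M w) (ι' : ∀ w, M w ⟶ P) (hπ : ∀ w, IsSplitEpi (π' w))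
    (hι : ∀ w, IsSplitMono (ι' w))
    (hw : ∀ w, π' w ≫ ι' w = (S.ρ (splitYoungElt (wordCells_subset w.1)) * S.E w.1 : End P)) :
    ∃ (a : ∀ w, M w ⟶ R) (b : ∀ w, R ⟶ M w), (∀ w, a w ≫ b w = 𝟙 _) ∧
      (∀ w w', w ≠ w' → a w ≫ b w' = 0) ∧ ∑ w, b w ≫ a w = 𝟙 R := by
  obtain ⟨f, g, h1, h2⟩ := S.exists_image_comparison hD
  -- Multiplication of endomorphisms is composition in the opposite order, so the relation reads
  -- backwards as a composite.
  have h1' : ∀ w w' : {w : D → Bool // IsLow w}, (π' w ≫ ι' w) ≫ f ≫ (π ≫ ι) ≫ g ≫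
      (π' w' ≫ ι' w') = if w' = w then π' w ≫ ι' w else 0 := by
    intro w w'
    have := h1 w.1 w'.1 w.2 w'.2
    rw [← hw, ← hw, ← hπι] at this
    simp only [End.mul_def, ← Subtype.ext_iff] at this
    refine Eq.trans ?_ this
    simp only [Category.assoc]
  have hd : (S.diagonal : P ⟶ P) = ∑ w : {w : D → Bool // IsLow w}, π' w ≫ ι' w := by
    rw [Finset.sum_congr rfl fun w _ => hw w, SubsetSystem.diagonal]
    exact (Finset.sum_subtype (Finset.univ.filter fun w : D → Bool => IsLow w) (by simp)
      (fun w => (S.ρ (splitYoungElt (wordCells_subset w)) * S.E w : End P)))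
  have h2' : (π ≫ ι) ≫ g ≫ (S.diagonal : P ⟶ P) ≫ f ≫ (π ≫ ι) = π ≫ ι := by
    rw [← hπι] at h2
    simp only [End.mul_def] at h2
    exact h2
  refine ⟨fun w => ι' w ≫ f ≫ π, fun w => ι ≫ g ≫ π' w, ?_, ?_, ?_⟩
  · intro w
    have := h1' w w
    rw [if_pos rfl] at this
    rw [← cancel_epi (π' w), ← cancel_mono (ι' w)]
    simpa using this
  · intro w w' h
    have := h1' w w'
    rw [if_neg (Ne.symm h)] at this
    rw [← cancel_epi (π' w), ← cancel_mono (ι' w')]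
    simpa using this
  · rw [← cancel_epi π, ← cancel_mono ι, Category.comp_id]
    refine Eq.trans ?_ h2'
    rw [hd]
    simp only [Preadditive.comp_sum, Preadditive.sum_comp, Category.assoc]

end Decomposition

/-! ### Adjacent transpositions -/

section AdjSwap

theorem adjSwap_val (n i : ℕ) (hi : i + 1 < n) (k : Fin n) :
    (adjSwap n i k).1 = if k.1 = i then i + 1 else if k.1 = i + 1 then i else k.1 := by
  rw [adjSwap, dif_pos hi, Equiv.swap_apply_def]
  simp only [Fin.ext_iff]
  split_ifs <;> rfl

theorem adjSwap_symm (n i : ℕ) (hi : i + 1 < n) : (adjSwap n i).symm = adjSwap n i := by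
  rw [adjSwap, dif_pos hi, Equiv.symm_swap]

theorem perm_induction {n : ℕ} {Q : Equiv.Perm (Fin n) → Prop} (h1 : Q 1)
    (hmul : ∀ σ τ, Q σ → Q τ → Q (σ * τ)) (hadj : ∀ i, i + 1 < n → Q (adjSwap n i))
    (σ : Equiv.Perm (Fin n)) : Q σ := by
  have hσ : σ ∈ Submonoid.closure
      (Set.range fun i : {i : ℕ // i + 1 < n} => adjSwap n i.1) := by
    rw [closure_adjSwap]; trivial
  induction hσ using Submonoid.closure_induction with
  | mem x hx =>
    obtain ⟨i, rfl⟩ := hx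
    exact hadj i.1 i.2
  | one => exact h1
  | mul x y _ _ hx hy => exact hmul x y hx hy

end AdjSwap

/-! ### Naturality of the permutation action and concatenation of tensor powers -/

section TensorFam

variable {𝒞 : Type*} [Category 𝒞] [MonoidalCategory 𝒞]

/-- The tensor product of `n` morphisms. -/
def tensorFam {Z Z' : 𝒞} : (n : ℕ) → (Fin n → (Z ⟶ Z')) → (tensorPow Z n ⟶ tensorPow Z' n)
  | 0, _ => 𝟙 _
  | n + 1, f => f 0 ⊗ₘ tensorFam n fun i => f i.succ

theorem tensorFam_comp {Z Z' Z'' : 𝒞} (n : ℕ) (f : Fin n → (Z ⟶ Z')) (g : Fin n → (Z' ⟶ Z'')) :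
    tensorFam n f ≫ tensorFam n g = tensorFam n fun i => f i ≫ g i := by
  induction n with
  | zero => exact Category.comp_id _
  | succ n ih =>
    change (_ ⊗ₘ _) ≫ (_ ⊗ₘ _) = _ ⊗ₘ _
    rw [MonoidalCategory.tensorHom_comp_tensorHom, ih]

theorem tensorFam_id (Z : 𝒞) (n : ℕ) : tensorFam n (fun _ => 𝟙 Z) = 𝟙 (tensorPow Z n) := by
  induction n with
  | zero => rfl
  | succ n ih =>
    change _ ⊗ₘ _ = _
    rw [ih]
    exact id_tensorHom_id _ _

/-- The concatenation of tensor powers. -/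
def concat (Z : 𝒞) (b : ℕ) : (a : ℕ) → (tensorPow Z a ⊗ tensorPow Z b ≅ tensorPow Z (b + a))
  -- The exponent is `b + a` rather than `a + b`, so that both clauses type-check by definitional
  -- unfolding.
  | 0 => λ_ _
  | a + 1 => α_ _ _ _ ≪≫ whiskerLeftIso Z (concat Z b a)

theorem tensorFam_concat {Z Z' : 𝒞} (b a : ℕ) (f : Fin a → (Z ⟶ Z')) (g : Fin b → (Z ⟶ Z'))
    (F : Fin (b + a) → (Z ⟶ Z')) (hf : ∀ i : Fin a, F ⟨i.1, by omega⟩ = f i)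
    (hg : ∀ j : Fin b, F ⟨a + j.1, by omega⟩ = g j) :
    (tensorFam a f ⊗ₘ tensorFam b g) ≫ (concat Z' b a).hom =
      (concat Z b a).hom ≫ tensorFam (b + a) F := by
  induction a with
  | zero =>
    have : F = g := funext fun j => by
      rw [← hg j]
      congr 1
      exact Fin.ext (by simp)
    rw [this]
    change (𝟙 _ ⊗ₘ _) ≫ (λ_ _).hom = (λ_ _).hom ≫ _
    rw [id_tensorHom, leftUnitor_naturality]
    rfl
  | succ a ih =>
    have h0 : F 0 = f 0 := hf 0
    have h1 := ih (fun i => f i.succ) (fun i => F i.succ) (fun i => hf i.succ) (fun j => by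
      rw [← hg j]
      congr 1
      exact Fin.ext (by simp; omega))
    change ((f 0 ⊗ₘ tensorFam a _) ⊗ₘ _) ≫ (α_ _ _ _).hom ≫ Z' ◁ (concat Z' b a).hom =
      ((α_ _ _ _).hom ≫ Z ◁ (concat Z b a).hom) ≫ (F 0 ⊗ₘ tensorFam (b + a) _)
    rw [associator_naturality_assoc, ← id_tensorHom, ← id_tensorHom,
      MonoidalCategory.tensorHom_comp_tensorHom, h1, Category.assoc,
      MonoidalCategory.tensorHom_comp_tensorHom, Category.comp_id, Category.id_comp, h0]
    rfl

variable [SymmetricCategory 𝒞]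

theorem tensorHom_braidFront {X X' Y Y' T T' : 𝒞} (f : X ⟶ X') (g : Y ⟶ Y') (h : T ⟶ T') :
    (f ⊗ₘ (g ⊗ₘ h)) ≫ braidFront X' Y' T' = braidFront X Y T ≫ (g ⊗ₘ (f ⊗ₘ h)) := by
  simp only [braidFront, Category.assoc]
  rw [associator_inv_naturality_assoc, ← associator_naturality, ← tensorHom_id, ← tensorHom_id,
    MonoidalCategory.tensorHom_comp_tensorHom_assoc, BraidedCategory.braiding_naturality,
    MonoidalCategory.tensorHom_comp_tensorHom_assoc, Category.comp_id, Category.id_comp]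

theorem tensorFam_adjBraid {Z Z' : 𝒞} (n i : ℕ) (hi : i + 1 < n) (f : Fin n → (Z ⟶ Z')) :
    tensorFam n f ≫ adjBraid Z' n i = adjBraid Z n i ≫ tensorFam n fun k => f (adjSwap n i k) := by
  induction n generalizing i with
  | zero => omega
  | succ n ih =>
    cases i with
    | zero =>
      obtain ⟨m, rfl⟩ : ∃ m, n = m + 1 := ⟨n - 1, by omega⟩
      have h0 : adjSwap (m + 1 + 1) 0 0 = Fin.succ 0 :=
        Fin.ext (by rw [adjSwap_val _ _ hi]; simp)
      have h1 : adjSwap (m + 1 + 1) 0 (Fin.succ 0) = 0 :=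
        Fin.ext (by rw [adjSwap_val _ _ hi]; simp)
      have h2 : ∀ k : Fin m, adjSwap (m + 1 + 1) 0 k.succ.succ = k.succ.succ := fun k =>
        Fin.ext (by rw [adjSwap_val _ _ hi]; simp)
      change (f 0 ⊗ₘ (f (Fin.succ 0) ⊗ₘ tensorFam m _)) ≫ braidFront Z' Z' _ =
        braidFront Z Z _ ≫ (f _ ⊗ₘ (f _ ⊗ₘ tensorFam m _))
      rw [tensorHom_braidFront, h0, h1]
      simp only [h2]
    | succ i =>
      have h0 : adjSwap (n + 1) (i + 1) 0 = 0 :=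
        Fin.ext (by rw [adjSwap_val _ _ hi]; simp)
      have h1 : ∀ k : Fin n, adjSwap (n + 1) (i + 1) k.succ = (adjSwap n i k).succ := fun k =>
        Fin.ext (by
          rw [adjSwap_val _ _ hi, Fin.val_succ, Fin.val_succ, adjSwap_val _ _ (by omega)]
          split_ifs <;> omega)
      change (f 0 ⊗ₘ tensorFam n _) ≫ Z' ◁ adjBraid Z' n i =
        Z ◁ adjBraid Z n i ≫ (f _ ⊗ₘ tensorFam n _)
      rw [h0, ← id_tensorHom, ← id_tensorHom, MonoidalCategory.tensorHom_comp_tensorHom,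
        MonoidalCategory.tensorHom_comp_tensorHom, ih i (by omega), Category.comp_id,
        Category.id_comp]
      simp only [h1]

/-- Only adjacent transpositions need a check, where it is naturality of the braiding. Different
morphisms in the factors are allowed, and they get permuted; this yields the conjugation rule of the
idempotents `E w`. -/
theorem tensorFam_permAction {Z Z' : 𝒞} (n : ℕ) (σ : Equiv.Perm (Fin n))
    (f : Fin n → (Z ⟶ Z')) :
    tensorFam n f ≫ (permAction Z' n σ : tensorPow Z' n ⟶ tensorPow Z' n) =
      (permAction Z n σ : tensorPow Z n ⟶ tensorPow Z n) ≫
        tensorFam n fun k => f (σ.symm k) := by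
  induction σ using perm_induction generalizing f with
  | h1 =>
    rw [map_one, map_one]
    exact (Category.comp_id _).trans (Category.id_comp _).symm
  | hmul σ τ hσ hτ =>
    rw [map_mul, map_mul, End.mul_def, End.mul_def, ← Category.assoc, hτ, Category.assoc, hσ,
      Category.assoc]
    rfl
  | hadj i hi =>
    rw [permAction_adjSwap _ _ _ hi, permAction_adjSwap _ _ _ hi, tensorFam_adjBraid n i hi,
      adjSwap_symm _ _ hi]

theorem adjBraid_whiskerRight_concat (Z : 𝒞) (b a i : ℕ) (hi : i + 1 < a) :
    adjBraid Z a i ▷ tensorPow Z b ≫ (concat Z b a).hom =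
      (concat Z b a).hom ≫ adjBraid Z (b + a) i := by
  induction a generalizing i with
  | zero => omega
  | succ a ih =>
    cases i with
    | zero =>
      obtain ⟨m, rfl⟩ : ∃ m, a = m + 1 := ⟨a - 1, by omega⟩
      change braidFront Z Z (tensorPow Z m) ▷ _ ≫ (α_ _ _ _).hom ≫
        Z ◁ ((α_ _ _ _).hom ≫ Z ◁ (concat Z b m).hom) =
        ((α_ _ _ _).hom ≫ Z ◁ ((α_ _ _ _).hom ≫ Z ◁ (concat Z b m).hom)) ≫
          braidFront Z Z (tensorPow Z (b + m))
      have h := braidFront_naturality Z Z (concat Z b m).hom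
      rw [MonoidalCategory.whiskerLeft_comp, Category.assoc, Category.assoc, ← h]
      have h2 : braidFront Z Z (tensorPow Z m) ▷ tensorPow Z b ≫ (α_ _ _ _).hom ≫
          Z ◁ (α_ _ _ _).hom = (α_ _ _ _).hom ≫ Z ◁ (α_ _ _ _).hom ≫
            braidFront Z Z (tensorPow Z m ⊗ tensorPow Z b) := by
        simp only [braidFront]
        monoidal
      have h3 := congrArg (fun f => f ≫ Z ◁ (Z ◁ (concat Z b m).hom)) h2
      simp only [Category.assoc] at h3
      exact h3
    | succ i =>
      have h := ih i (by omega)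
      change (Z ◁ adjBraid Z a i) ▷ _ ≫ (α_ _ _ _).hom ≫ Z ◁ (concat Z b a).hom =
        ((α_ _ _ _).hom ≫ Z ◁ (concat Z b a).hom) ≫ Z ◁ adjBraid Z (b + a) i
      rw [associator_naturality_middle_assoc, ← MonoidalCategory.whiskerLeft_comp, h,
        MonoidalCategory.whiskerLeft_comp, Category.assoc]

theorem whiskerLeft_adjBraid_concat (Z : 𝒞) (b a i : ℕ) :
    tensorPow Z a ◁ adjBraid Z b i ≫ (concat Z b a).hom =
      (concat Z b a).hom ≫ adjBraid Z (b + a) (i + a) := by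
  induction a with
  | zero => exact leftUnitor_naturality _
  | succ a ih =>
    change (Z ⊗ tensorPow Z a) ◁ _ ≫ (α_ _ _ _).hom ≫ Z ◁ (concat Z b a).hom =
        ((α_ _ _ _).hom ≫ Z ◁ (concat Z b a).hom) ≫ Z ◁ adjBraid Z (b + a) (i + a)
    rw [associator_naturality_right_assoc, ← MonoidalCategory.whiskerLeft_comp, ih,
      MonoidalCategory.whiskerLeft_comp, Category.assoc]

/-- The embedding of the first `a` positions. -/
def embFirst (b a : ℕ) : Fin a ↪ Fin (b + a) :=
  ⟨fun i => ⟨i.1, by omega⟩, fun i j h => Fin.ext (by simpa using h)⟩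

/-- The embedding of the last `b` positions. -/
def embLast (b a : ℕ) : Fin b ↪ Fin (b + a) :=
  ⟨fun i => ⟨a + i.1, by omega⟩, fun i j h => Fin.ext (by simpa using h)⟩

theorem viaEmbedding_embFirst_adjSwap (b a i : ℕ) (hi : i + 1 < a) :
    Equiv.Perm.viaEmbeddingHom (embFirst b a) (adjSwap a i) = adjSwap (b + a) i := by
  rw [Equiv.Perm.viaEmbeddingHom_apply]
  refine Equiv.ext fun k => ?_
  by_cases hk : k.1 < a
  · have := Equiv.Perm.viaEmbedding_apply (adjSwap a i) (embFirst b a) ⟨k.1, hk⟩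
    refine this.trans (Fin.ext ?_)
    change (adjSwap a i ⟨k.1, hk⟩).1 = _
    rw [adjSwap_val _ _ hi, adjSwap_val _ _ (by omega)]
  · rw [Equiv.Perm.viaEmbedding_apply_of_notMem]
    · refine Fin.ext ?_
      rw [adjSwap_val _ _ (by omega)]
      split_ifs <;> omega
    · rintro ⟨j, rfl⟩
      exact hk j.2

theorem viaEmbedding_embLast_adjSwap (b a i : ℕ) (hi : i + 1 < b) :
    Equiv.Perm.viaEmbeddingHom (embLast b a) (adjSwap b i) = adjSwap (b + a) (i + a) := by
  rw [Equiv.Perm.viaEmbeddingHom_apply]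
  refine Equiv.ext fun k => ?_
  by_cases hk : a ≤ k.1
  · have := Equiv.Perm.viaEmbedding_apply (adjSwap b i) (embLast b a) ⟨k.1 - a, by omega⟩
    have e : embLast b a ⟨k.1 - a, by omega⟩ = k := 
      Fin.ext (show a + (k.1 - a) = k.1 by omega)
    rw [e] at this
    refine this.trans (Fin.ext ?_)
    change a + (adjSwap b i ⟨k.1 - a, _⟩).1 = _
    rw [adjSwap_val _ _ hi, adjSwap_val _ _ (by omega)]
    split_ifs <;> simp only at * <;> omega
  · rw [Equiv.Perm.viaEmbedding_apply_of_notMem]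
    · refine Fin.ext ?_
      rw [adjSwap_val _ _ (by omega)]
      split_ifs <;> omega
    · rintro ⟨j, rfl⟩
      exact hk (Nat.le_add_right a j.1)

theorem permAction_whiskerRight_concat (Z : 𝒞) (b a : ℕ) (σ : Equiv.Perm (Fin a)) :
    permAction Z a σ ▷ tensorPow Z b ≫ (concat Z b a).hom =
      (concat Z b a).hom ≫ (permAction Z (b + a)
        (Equiv.Perm.viaEmbeddingHom (embFirst b a) σ) : tensorPow Z (b + a) ⟶ _) := by
  induction σ using perm_induction with
  | h1 =>
    rw [map_one, map_one, map_one]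
    exact (congrArg (fun f => f ≫ _) (id_whiskerRight _ _)).trans
      ((Category.id_comp _).trans (Category.comp_id _).symm)
  | hmul σ τ hσ hτ =>
    rw [map_mul, map_mul, map_mul, End.mul_def, End.mul_def, comp_whiskerRight, Category.assoc,
      hσ, ← Category.assoc, hτ, Category.assoc]
  | hadj i hi =>
    rw [viaEmbedding_embFirst_adjSwap _ _ _ hi, permAction_adjSwap _ _ _ hi,
      permAction_adjSwap _ _ _ (by omega), adjBraid_whiskerRight_concat _ _ _ _ hi]

theorem whiskerLeft_permAction_concat (Z : 𝒞) (b a : ℕ) (σ : Equiv.Perm (Fin b)) :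
    tensorPow Z a ◁ permAction Z b σ ≫ (concat Z b a).hom =
      (concat Z b a).hom ≫ (permAction Z (b + a)
        (Equiv.Perm.viaEmbeddingHom (embLast b a) σ) : tensorPow Z (b + a) ⟶ _) := by
  induction σ using perm_induction with
  | h1 =>
    rw [map_one, map_one, map_one]
    exact (congrArg (fun f => f ≫ _) (MonoidalCategory.whiskerLeft_id _ _)).trans
      ((Category.id_comp _).trans (Category.comp_id _).symm)
  | hmul σ τ hσ hτ =>
    rw [map_mul, map_mul, map_mul, End.mul_def, End.mul_def, MonoidalCategory.whiskerLeft_comp,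
      Category.assoc, hσ, ← Category.assoc, hτ, Category.assoc]
  | hadj i hi =>
    rw [viaEmbedding_embLast_adjSwap _ _ _ hi, permAction_adjSwap _ _ _ hi,
      permAction_adjSwap _ _ _ (by omega), whiskerLeft_adjBraid_concat]

end TensorFam

/-! ### Rational linearity of whiskering -/

section RatLinear

variable {𝒞 : Type*} [Category 𝒞] [Preadditive 𝒞] [Linear ℚ 𝒞] [MonoidalCategory 𝒞]
  [MonoidalPreadditive 𝒞]

/-- Additive maps between rational vector spaces are rationally linear. -/
theorem rat_smul_whiskerRight (r : ℚ) {X Y : 𝒞} (f : X ⟶ Y) (Z : 𝒞) :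
    (r • f) ▷ Z = r • (f ▷ Z) :=
  map_rat_smul ((tensorRight Z).mapAddHom (X := X) (Y := Y)) r f

theorem whiskerLeft_rat_smul (r : ℚ) (Z : 𝒞) {X Y : 𝒞} (f : X ⟶ Y) :
    Z ◁ (r • f) = r • (Z ◁ f) :=
  map_rat_smul ((tensorLeft Z).mapAddHom (X := X) (Y := Y)) r f

end RatLinear

/-! ### Joining the cells of a subset and of its complement -/

section Join

variable {𝒞 : Type*} [Category 𝒞] [MonoidalCategory 𝒞] [SymmetricCategory 𝒞]

/-- Two numberings of the same set differ by a permutation, whose action on the tensor power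
intertwines them. -/
theorem exists_reindex {ι : Type*} (Z : 𝒞) {m n : ℕ} (h : m = n) (θ : ι ≃ Fin m) (θ' : ι ≃ Fin n) :
    ∃ ω : tensorPow Z m ≅ tensorPow Z n,
      (∀ g : Equiv.Perm ι, (permAction Z m (θ.permCongr g) : tensorPow Z m ⟶ _) ≫ ω.hom =
        ω.hom ≫ (permAction Z n (θ'.permCongr g) : tensorPow Z n ⟶ _)) ∧
      ∀ f : ι → (Z ⟶ Z), tensorFam m (fun i => f (θ.symm i)) ≫ ω.hom =
        ω.hom ≫ tensorFam n fun i => f (θ'.symm i) := by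
  subst h
  let τ : Equiv.Perm (Fin m) := θ.symm.trans θ'
  let ω : tensorPow Z m ≅ tensorPow Z m :=
    { hom := permAction Z m τ
      inv := permAction Z m τ⁻¹
      hom_inv_id := by
        rw [← End.mul_def, ← map_mul, inv_mul_cancel, map_one]; rfl
      inv_hom_id := by
        rw [← End.mul_def, ← map_mul, mul_inv_cancel, map_one]; rfl }
  refine ⟨ω, fun g => ?_, fun f => ?_⟩
  · change (permAction Z m (θ.permCongr g) : tensorPow Z m ⟶ _) ≫ permAction Z m τ =
      (permAction Z m τ : tensorPow Z m ⟶ _) ≫ permAction Z m (θ'.permCongr g)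
    rw [← End.mul_def, ← map_mul, ← End.mul_def, ← map_mul]
    congr 1
    ext i
    simp [τ]
  · refine (tensorFam_permAction m τ _).trans ?_
    congr 2
    funext i
    simp [τ]

variable {D B : Finset (ℕ × ℕ)}

-- A numbering of `D` adapted to concatenation: first the complement of `B`, then `B`, each in its
-- own numbering.
open Classical in
theorem exists_splitEquiv (hB : B ⊆ D) : ∃ θ : D ≃ Fin (B.card + (D \ B).card),
    (∀ x : ↥(D \ B), θ ⟨x.1, Finset.sdiff_subset x.2⟩ = embFirst _ _ ((D \ B).equivFin x)) ∧
      ∀ x : B, θ ⟨x.1, hB x.2⟩ = embLast _ _ (B.equivFin x) := by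
  let f : D → Fin (B.card + (D \ B).card) := fun x =>
    if h : x.1 ∈ B then embLast _ _ (B.equivFin ⟨x.1, h⟩) else
      embFirst _ _ ((D \ B).equivFin ⟨x.1, Finset.mem_sdiff.2 ⟨x.2, h⟩⟩)
  have hne : ∀ x y, embFirst B.card (D \ B).card x ≠ embLast _ _ y := by
    intro x y h
    have := congrArg Fin.val h
    have h2 : x.1 = (D \ B).card + y.1 := this
    omega
  have hinj : Function.Injective f := by
    intro x y h
    simp only [f] at h
    split_ifs at h with h1 h2 h2
    · exact Subtype.ext (congrArg (fun z : B => z.1)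
        (B.equivFin.injective ((embLast _ _).injective h)))
    · exact (hne _ _ h.symm).elim
    · exact (hne _ _ h).elim
    · exact Subtype.ext (congrArg (fun z : ↥(D \ B) => z.1)
        ((D \ B).equivFin.injective ((embFirst _ _).injective h)))
  have hcard : Fintype.card D = Fintype.card (Fin (B.card + (D \ B).card)) := by
    rw [Fintype.card_coe, Fintype.card_fin, add_comm, Finset.card_sdiff_add_card_eq_card hB]
  refine ⟨Equiv.ofBijective f ((Fintype.bijective_iff_injective_and_card f).2 ⟨hinj, hcard⟩),
    fun x => ?_, fun x => ?_⟩
  · exact dif_neg (Finset.mem_sdiff.1 x.2).2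
  · exact dif_pos x.2

theorem permCongr_inclHom_first (hB : B ⊆ D) {θ : D ≃ Fin (B.card + (D \ B).card)}
    (h1 : ∀ x : ↥(D \ B), θ ⟨x.1, Finset.sdiff_subset x.2⟩ =
      embFirst _ _ ((D \ B).equivFin x))
    (h2 : ∀ x : B, θ ⟨x.1, hB x.2⟩ = embLast _ _ (B.equivFin x)) (g : Equiv.Perm ↥(D \ B)) :
    θ.permCongr (inclHom Finset.sdiff_subset g) =
      Equiv.Perm.viaEmbeddingHom (embFirst _ _) ((D \ B).equivFin.permCongr g) := by
  refine Equiv.ext fun i => ?_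
  obtain ⟨x, rfl⟩ := θ.surjective i
  rw [Equiv.permCongr_apply, Equiv.symm_apply_apply, Equiv.Perm.viaEmbeddingHom_apply]
  by_cases hx : x.1 ∈ D \ B
  · rw [inclHom_apply _ _ _ hx, h1 ⟨x.1, hx⟩, Equiv.Perm.viaEmbedding_apply, h1]
    simp
  · rw [inclHom_apply_of_notMem _ _ _ hx]
    have hxB : x.1 ∈ B := by
      by_contra h
      exact hx (Finset.mem_sdiff.2 ⟨x.2, h⟩)
    rw [h2 ⟨x.1, hxB⟩, Equiv.Perm.viaEmbedding_apply_of_notMem]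
    rintro ⟨y, hy⟩
    have h3 : y.1 = (D \ B).card + (B.equivFin ⟨x.1, hxB⟩).1 := congrArg Fin.val hy
    omega

theorem permCongr_inclHom_last (hB : B ⊆ D) {θ : D ≃ Fin (B.card + (D \ B).card)}
    (h1 : ∀ x : ↥(D \ B), θ ⟨x.1, Finset.sdiff_subset x.2⟩ =
      embFirst _ _ ((D \ B).equivFin x))
    (h2 : ∀ x : B, θ ⟨x.1, hB x.2⟩ = embLast _ _ (B.equivFin x)) (g : Equiv.Perm B) :
    θ.permCongr (inclHom hB g) =
      Equiv.Perm.viaEmbeddingHom (embLast _ _) (B.equivFin.permCongr g) := by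
  refine Equiv.ext fun i => ?_
  obtain ⟨x, rfl⟩ := θ.surjective i
  rw [Equiv.permCongr_apply, Equiv.symm_apply_apply, Equiv.Perm.viaEmbeddingHom_apply]
  by_cases hx : x.1 ∈ B
  · rw [inclHom_apply _ _ _ hx, h2 ⟨x.1, hx⟩, Equiv.Perm.viaEmbedding_apply, h2]
    simp
  · rw [inclHom_apply_of_notMem _ _ _ hx]
    rw [h1 ⟨x.1, Finset.mem_sdiff.2 ⟨x.2, hx⟩⟩, Equiv.Perm.viaEmbedding_apply_of_notMem]
    rintro ⟨y, hy⟩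
    have h3 : (D \ B).card + y.1 = ((D \ B).equivFin ⟨x.1, Finset.mem_sdiff.2 ⟨x.2, hx⟩⟩).1 :=
      congrArg Fin.val hy
    omega

variable [Preadditive 𝒞] [Linear ℚ 𝒞]

theorem cellAction_of (D : Finset (ℕ × ℕ)) (X : 𝒞) (g : Equiv.Perm D) :
    cellAction D X (MonoidAlgebra.of ℚ _ g) = permAction X D.card (D.equivFin.permCongr g) := by
  rw [cellAction, MonoidAlgebra.lift_of]
  rfl

variable [MonoidalPreadditive 𝒞]

/-- Concatenate in the adapted numbering, in which the two groups act on the first and the last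
positions, and then pass to the standard numbering of `D`. -/
theorem exists_concat_action (hB : B ⊆ D) (Z : 𝒞) :
    ∃ ω : tensorPow Z (D \ B).card ⊗ tensorPow Z B.card ≅ tensorPow Z D.card,
      (∀ x y, (cellAction (D \ B) Z x ⊗ₘ cellAction B Z y) ≫ ω.hom =
        ω.hom ≫ (cellAction D Z (inclAlg Finset.sdiff_subset x * inclAlg hB y) :
          tensorPow Z D.card ⟶ _)) ∧
      ∀ f g : Z ⟶ Z, (tensorFam _ (fun _ => f) ⊗ₘ tensorFam _ (fun _ => g)) ≫ ω.hom =
        ω.hom ≫ tensorFam D.card fun i => if (D.equivFin.symm i).1 ∈ B then g else f := by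
  obtain ⟨θ, h1, h2⟩ := exists_splitEquiv hB
  obtain ⟨ω, h3, h4⟩ := exists_reindex Z (by
    rw [add_comm, Finset.card_sdiff_add_card_eq_card hB]) θ D.equivFin
  have e1 : ∀ x : MonoidAlgebra ℚ (Equiv.Perm ↥(D \ B)),
      cellAction (D \ B) Z x ▷ tensorPow Z B.card ≫ (concat Z _ _).hom ≫ ω.hom =
        (concat Z _ _).hom ≫ ω.hom ≫
          (cellAction D Z (inclAlg Finset.sdiff_subset x) : tensorPow Z D.card ⟶ _) := by
    intro x
    induction x using MonoidAlgebra.induction_on with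
    | of g =>
      rw [inclAlg_of, cellAction_of, cellAction_of, ← h3, permCongr_inclHom_first hB h1 h2,
        ← Category.assoc, permAction_whiskerRight_concat, Category.assoc]
    | add x y hx hy =>
      rw [map_add, map_add, map_add]
      exact (congrArg (fun f => f ≫ _) (MonoidalPreadditive.add_whiskerRight _ _)).trans
        ((Preadditive.add_comp _ _ _ _ _ _).trans (by
          rw [hx, hy, ← Preadditive.comp_add, ← Preadditive.comp_add]))
    | smul r x hx =>
      rw [map_smul, map_smul, map_smul]
      exact (congrArg (fun f => f ≫ _) (rat_smul_whiskerRight r _ _)).trans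
        ((Linear.smul_comp _ _ _ _ _ _).trans (by
          rw [hx, ← Linear.comp_smul, ← Linear.comp_smul]))
  have e2 : ∀ x : MonoidAlgebra ℚ (Equiv.Perm B),
      tensorPow Z (D \ B).card ◁ cellAction B Z x ≫ (concat Z _ _).hom ≫ ω.hom =
        (concat Z _ _).hom ≫ ω.hom ≫
          (cellAction D Z (inclAlg hB x) : tensorPow Z D.card ⟶ _) := by
    intro x
    induction x using MonoidAlgebra.induction_on with
    | of g =>
      rw [inclAlg_of, cellAction_of, cellAction_of, ← h3, permCongr_inclHom_last hB h1 h2,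
        ← Category.assoc, whiskerLeft_permAction_concat, Category.assoc]
    | add x y hx hy =>
      rw [map_add, map_add, map_add]
      exact (congrArg (fun f => f ≫ _) (MonoidalPreadditive.whiskerLeft_add _ _)).trans
        ((Preadditive.add_comp _ _ _ _ _ _).trans (by
          rw [hx, hy, ← Preadditive.comp_add, ← Preadditive.comp_add]))
    | smul r x hx =>
      rw [map_smul, map_smul, map_smul]
      exact (congrArg (fun f => f ≫ _) (whiskerLeft_rat_smul r _ _)).trans
        ((Linear.smul_comp _ _ _ _ _ _).trans (by
          rw [hx, ← Linear.comp_smul, ← Linear.comp_smul]))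
  refine ⟨concat Z _ _ ≪≫ ω, fun x y => ?_, fun f g => ?_⟩
  · rw [Iso.trans_hom, tensorHom_def', Category.assoc, e1, map_mul, End.mul_def]
    rw [← Category.assoc, ← Category.assoc, Category.assoc (_ ◁ _), e2]
    simp only [Category.assoc]
  · rw [Iso.trans_hom, Category.assoc, ← h4 fun x => if x.1 ∈ B then g else f,
      ← Category.assoc, ← Category.assoc]
    congr 1
    refine tensorFam_concat _ _ _ _ _ (fun i => ?_) fun i => ?_
    · have : θ.symm (embFirst _ _ i) =
          ⟨((D \ B).equivFin.symm i).1, Finset.sdiff_subset ((D \ B).equivFin.symm i).2⟩ := by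
        rw [Equiv.symm_apply_eq, h1, Equiv.apply_symm_apply]
      change (if (θ.symm (embFirst _ _ i)).1 ∈ B then _ else _) = _
      rw [this]
      exact if_neg (Finset.mem_sdiff.1 ((D \ B).equivFin.symm i).2).2
    · have : θ.symm (embLast _ _ i) =
          ⟨(B.equivFin.symm i).1, hB (B.equivFin.symm i).2⟩ := by
        rw [Equiv.symm_apply_eq, h2, Equiv.apply_symm_apply]
      change (if (θ.symm (embLast _ _ i)).1 ∈ B then _ else _) = _
      rw [this]
      exact if_pos (B.equivFin.symm i).2

end Join

/-! ### Multilinear expansion -/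

section TensorFamLinear

variable {𝒞 : Type*} [Category 𝒞] [Preadditive 𝒞] [MonoidalCategory 𝒞] [MonoidalPreadditive 𝒞]

theorem tensorFam_eq_zero {Z Z' : 𝒞} (n : ℕ) (f : Fin n → (Z ⟶ Z')) (i : Fin n) (h : f i = 0) :
    tensorFam n f = 0 := by
  induction n with
  | zero => exact i.elim0
  | succ n ih =>
    change f 0 ⊗ₘ tensorFam n _ = 0
    cases i using Fin.cases with
    | zero => rw [h, MonoidalPreadditive.zero_tensor]
    | succ i => rw [ih _ i h, MonoidalPreadditive.tensor_zero]

theorem sum_tensorFam {Z Z' : 𝒞} (f g : Z ⟶ Z') (n : ℕ) :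
    ∑ v : Fin n → Bool, tensorFam n (fun i => if v i then g else f) =
      tensorFam n fun _ => f + g := by
  induction n with
  | zero => exact Fintype.sum_unique _
  | succ n ih =>
    rw [← Equiv.sum_comp (Fin.consEquiv fun _ => Bool), Fintype.sum_prod_type]
    change ∑ x : Bool, ∑ y : Fin n → Bool, ((if x = true then g else f) ⊗ₘ
      tensorFam n (fun i => if y i = true then g else f)) = (f + g) ⊗ₘ tensorFam n fun _ => f + g
    simp only [← tensor_sum, ih]
    rw [Fintype.sum_bool, MonoidalPreadditive.add_tensor]
    simp [add_comm]

end TensorFamLinear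

/-! ### The branching rule for a direct sum -/

section Sum

variable {𝒞 : Type*} [Category 𝒞] [Preadditive 𝒞] [Linear ℚ 𝒞] [MonoidalCategory 𝒞]
  [SymmetricCategory 𝒞]

theorem tensorFam_cellAction (D : Finset (ℕ × ℕ)) {X Z : 𝒞} (f : X ⟶ Z)
    (x : MonoidAlgebra ℚ (Equiv.Perm D)) :
    (cellAction D X x : tensorPow X D.card ⟶ _) ≫ tensorFam D.card (fun _ => f) =
      tensorFam D.card (fun _ => f) ≫ (cellAction D Z x : tensorPow Z D.card ⟶ _) := by
  induction x using MonoidAlgebra.induction_on with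
  | of g => rw [cellAction_of, cellAction_of, tensorFam_permAction]
  | add x y hx hy =>
    rw [map_add, map_add]
    exact (Preadditive.add_comp _ _ _ _ _ _).trans
      ((congrArg₂ (· + ·) hx hy).trans (Preadditive.comp_add _ _ _ _ _ _).symm)
  | smul r x hx =>
    rw [map_smul, map_smul]
    exact (Linear.smul_comp _ _ _ _ _ _).trans
      ((congrArg (r • ·) hx).trans (Linear.comp_smul _ _ _ _ _ _).symm)

variable [MonoidalPreadditive 𝒞] {D : Finset (ℕ × ℕ)}

/-- The subset system on the tensor power of a direct sum `X ⊕ Y`, given by two complementary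
idempotents `e` and `e'`. -/
noncomputable def sumSystem (D : Finset (ℕ × ℕ)) {Z : 𝒞} (e e' : Z ⟶ Z) (he : e ≫ e = e)
    (he' : e' ≫ e' = e') (h₁ : e ≫ e' = 0) (h₂ : e' ≫ e = 0) (hs : e + e' = 𝟙 Z) :
    SubsetSystem D (End (tensorPow Z D.card)) where
  ρ := cellAction D Z
  E w := tensorFam D.card fun i => if w (D.equivFin.symm i) then e' else e
  idem w := by
    rw [End.mul_def, tensorFam_comp]
    congr 1
    funext i
    split_ifs <;> assumption
  orth w w' h := by
    rw [End.mul_def, tensorFam_comp]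
    obtain ⟨x, hx⟩ := Function.ne_iff.1 h
    refine tensorFam_eq_zero _ _ (D.equivFin x) ?_
    rw [Equiv.symm_apply_apply]
    cases h3 : w x <;> cases h4 : w' x <;> simp_all
  sum := by
    have := sum_tensorFam e e' D.card
    rw [hs, tensorFam_id] at this
    refine Eq.trans ?_ this
    exact Fintype.sum_equiv (Equiv.arrowCongr D.equivFin (Equiv.refl Bool)) _ _ fun w => rfl
  conj g w := by
    rw [cellAction_of, End.mul_def, End.mul_def]
    refine (tensorFam_permAction _ _ _).trans ?_
    congr 2
    funext i
    change _ = if w (g.symm (D.equivFin.symm i)) then e' else e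
    congr 3
    exact D.equivFin.symm_apply_apply _

/-- The summand of the tensor power of a direct sum that belongs to the word `w`. -/
theorem exists_word_summand {X Y Z : 𝒞} (inl : X ⟶ Z) (fst : Z ⟶ X) (inr : Y ⟶ Z) (snd : Z ⟶ Y)
    (h₁ : inl ≫ fst = 𝟙 X) (h₂ : inr ≫ snd = 𝟙 Y) (w : D → Bool) :
    ∃ (j : tensorPow X (D \ wordCells w).card ⊗ tensorPow Y (wordCells w).card ⟶
        tensorPow Z D.card)
      (q : tensorPow Z D.card ⟶
        tensorPow X (D \ wordCells w).card ⊗ tensorPow Y (wordCells w).card),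
      j ≫ q = 𝟙 _ ∧
      q ≫ j = tensorFam D.card (fun i => if w (D.equivFin.symm i) then snd ≫ inr else fst ≫ inl) ∧
      (youngEnd (D \ wordCells w) X ⊗ₘ youngEnd (wordCells w) Y) ≫ j =
        j ≫ (cellAction D Z (splitYoungElt (wordCells_subset w)) : tensorPow Z D.card ⟶ _) := by
  obtain ⟨ω, hω₁, hω₂⟩ := exists_concat_action (wordCells_subset w) Z
  refine ⟨(tensorFam _ (fun _ => inl) ⊗ₘ tensorFam _ (fun _ => inr)) ≫ ω.hom,
    ω.inv ≫ (tensorFam _ (fun _ => fst) ⊗ₘ tensorFam _ (fun _ => snd)), ?_, ?_, ?_⟩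
  · rw [Category.assoc, Iso.hom_inv_id_assoc, MonoidalCategory.tensorHom_comp_tensorHom,
      tensorFam_comp, tensorFam_comp]
    simp only [h₁, h₂, tensorFam_id]
    exact id_tensorHom_id _ _
  · rw [Category.assoc, MonoidalCategory.tensorHom_comp_tensorHom_assoc, tensorFam_comp,
      tensorFam_comp, hω₂, Iso.inv_hom_id_assoc]
    simp only [mem_wordCells]
  · rw [Category.assoc, splitYoungElt, ← hω₁, MonoidalCategory.tensorHom_comp_tensorHom_assoc,
      MonoidalCategory.tensorHom_comp_tensorHom_assoc, youngEnd, youngEnd, ← tensorFam_cellAction,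
      ← tensorFam_cellAction]
    rfl

/-- The decomposition of the Schur functor of a direct sum. -/
theorem exists_schur_sum_decomposition (hD : IsLowerSet (D : Set (ℕ × ℕ))) {X Y Z R : 𝒞}
    (inl : X ⟶ Z) (fst : Z ⟶ X) (inr : Y ⟶ Z) (snd : Z ⟶ Y) (h₁ : inl ≫ fst = 𝟙 X)
    (h₂ : inr ≫ snd = 𝟙 Y) (h₃ : inl ≫ snd = 0) (h₄ : inr ≫ fst = 0)
    (h₅ : fst ≫ inl + snd ≫ inr = 𝟙 Z)
    (π : tensorPow Z D.card ⟶ R) (ι : R ⟶ tensorPow Z D.card) [IsSplitEpi π] [IsSplitMono ι]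
    (hπι : π ≫ ι = youngEnd D Z) (M₁ M₂ : {w : D → Bool // IsLow w} → 𝒞)
    (p₁ : ∀ w : {w : D → Bool // IsLow w}, tensorPow X (D \ wordCells w.1).card ⟶ M₁ w)
    (i₁ : ∀ w : {w : D → Bool // IsLow w}, M₁ w ⟶ tensorPow X (D \ wordCells w.1).card)
    (p₂ : ∀ w : {w : D → Bool // IsLow w}, tensorPow Y (wordCells w.1).card ⟶ M₂ w)
    (i₂ : ∀ w : {w : D → Bool // IsLow w}, M₂ w ⟶ tensorPow Y (wordCells w.1).card)
    (hp₁ : ∀ w, IsSplitEpi (p₁ w)) (hi₁ : ∀ w, IsSplitMono (i₁ w))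
    (hp₂ : ∀ w, IsSplitEpi (p₂ w)) (hi₂ : ∀ w, IsSplitMono (i₂ w))
    (hM₁ : ∀ w : {w : D → Bool // IsLow w}, p₁ w ≫ i₁ w = youngEnd (D \ wordCells w.1) X)
    (hM₂ : ∀ w : {w : D → Bool // IsLow w}, p₂ w ≫ i₂ w = youngEnd (wordCells w.1) Y) :
    ∃ (a : ∀ w, M₁ w ⊗ M₂ w ⟶ R) (b : ∀ w, R ⟶ M₁ w ⊗ M₂ w), (∀ w, a w ≫ b w = 𝟙 _) ∧
      (∀ w w', w ≠ w' → a w ≫ b w' = 0) ∧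
      ∀ [Fintype {w : D → Bool // IsLow w}], ∑ w, b w ≫ a w = 𝟙 R := by
  have t₁ : (fst ≫ inl) ≫ fst ≫ inl = fst ≫ inl := by
    rw [Category.assoc, reassoc_of% h₁]
  have t₂ : (snd ≫ inr) ≫ snd ≫ inr = snd ≫ inr := by
    rw [Category.assoc, reassoc_of% h₂]
  have t₃ : (fst ≫ inl) ≫ snd ≫ inr = 0 := by
    rw [Category.assoc, reassoc_of% h₃, zero_comp, comp_zero]
  have t₄ : (snd ≫ inr) ≫ fst ≫ inl = 0 := by
    rw [Category.assoc, reassoc_of% h₄, zero_comp, comp_zero]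
  choose j q hjq hqj hact using fun w : {w : D → Bool // IsLow w} =>
    exists_word_summand inl fst inr snd h₁ h₂ w.1
  -- The image of the diagonal block at `w` is the tensor product of the images of the two Young
  -- symmetrizers, seen inside the tensor power through the split inclusion `j w`.
  obtain ⟨a, b, h6, h7, h8⟩ := exists_decomposition hD
    (sumSystem D (fst ≫ inl) (snd ≫ inr) t₁ t₂ t₃ t₄ h₅) π ι hπι (fun w => M₁ w ⊗ M₂ w)
    (fun w => q w ≫ (p₁ w ⊗ₘ p₂ w)) (fun w => (i₁ w ⊗ₘ i₂ w) ≫ j w)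
    (fun w => ⟨⟨⟨(section_ (p₁ w) ⊗ₘ section_ (p₂ w)) ≫ j w, by
      rw [Category.assoc, ← Category.assoc (j w), hjq, Category.id_comp,
        MonoidalCategory.tensorHom_comp_tensorHom, IsSplitEpi.id, IsSplitEpi.id,
        id_tensorHom_id]⟩⟩⟩)
    (fun w => ⟨⟨⟨q w ≫ (retraction (i₁ w) ⊗ₘ retraction (i₂ w)), by
      rw [Category.assoc, ← Category.assoc (j w), hjq, Category.id_comp,
        MonoidalCategory.tensorHom_comp_tensorHom, IsSplitMono.id, IsSplitMono.id,
        id_tensorHom_id]⟩⟩⟩)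
    (fun w => by
      rw [Category.assoc, MonoidalCategory.tensorHom_comp_tensorHom_assoc, hM₁, hM₂, hact,
        ← Category.assoc, hqj]
      rfl)
  refine ⟨a, b, h6, h7, ?_⟩
  intro inst
  convert h8

end Sum

/-! ### Additivity of the tensor product of complexes -/

section MonoidalPreadditive

variable {𝒞 : Type*} [Category 𝒞] [Preadditive 𝒞] [HasFiniteBiproducts 𝒞] [MonoidalCategory 𝒞]
  [MonoidalPreadditive 𝒞] [SymmetricCategory 𝒞]

instance : MonoidalPreadditive (CochainComplex 𝒞 ℕ) where
  whiskerLeft_zero {K L M} := by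
    ext n
    apply ιT_ext
    intro i j h
    rw [ιT_whiskerLeft, HomologicalComplex.zero_f, HomologicalComplex.zero_f,
      MonoidalPreadditive.whiskerLeft_zero, zero_comp, comp_zero]
  zero_whiskerRight {K L M} := by
    ext n
    apply ιT_ext
    intro i j h
    rw [ιT_whiskerRight, HomologicalComplex.zero_f, HomologicalComplex.zero_f,
      MonoidalPreadditive.zero_whiskerRight, zero_comp, comp_zero]
  whiskerLeft_add {K L M} f g := by
    ext n
    apply ιT_ext
    intro i j h
    rw [ιT_whiskerLeft, HomologicalComplex.add_f_apply, HomologicalComplex.add_f_apply,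
      MonoidalPreadditive.whiskerLeft_add, Preadditive.add_comp, Preadditive.comp_add,
      ιT_whiskerLeft, ιT_whiskerLeft]
  add_whiskerRight {K L M} f g := by
    ext n
    apply ιT_ext
    intro i j h
    rw [ιT_whiskerRight, HomologicalComplex.add_f_apply, HomologicalComplex.add_f_apply,
      MonoidalPreadditive.add_whiskerRight, Preadditive.add_comp, Preadditive.comp_add,
      ιT_whiskerRight, ιT_whiskerRight]

end MonoidalPreadditive

/-! ### Images of conjugate endomorphisms -/

section Image

variable {𝒞 : Type*} [Category 𝒞]

theorem nonempty_image_iso {P P' Y Y' : 𝒞} (e : P ≅ P') {c : P ⟶ P} {c' : P' ⟶ P'}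
    (he : e.hom ≫ c' = c ≫ e.hom) (p : P ⟶ Y) (i : Y ⟶ P) [IsSplitEpi p] [IsSplitMono i]
    (h : p ≫ i = c) (p' : P' ⟶ Y') (i' : Y' ⟶ P') [IsSplitEpi p'] [IsSplitMono i']
    (h' : p' ≫ i' = c') : Nonempty (Y ≅ Y') := by
  have he' : e.inv ≫ c = c' ≫ e.inv := by
    rw [Iso.inv_comp_eq, ← Category.assoc, he, Category.assoc, Iso.hom_inv_id, Category.comp_id]
  subst h h'
  refine ⟨section_ p ≫ e.hom ≫ p', section_ p' ≫ e.inv ≫ p, ?_, ?_⟩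
  · rw [← cancel_mono i]
    simp only [Category.assoc, he', IsSplitEpi.id_assoc, Category.id_comp]
    rw [reassoc_of% he, Iso.hom_inv_id, Category.comp_id, IsSplitEpi.id_assoc]
  · rw [← cancel_mono i']
    simp only [Category.assoc, he, IsSplitEpi.id_assoc, Category.id_comp]
    rw [reassoc_of% he', Iso.inv_hom_id, Category.comp_id, IsSplitEpi.id_assoc]

end Image

/-! ### Independence of the differential -/

section GradedMaps

variable {𝒞 : Type*} [Category 𝒞] [Preadditive 𝒞] [HasFiniteBiproducts 𝒞] [MonoidalCategory 𝒞]
  [MonoidalPreadditive 𝒞] [SymmetricCategory 𝒞]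

/-- The tensor product of two families of morphisms between the terms of complexes, which need not
commute with the differentials. -/
noncomputable def gradedTensor {K K' L L' : CochainComplex 𝒞 ℕ} (f : ∀ i, K.X i ⟶ K'.X i)
    (g : ∀ i, L.X i ⟶ L'.X i) (n : ℕ) : (K ⊗ L).X n ⟶ (K' ⊗ L').X n :=
  HomologicalComplex.mapBifunctorDesc fun i j h => (f i ⊗ₘ g j) ≫ ιT K' L' i j n h

theorem ιT_gradedTensor {K K' L L' : CochainComplex 𝒞 ℕ} (f : ∀ i, K.X i ⟶ K'.X i)
    (g : ∀ i, L.X i ⟶ L'.X i) (i j n : ℕ) (h : i + j = n) :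
    ιT K L i j n h ≫ gradedTensor f g n = (f i ⊗ₘ g j) ≫ ιT K' L' i j n h :=
  HomologicalComplex.ι_mapBifunctorDesc _ _ _ _

theorem gradedTensor_comp {K K' K'' L L' L'' : CochainComplex 𝒞 ℕ} (f : ∀ i, K.X i ⟶ K'.X i)
    (f' : ∀ i, K'.X i ⟶ K''.X i) (g : ∀ i, L.X i ⟶ L'.X i) (g' : ∀ i, L'.X i ⟶ L''.X i) (n : ℕ) :
    gradedTensor f g n ≫ gradedTensor f' g' n =
      gradedTensor (fun i => f i ≫ f' i) (fun i => g i ≫ g' i) n := by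
  apply ιT_ext
  intro i j h
  rw [← Category.assoc, ιT_gradedTensor, Category.assoc, ιT_gradedTensor, ιT_gradedTensor,
    MonoidalCategory.tensorHom_comp_tensorHom_assoc]

theorem gradedTensor_id (K L : CochainComplex 𝒞 ℕ) (n : ℕ) :
    gradedTensor (fun i => 𝟙 (K.X i)) (fun i => 𝟙 (L.X i)) n = 𝟙 ((K ⊗ L).X n) := by
  apply ιT_ext
  intro i j h
  rw [ιT_gradedTensor, id_tensorHom_id, Category.id_comp, Category.comp_id]

theorem gradedTensor_f {K K' L L' : CochainComplex 𝒞 ℕ} (f : K ⟶ K') (g : L ⟶ L') (n : ℕ) :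
    gradedTensor f.f g.f n = (f ▷ L ≫ K' ◁ g).f n := by
  apply ιT_ext
  intro i j h
  rw [ιT_gradedTensor, HomologicalComplex.comp_f, ← Category.assoc, ιT_whiskerRight,
    Category.assoc, ιT_whiskerLeft, MonoidalCategory.tensorHom_def, Category.assoc]

theorem gradedTensor_whiskerRight {K K' : CochainComplex 𝒞 ℕ} (f : K ⟶ K')
    (L : CochainComplex 𝒞 ℕ) (n : ℕ) :
    gradedTensor f.f (fun i => 𝟙 (L.X i)) n = (f ▷ L).f n :=
  (gradedTensor_f f (𝟙 L) n).trans (by rw [MonoidalCategory.whiskerLeft_id, Category.comp_id])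

theorem gradedTensor_whiskerLeft (K : CochainComplex 𝒞 ℕ) {L L' : CochainComplex 𝒞 ℕ}
    (g : L ⟶ L') (n : ℕ) :
    gradedTensor (fun i => 𝟙 (K.X i)) g.f n = (K ◁ g).f n :=
  (gradedTensor_f (𝟙 K) g n).trans (by rw [MonoidalCategory.id_whiskerRight, Category.id_comp])

theorem gradedTensor_associator {K K' L L' M M' : CochainComplex 𝒞 ℕ} (f : ∀ i, K.X i ⟶ K'.X i)
    (g : ∀ i, L.X i ⟶ L'.X i) (h : ∀ i, M.X i ⟶ M'.X i) (n : ℕ) :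
    gradedTensor (gradedTensor f g) h n ≫ (α_ K' L' M').hom.f n =
      (α_ K L M).hom.f n ≫ gradedTensor f (gradedTensor g h) n := by
  apply ιT_ext₃
  intro i j k hn
  have e1 := ιT_associator_hom K L M i j k (i + j) (j + k) n rfl rfl hn
  have e2 := ιT_associator_hom K' L' M' i j k (i + j) (j + k) n rfl rfl hn
  have r1 := congrArg (fun u => u ≫ gradedTensor f (gradedTensor g h) n) e1
  simp only [Category.assoc] at r1
  rw [r1, ιT_gradedTensor, ← Category.assoc (ιT (K ⊗ L) M _ _ _ _), ιT_gradedTensor,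
    Category.assoc, ← tensorHom_id, ← id_tensorHom,
    MonoidalCategory.tensorHom_comp_tensorHom_assoc,
    MonoidalCategory.tensorHom_comp_tensorHom_assoc, ιT_gradedTensor, ιT_gradedTensor,
    Category.id_comp, Category.id_comp]
  have s1 : ((f i ⊗ₘ g j) ≫ ιT K' L' i j (i + j) rfl) ⊗ₘ h k =
      ((f i ⊗ₘ g j) ⊗ₘ h k) ≫ ιT K' L' i j (i + j) rfl ▷ M'.X k := by
    rw [← tensorHom_id, MonoidalCategory.tensorHom_comp_tensorHom, Category.comp_id]
  have s2 : f i ⊗ₘ ((g j ⊗ₘ h k) ≫ ιT L' M' j k (j + k) rfl) =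
      (f i ⊗ₘ (g j ⊗ₘ h k)) ≫ K'.X i ◁ ιT L' M' j k (j + k) rfl := by
    rw [← id_tensorHom, MonoidalCategory.tensorHom_comp_tensorHom, Category.comp_id]
  rw [s1, s2, Category.assoc, e2, Category.assoc,
    MonoidalCategory.associator_naturality_assoc]

/-- The Koszul sign depends only on the degrees, so the braiding commutes with degree-preserving
families even if they are not morphisms of complexes. -/
theorem gradedTensor_braiding {K K' L L' : CochainComplex 𝒞 ℕ} (f : ∀ i, K.X i ⟶ K'.X i)
    (g : ∀ i, L.X i ⟶ L'.X i) (n : ℕ) :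
    gradedTensor f g n ≫ (β_ K' L').hom.f n = (β_ K L).hom.f n ≫ gradedTensor g f n := by
  apply ιT_ext
  intro i j h
  change _ ≫ _ ≫ koszulX K' L' n = _ ≫ koszulX K L n ≫ _
  rw [← Category.assoc, ιT_gradedTensor, Category.assoc, ιT_koszulX, ← Category.assoc, ιT_koszulX,
    Linear.units_smul_comp, Linear.comp_units_smul, Category.assoc, ιT_gradedTensor,
    BraidedCategory.braiding_naturality_assoc]

theorem gradedTensor_braidFront {K K' L L' M M' : CochainComplex 𝒞 ℕ} (f : ∀ i, K.X i ⟶ K'.X i)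
    (g : ∀ i, L.X i ⟶ L'.X i) (h : ∀ i, M.X i ⟶ M'.X i) (n : ℕ) :
    gradedTensor f (gradedTensor g h) n ≫ (braidFront K' L' M').f n =
      (braidFront K L M).f n ≫ gradedTensor g (gradedTensor f h) n := by
  have e1 : gradedTensor f (gradedTensor g h) n ≫ (α_ K' L' M').inv.f n =
      (α_ K L M).inv.f n ≫ gradedTensor (gradedTensor f g) h n := by
    have h2 : (α_ K L M).inv.f n ≫ (α_ K L M).hom.f n = 𝟙 _ := by
      rw [← HomologicalComplex.comp_f, Iso.inv_hom_id, HomologicalComplex.id_f]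
    have h3 : (α_ K' L' M').hom.f n ≫ (α_ K' L' M').inv.f n = 𝟙 _ := by
      rw [← HomologicalComplex.comp_f, Iso.hom_inv_id, HomologicalComplex.id_f]
    calc _ = (α_ K L M).inv.f n ≫ ((α_ K L M).hom.f n ≫ gradedTensor f (gradedTensor g h) n) ≫
          (α_ K' L' M').inv.f n := by rw [← Category.assoc, ← Category.assoc, h2, Category.id_comp]
      _ = _ := by
        rw [← gradedTensor_associator, Category.assoc, h3, Category.comp_id]
  simp only [braidFront, HomologicalComplex.comp_f]
  rw [← Category.assoc, e1, Category.assoc, ← gradedTensor_whiskerRight,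
    ← Category.assoc (gradedTensor (gradedTensor f g) h n), gradedTensor_comp]
  have e2 : (fun i => gradedTensor f g i ≫ (β_ K' L').hom.f i) =
      fun i => (β_ K L).hom.f i ≫ gradedTensor g f i :=
    funext fun i => gradedTensor_braiding f g i
  have e3 : (fun i => h i ≫ 𝟙 (M'.X i)) = fun i => 𝟙 (M.X i) ≫ h i :=
    funext fun i => by rw [Category.comp_id, Category.id_comp]
  rw [e2, e3, ← gradedTensor_comp, Category.assoc, gradedTensor_associator,
    gradedTensor_whiskerRight, Category.assoc, Category.assoc]

/-- The tensor power of a family of morphisms between the terms of complexes. -/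
noncomputable def gradedPow {K K' : CochainComplex 𝒞 ℕ} (f : ∀ i, K.X i ⟶ K'.X i) :
    ∀ m n, (tensorPow K m).X n ⟶ (tensorPow K' m).X n
  | 0 => fun _ => 𝟙 _
  | m + 1 => gradedTensor f (gradedPow f m)

theorem gradedPow_comp {K K' K'' : CochainComplex 𝒞 ℕ} (f : ∀ i, K.X i ⟶ K'.X i)
    (f' : ∀ i, K'.X i ⟶ K''.X i) (m n : ℕ) :
    gradedPow f m n ≫ gradedPow f' m n = gradedPow (fun i => f i ≫ f' i) m n := by
  induction m generalizing n with
  | zero => exact Category.comp_id _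
  | succ m ih =>
    refine (gradedTensor_comp _ _ _ _ n).trans ?_
    change _ = gradedTensor _ _ n
    rw [funext ih]

theorem gradedPow_id (K : CochainComplex 𝒞 ℕ) (m n : ℕ) :
    gradedPow (fun i => 𝟙 (K.X i)) m n = 𝟙 _ := by
  induction m generalizing n with
  | zero => rfl
  | succ m ih =>
    change gradedTensor _ _ n = _
    rw [funext ih]
    exact gradedTensor_id _ _ _

theorem gradedPow_adjBraid {K K' : CochainComplex 𝒞 ℕ} (f : ∀ i, K.X i ⟶ K'.X i) (m k n : ℕ) :
    gradedPow f m n ≫ (adjBraid K' m k : tensorPow K' m ⟶ _).f n =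
      (adjBraid K m k : tensorPow K m ⟶ _).f n ≫ gradedPow f m n := by
  induction m generalizing k n with
  | zero => rfl
  | succ m ih =>
    cases k with
    | zero =>
      cases m with
      | zero => exact (Category.comp_id _).trans (Category.id_comp _).symm
      | succ m => exact gradedTensor_braidFront f f (gradedPow f m) n
    | succ k =>
      change gradedTensor _ _ n ≫ (K' ◁ _).f n = (K ◁ _).f n ≫ gradedTensor _ _ n
      rw [← gradedTensor_whiskerLeft, ← gradedTensor_whiskerLeft, gradedTensor_comp,
        gradedTensor_comp, funext (ih k)]
      simp only [Category.comp_id, Category.id_comp]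

theorem gradedPow_permAction {K K' : CochainComplex 𝒞 ℕ} (f : ∀ i, K.X i ⟶ K'.X i) (m n : ℕ)
    (σ : Equiv.Perm (Fin m)) :
    gradedPow f m n ≫ (permAction K' m σ : tensorPow K' m ⟶ _).f n =
      (permAction K m σ : tensorPow K m ⟶ _).f n ≫ gradedPow f m n := by
  induction σ using perm_induction with
  | h1 =>
    rw [map_one, map_one]
    exact (Category.comp_id _).trans (Category.id_comp _).symm
  | hmul σ τ hσ hτ =>
    rw [map_mul, map_mul, End.mul_def, End.mul_def, HomologicalComplex.comp_f,
      HomologicalComplex.comp_f, ← Category.assoc, hτ, Category.assoc, hσ, Category.assoc]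
  | hadj i hi =>
    rw [permAction_adjSwap _ _ _ hi, permAction_adjSwap _ _ _ hi, gradedPow_adjBraid]

variable [Linear ℚ 𝒞]

theorem gradedPow_cellAction (D : Finset (ℕ × ℕ)) {K K' : CochainComplex 𝒞 ℕ}
    (f : ∀ i, K.X i ⟶ K'.X i) (n : ℕ) (x : MonoidAlgebra ℚ (Equiv.Perm D)) :
    gradedPow f D.card n ≫ (cellAction D K' x : tensorPow K' D.card ⟶ _).f n =
      (cellAction D K x : tensorPow K D.card ⟶ _).f n ≫ gradedPow f D.card n := by
  induction x using MonoidAlgebra.induction_on with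
  | of g => rw [cellAction_of, cellAction_of, gradedPow_permAction]
  | add x y hx hy =>
    rw [map_add, map_add]
    exact (Preadditive.comp_add _ _ _ _ _ _).trans
      ((congrArg₂ (· + ·) hx hy).trans (Preadditive.add_comp _ _ _ _ _ _).symm)
  | smul r x hx =>
    rw [map_smul, map_smul]
    exact (Linear.comp_smul _ _ _ _ _ _).trans
      ((congrArg (r • ·) hx).trans (Linear.smul_comp _ _ _ _ _ _).symm)

/-- The terms of the Schur functor of a complex depend only on the terms of the complex. -/
theorem exists_schur_X_iso (D : Finset (ℕ × ℕ)) {K K' : CochainComplex 𝒞 ℕ}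
    (f : ∀ i, K.X i ≅ K'.X i) {R R' : CochainComplex 𝒞 ℕ}
    (π : tensorPow K D.card ⟶ R) (ι : R ⟶ tensorPow K D.card) [IsSplitEpi π] [IsSplitMono ι]
    (h : π ≫ ι = youngEnd D K)
    (π' : tensorPow K' D.card ⟶ R') (ι' : R' ⟶ tensorPow K' D.card) [IsSplitEpi π']
    [IsSplitMono ι'] (h' : π' ≫ ι' = youngEnd D K') (n : ℕ) : Nonempty (R.X n ≅ R'.X n) := by
  -- This isomorphism of terms ignores the differentials but commutes with the permutations, and
  -- hence identifies the images of the Young symmetrizers in degree `n`.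
  let e : (tensorPow K D.card).X n ≅ (tensorPow K' D.card).X n :=
    { hom := gradedPow (fun i => (f i).hom) _ n
      inv := gradedPow (fun i => (f i).inv) _ n
      hom_inv_id := by
        rw [gradedPow_comp]
        simp only [Iso.hom_inv_id]
        exact gradedPow_id _ _ _
      inv_hom_id := by
        rw [gradedPow_comp]
        simp only [Iso.inv_hom_id]
        exact gradedPow_id _ _ _ }
  have : IsSplitEpi (π.f n) :=
    inferInstanceAs (IsSplitEpi ((HomologicalComplex.eval 𝒞 (ComplexShape.up ℕ) n).map π))
  have : IsSplitMono (ι.f n) :=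
    inferInstanceAs (IsSplitMono ((HomologicalComplex.eval 𝒞 (ComplexShape.up ℕ) n).map ι))
  have : IsSplitEpi (π'.f n) :=
    inferInstanceAs (IsSplitEpi ((HomologicalComplex.eval 𝒞 (ComplexShape.up ℕ) n).map π'))
  have : IsSplitMono (ι'.f n) :=
    inferInstanceAs (IsSplitMono ((HomologicalComplex.eval 𝒞 (ComplexShape.up ℕ) n).map ι'))
  refine nonempty_image_iso e (c := (youngEnd D K).f n) (c' := (youngEnd D K').f n)
    (gradedPow_cellAction D (fun i => (f i).hom) n (youngElt D)) (π.f n) (ι.f n) ?_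
    (π'.f n) (ι'.f n) ?_
  · rw [← h, HomologicalComplex.comp_f]
  · rw [← h', HomologicalComplex.comp_f]

end GradedMaps

/-! ### Degrees in which the Schur functors are supported -/

section Support

variable {𝒞 : Type*} [Category 𝒞] [Preadditive 𝒞] [MonoidalCategory 𝒞] [MonoidalPreadditive 𝒞]

theorem isZero_tensor_left {X : 𝒞} (hX : IsZero X) (Y : 𝒞) : IsZero (X ⊗ Y) := by
  rw [IsZero.iff_id_eq_zero] at hX ⊢
  rw [← MonoidalCategory.id_whiskerRight, hX, MonoidalPreadditive.zero_whiskerRight]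

theorem isZero_tensor_right (X : 𝒞) {Y : 𝒞} (hY : IsZero Y) : IsZero (X ⊗ Y) := by
  rw [IsZero.iff_id_eq_zero] at hY ⊢
  rw [← MonoidalCategory.whiskerLeft_id, hY, MonoidalPreadditive.whiskerLeft_zero]

variable [HasFiniteBiproducts 𝒞] [SymmetricCategory 𝒞]

theorem isZero_tensor_X (s t u : ℕ → Prop) (h : ∀ i j, s i → t j → u (i + j))
    {K L : CochainComplex 𝒞 ℕ} (hK : ∀ i, ¬ s i → IsZero (K.X i))
    (hL : ∀ i, ¬ t i → IsZero (L.X i)) (n : ℕ) (hn : ¬ u n) : IsZero ((K ⊗ L).X n) := by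
  rw [IsZero.iff_id_eq_zero]
  apply ιT_ext
  intro i j hij
  refine IsZero.eq_of_src ?_ _ _
  by_cases hi : s i
  · refine isZero_tensor_right _ (hL j fun hj => hn ?_)
    rw [← hij]
    exact h i j hi hj
  · exact isZero_tensor_left (hK i hi) _

theorem isZero_tensorPow_X (s : ℕ → Prop) (u : ℕ → ℕ → Prop) (h0 : u 0 0)
    (h : ∀ m i j, s i → u m j → u (m + 1) (i + j)) {K : CochainComplex 𝒞 ℕ}
    (hK : ∀ i, ¬ s i → IsZero (K.X i)) (m n : ℕ) (hn : ¬ u m n) :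
    IsZero ((tensorPow K m).X n) := by
  induction m generalizing n with
  | zero =>
    exact HomologicalComplex.isZero_single_obj_X (ComplexShape.up ℕ) 0 (𝟙_ 𝒞) n
      fun hn' => hn (hn' ▸ h0)
  | succ m ih => exact isZero_tensor_X s (u m) (u (m + 1)) (h m) hK ih n hn

variable [Linear ℚ 𝒞] [IsIdempotentComplete (CochainComplex 𝒞 ℕ)]

/-- The Schur functor is a direct summand of the tensor power, so its support is bounded by sums of
degrees from the support of `K`. The predicate `u m` records the sums of `m` such degrees. -/
theorem isZero_schurObj_X (s : ℕ → Prop) (u : ℕ → ℕ → Prop) (h0 : u 0 0)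
    (h : ∀ m i j, s i → u m j → u (m + 1) (i + j)) {K : CochainComplex 𝒞 ℕ}
    (hK : ∀ i, ¬ s i → IsZero (K.X i)) (D : Finset (ℕ × ℕ)) (n : ℕ) (hn : ¬ u D.card n) :
    IsZero ((schurObj D K).X n) := by
  obtain ⟨p, (i : schurObj D K ⟶ tensorPow K D.card), -, hi, -⟩ := (exists_schur D K).choose_spec
  have hi' : IsSplitMono i := hi
  have : IsSplitMono (i.f n) :=
    inferInstanceAs (IsSplitMono ((HomologicalComplex.eval 𝒞 (ComplexShape.up ℕ) n).map i))
  exact IsZero.of_mono (i.f n) (isZero_tensorPow_X s u h0 h hK _ n hn)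

theorem isZero_schurObj_inDegree (d : ℕ) (X : 𝒞) (D : Finset (ℕ × ℕ)) (n : ℕ)
    (hn : n ≠ D.card * d) : IsZero ((schurObj D (inDegree d X)).X n) :=
  isZero_schurObj_X (· = d) (fun m j => j = m * d) (by simp)
    (fun m i j hi hj => by rw [hi, hj]; ring)
    (fun i hi => HomologicalComplex.isZero_single_obj_X _ _ _ _ hi) D n hn

theorem isZero_piece (D D' : Finset (ℕ × ℕ)) (X Y : 𝒞) (n : ℕ) (hn : n ≠ D'.card) :
    IsZero ((schurObj D (inDegree 0 X) ⊗ schurObj D' (inDegree 1 Y)).X n) :=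
  isZero_tensor_X (· = D.card * 0) (· = D'.card * 1) (· = D'.card)
    (fun i j hi hj => by rw [hi, hj]; ring) (isZero_schurObj_inDegree 0 X D)
    (isZero_schurObj_inDegree 1 Y D') n hn

end Support

/-! ### Lower sets in a Young diagram and subdiagrams -/

section Words

/-- The word of a Young diagram `μ`. -/
def diagramWord (lam μ : YoungDiagram) (x : lam.cells) : Bool := decide (x.1 ∈ μ.cells)

theorem isLow_diagramWord (lam μ : YoungDiagram) : IsLow (diagramWord lam μ) where
  row x y h1 h2 hy := by
    rw [diagramWord, decide_eq_true_eq] at hy ⊢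
    exact μ.isLowerSet (a := y.1) (b := x.1) ⟨h1.le, h2⟩ hy
  col x y h1 h2 hy := by
    rw [diagramWord, decide_eq_true_eq] at hy ⊢
    exact μ.isLowerSet (a := y.1) (b := x.1) ⟨h2, h1.le⟩ hy

theorem wordCells_diagramWord {lam μ : YoungDiagram} (h : μ ≤ lam) :
    wordCells (diagramWord lam μ) = μ.cells := by
  ext x
  constructor
  · intro hx
    have := (mem_wordCells _ ⟨x, wordCells_subset _ hx⟩).1 hx
    exact of_decide_eq_true this
  · intro hx
    exact (mem_wordCells _ ⟨x, YoungDiagram.cells_subset_iff.2 h hx⟩).2 (decide_eq_true hx)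

/-- From a cell of `w`, any cell above and to the left of it is reached by a column step followed by
a row step; the intermediate corner belongs to `lam`. -/
theorem exists_diagram_of_isLow {lam : YoungDiagram} {w : lam.cells → Bool} (hw : IsLow w) :
    ∃ μ : YoungDiagram, μ ≤ lam ∧ μ.cells = wordCells w ∧ diagramWord lam μ = w := by
  have hlow : IsLowerSet (wordCells w : Set (ℕ × ℕ)) := by
    intro y x hxy hy
    have hyl := wordCells_subset w hy
    have hxl : x ∈ lam.cells := lam.isLowerSet hxy hyl
    have hml : (x.1, y.2) ∈ lam.cells :=
      lam.isLowerSet (a := y) (b := (x.1, y.2)) ⟨hxy.1, le_rfl⟩ hyl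
    have hy' := (mem_wordCells w ⟨y, hyl⟩).1 hy
    have hm' := hw.col ⟨(x.1, y.2), hml⟩ ⟨y, hyl⟩ rfl hxy.1 hy'
    exact (mem_wordCells w ⟨x, hxl⟩).2 (hw.row ⟨x, hxl⟩ ⟨_, hml⟩ rfl hxy.2 hm')
  refine ⟨⟨wordCells w, hlow⟩, YoungDiagram.cells_subset_iff.1 (wordCells_subset w), rfl, ?_⟩
  funext x
  have := mem_wordCells w x
  rw [diagramWord, Bool.eq_iff_iff, decide_eq_true_eq]
  exact this

end Words

attribute [local instance] hasBinaryBiproducts_of_finite_biproducts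

/-! ### Comparison of terms in a single degree -/

section Comparison

variable {𝒞 : Type*} [Category 𝒞] [Preadditive 𝒞] [HasFiniteBiproducts 𝒞]

/-- The composite through the biproduct is the partial sum of the decomposition of the identity over
the range of `e`; in degree `n` the omitted terms factor through zero objects. -/
theorem nonempty_biproduct_X_iso {W : Type*} {J : Type} [Fintype W] [Finite J]
    (M : W → CochainComplex 𝒞 ℕ) (G : J → CochainComplex 𝒞 ℕ) (e : J → W)
    (he : Function.Injective e) (θ : ∀ j, G j ≅ M (e j)) (R : CochainComplex 𝒞 ℕ)
    (a : ∀ w, M w ⟶ R) (b : ∀ w, R ⟶ M w) (h₁ : ∀ w, a w ≫ b w = 𝟙 _)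
    (h₂ : ∀ w w', w ≠ w' → a w ≫ b w' = 0) (h₃ : ∑ w, b w ≫ a w = 𝟙 R) (n : ℕ)
    (hn : ∀ w, w ∉ Set.range e → IsZero ((M w).X n)) :
    Nonempty (R.X n ≅ (⨁ G).X n) := by
  classical
  have := Fintype.ofFinite J
  let α : ⨁ G ⟶ R := biproduct.desc fun j => (θ j).hom ≫ a (e j)
  let β : R ⟶ ⨁ G := biproduct.lift fun j => b (e j) ≫ (θ j).inv
  have hαβ : α ≫ β = 𝟙 _ := by
    refine biproduct.hom_ext' _ _ fun j => biproduct.hom_ext _ _ fun j' => ?_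
    simp only [α, β, Category.assoc, biproduct.lift_π, biproduct.ι_desc_assoc, Category.comp_id]
    by_cases h : j = j'
    · subst h
      rw [reassoc_of% (h₁ (e j)), Iso.hom_inv_id, biproduct.ι_π_self]
    · rw [reassoc_of% (h₂ _ _ (he.ne h)), zero_comp, comp_zero, biproduct.ι_π_ne _ h]
  have hβα : (β ≫ α).f n = 𝟙 _ := by
    have h4 : β ≫ α = ∑ j, b (e j) ≫ a (e j) := by
      refine biproduct.lift_desc.trans (Finset.sum_congr rfl fun j _ => ?_)
      rw [Category.assoc, Iso.inv_hom_id_assoc]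
    rw [h4, ← HomologicalComplex.id_f, ← h₃]
    change (HomologicalComplex.eval 𝒞 (ComplexShape.up ℕ) n).map _ =
      (HomologicalComplex.eval 𝒞 (ComplexShape.up ℕ) n).map _
    rw [Functor.map_sum, Functor.map_sum]
    refine Finset.sum_of_injOn e he.injOn (fun _ _ => by simp) (fun w _ hw => ?_) fun _ _ => rfl
    rw [Functor.map_comp]
    have h5 : (HomologicalComplex.eval 𝒞 (ComplexShape.up ℕ) n).map (b w) = 0 :=
      (hn w (by simpa using hw)).eq_of_tgt _ _
    rw [h5, zero_comp]
  refine ⟨β.f n, α.f n, ?_, ?_⟩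
  · rw [← HomologicalComplex.comp_f, hβα]
  · rw [← HomologicalComplex.comp_f, hαβ, HomologicalComplex.id_f]

/-- The comparison is made in each degree separately and need not respect the differential, which is
zero on the right-hand side. -/
theorem nonempty_two_term_iso {B C : 𝒞} {K : CochainComplex 𝒞 ℕ} (e0 : K.X 0 ≅ B)
    (e1 : K.X 1 ≅ C) (hK : ∀ n, IsZero (K.X (n + 2))) (n : ℕ) :
    Nonempty (K.X n ≅ (inDegree 0 B ⊞ inDegree 1 C).X n) := by
  have h : Nonempty (K.X n ≅ (inDegree 0 B).X n ⊞ (inDegree 1 C).X n) := by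
    have hz : ∀ d X n, n ≠ d → IsZero ((inDegree d X : CochainComplex 𝒞 ℕ).X n) :=
      fun d X n h => HomologicalComplex.isZero_single_obj_X _ _ _ _ h
    match n with
    | 0 => exact ⟨e0 ≪≫ (HomologicalComplex.singleObjXSelf _ 0 B).symm ≪≫
        isoBiprodZero (hz 1 C 0 (by omega))⟩
    | 1 => exact ⟨e1 ≪≫ (HomologicalComplex.singleObjXSelf _ 1 C).symm ≪≫
        isoZeroBiprod (hz 0 B 1 (by omega))⟩
    | n + 2 =>
      exact ⟨(hK n).iso ((biprod_isZero_iff _ _).2 ⟨hz 0 B _ (by omega), hz 1 C _ (by omega)⟩)⟩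
  exact h.map fun e => e ≪≫ (HomologicalComplex.biprodXIso _ _ n).symm

end Comparison

/-! ### Terms of the Schur functor of a two-term complex -/

section Main

variable {𝒞 : Type*} [Category 𝒞] [Preadditive 𝒞] [Linear ℚ 𝒞] [HasFiniteBiproducts 𝒞]
  [IsIdempotentComplete 𝒞] [MonoidalCategory 𝒞] [MonoidalPreadditive 𝒞] [SymmetricCategory 𝒞]

/-- Forget the differential of `K`, apply the branching rule to `B ⊕ C[1]`, and keep the summands
that are nonzero in degree `k`. These belong to subdiagrams with `k` cells, since the factor from
`C[1]` sits in degree `|μ|`. -/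
theorem nonempty_schurObj_X_iso (lam : YoungDiagram) {B C : 𝒞} {K : CochainComplex 𝒞 ℕ}
    (e0 : K.X 0 ≅ B) (e1 : K.X 1 ≅ C) (hK : ∀ n, IsZero (K.X (n + 2))) (k : ℕ) :
    Nonempty ((schurObj lam.cells K).X k ≅ (gradedPiece lam k B C).X k) := by
  classical
  obtain ⟨p, i, hp, hi, hpi⟩ := (exists_schur lam.cells K).choose_spec
  obtain ⟨p', i', hp', hi', hpi'⟩ :=
    (exists_schur lam.cells (inDegree 0 B ⊞ inDegree 1 C)).choose_spec
  obtain ⟨θ⟩ := exists_schur_X_iso lam.cells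
    (fun n => (nonempty_two_term_iso e0 e1 hK n).some) p i hpi p' i' hpi' k
  choose p₁ i₁ hp₁ hi₁ hM₁ using fun w : {w : lam.cells → Bool // IsLow w} =>
    (exists_schur (lam.cells \ wordCells w.1) (inDegree 0 B)).choose_spec
  choose p₂ i₂ hp₂ hi₂ hM₂ using fun w : {w : lam.cells → Bool // IsLow w} =>
    (exists_schur (wordCells w.1) (inDegree 1 C)).choose_spec
  obtain ⟨a, b, h1, h2, h3⟩ := exists_schur_sum_decomposition (D := lam.cells) lam.isLowerSet
    biprod.inl biprod.fst biprod.inr biprod.snd biprod.inl_fst biprod.inr_snd biprod.inl_snd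
    biprod.inr_fst biprod.total p' i' hpi'
    (fun w => schurObj (lam.cells \ wordCells w.1) (inDegree 0 B))
    (fun w => schurObj (wordCells w.1) (inDegree 1 C))
    p₁ i₁ p₂ i₂ hp₁ hi₁ hp₂ hi₂ hM₁ hM₂
  have : Fintype {w : lam.cells → Bool // IsLow w} := Fintype.ofFinite _
  obtain ⟨η⟩ := nonempty_biproduct_X_iso _
    (fun μ : {μ : YoungDiagram // μ ≤ lam ∧ μ.card = k} =>
      schurObj (lam.cells \ μ.1.cells) (inDegree 0 B) ⊗ schurObj μ.1.cells (inDegree 1 C))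
    (fun μ => (⟨diagramWord lam μ.1, isLow_diagramWord lam μ.1⟩ :
      {w : lam.cells → Bool // IsLow w}))
    (fun μ μ' h => Subtype.ext (YoungDiagram.ext (by
      rw [← wordCells_diagramWord μ.2.1, ← wordCells_diagramWord μ'.2.1]
      exact congrArg (fun w => wordCells w.1) h)))
    (fun μ => eqToIso (by rw [wordCells_diagramWord μ.2.1])) _ a b h1 h2 h3 k (by
      intro w hw
      refine isZero_piece _ _ _ _ _ fun hk => hw ?_
      obtain ⟨μ, hμ1, hμ2, hμ3⟩ := exists_diagram_of_isLow w.2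
      exact ⟨⟨μ, hμ1, by rw [hk, ← hμ2]⟩, Subtype.ext hμ3⟩)
  exact ⟨θ ≪≫ η⟩

theorem isZero_gradedPiece_X (lam : YoungDiagram) (B C : 𝒞) {k n : ℕ} (h : n ≠ k) :
    IsZero ((gradedPiece lam k B C).X n) := by
  classical
  have := Fintype.ofFinite {μ : YoungDiagram // μ ≤ lam ∧ μ.card = k}
  rw [IsZero.iff_id_eq_zero, gradedPiece, ← HomologicalComplex.id_f, ← biproduct.total]
  change (HomologicalComplex.eval 𝒞 (ComplexShape.up ℕ) n).map _ = _
  rw [Functor.map_sum]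
  refine Finset.sum_eq_zero fun μ _ => ?_
  rw [Functor.map_comp]
  have h5 : (HomologicalComplex.eval 𝒞 (ComplexShape.up ℕ) n).map (biproduct.π
      (fun μ : {μ : YoungDiagram // μ ≤ lam ∧ μ.card = k} =>
        schurObj (lam.cells \ μ.1.cells) (inDegree 0 B) ⊗ schurObj μ.1.cells (inDegree 1 C))
      μ) = 0 :=
    (isZero_piece _ _ _ _ n (fun hn => h (hn.trans μ.2.2))).eq_of_tgt _ _
  rw [h5, zero_comp]

end Main

/-! ### Consequences of the axioms of an exact structure -/

section ExactStructure

variable {𝒞 : Type*} [Category 𝒞] [Preadditive 𝒞] {E : ShortComplex 𝒞 → Prop}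

namespace IsExactStructure

theorem mono (hE : IsExactStructure E) {X Y Z : 𝒞} {f : X ⟶ Y} {g : Y ⟶ Z} {w : f ≫ g = 0}
    (h : E (ShortComplex.mk f g w)) : Mono f :=
  mono_of_isLimit_fork (hE.isKernel _ h).some

theorem epi (hE : IsExactStructure E) {X Y Z : 𝒞} {f : X ⟶ Y} {g : Y ⟶ Z} {w : f ≫ g = 0}
    (h : E (ShortComplex.mk f g w)) : Epi g :=
  epi_of_isColimit_cofork (hE.isCokernel _ h).some

theorem lift (hE : IsExactStructure E) {X Y Z : 𝒞} {f : X ⟶ Y} {g : Y ⟶ Z} {w : f ≫ g = 0}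
    (h : E (ShortComplex.mk f g w)) {T : 𝒞} (t : T ⟶ Y) (ht : t ≫ g = 0) :
    ∃ l : T ⟶ X, l ≫ f = t := by
  obtain ⟨l, hl⟩ := KernelFork.IsLimit.lift' (hE.isKernel _ h).some t ht
  exact ⟨l, hl⟩

theorem desc (hE : IsExactStructure E) {X Y Z : 𝒞} {f : X ⟶ Y} {g : Y ⟶ Z} {w : f ≫ g = 0}
    (h : E (ShortComplex.mk f g w)) {T : 𝒞} (t : Y ⟶ T) (ht : f ≫ t = 0) :
    ∃ l : Z ⟶ T, g ≫ l = t := by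
  obtain ⟨l, hl⟩ := CokernelCofork.IsColimit.desc' (hE.isCokernel _ h).some t ht
  exact ⟨l, hl⟩

theorem congr_iso (hE : IsExactStructure E) {X Y Z X' Y' Z' : 𝒞} {f : X ⟶ Y} {g : Y ⟶ Z}
    {w : f ≫ g = 0} (h : E (ShortComplex.mk f g w)) {f' : X' ⟶ Y'} {g' : Y' ⟶ Z'}
    (w' : f' ≫ g' = 0) (a : X ≅ X') (b : Y ≅ Y') (c : Z ≅ Z') (hab : a.hom ≫ f' = f ≫ b.hom)
    (hbc : b.hom ≫ g' = g ≫ c.hom) : E (ShortComplex.mk f' g' w') :=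
  hE.of_iso (ShortComplex.mk f g w) (ShortComplex.mk f' g' w')
    (ShortComplex.isoMk a b c hab hbc) h

/-- Two kernels of the same deflation are isomorphic, and exact sequences are closed under
isomorphism. -/
theorem of_isKernel (hE : IsExactStructure E) {X Y Z : 𝒞} {f : X ⟶ Y} {g : Y ⟶ Z} (w : f ≫ g = 0)
    (hg : IsDeflation E g)
    [Mono f] (h : ∀ {T : 𝒞} (t : T ⟶ Y), t ≫ g = 0 → ∃ l : T ⟶ X, l ≫ f = t) :
    E (ShortComplex.mk f g w) := by
  obtain ⟨X', f', w', h'⟩ := hg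
  have := hE.mono h'
  obtain ⟨a, ha⟩ := h f' w'
  obtain ⟨b, hb⟩ := hE.lift h' f w
  refine hE.congr_iso h' w ⟨a, b, ?_, ?_⟩ (Iso.refl _) (Iso.refl _) ?_ ?_
  · rw [← cancel_mono f', Category.assoc, hb, ha, Category.id_comp]
  · rw [← cancel_mono f, Category.assoc, ha, hb, Category.id_comp]
  · simpa using ha
  · simp

theorem of_isCokernel (hE : IsExactStructure E) {X Y Z : 𝒞} {f : X ⟶ Y} {g : Y ⟶ Z} (w : f ≫ g = 0)
    (hf : IsInflation E f) [Epi g]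
    (h : ∀ {T : 𝒞} (t : Y ⟶ T), f ≫ t = 0 → ∃ l : Z ⟶ T, g ≫ l = t) :
    E (ShortComplex.mk f g w) := by
  obtain ⟨Z', g', w', h'⟩ := hf
  have := hE.epi h'
  obtain ⟨a, ha⟩ := h g' w'
  obtain ⟨b, hb⟩ := hE.desc h' g w
  refine hE.congr_iso h' w (Iso.refl _) (Iso.refl _) ⟨b, a, ?_, ?_⟩ ?_ ?_
  · rw [← cancel_epi g', reassoc_of% hb, ha, Category.comp_id]
  · rw [← cancel_epi g, reassoc_of% ha, hb, Category.comp_id]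
  · simp
  · simpa using hb.symm

theorem deflation_of_iso (hE : IsExactStructure E) {Y Z Y' Z' : 𝒞} {g : Y ⟶ Z} {g' : Y' ⟶ Z'}
    (hg : IsDeflation E g)
    (a : Y ≅ Y') (b : Z ≅ Z') (h : a.hom ≫ g' = g ≫ b.hom) : IsDeflation E g' := by
  obtain ⟨X, f, w, hX⟩ := hg
  refine ⟨X, f ≫ a.hom, by rw [Category.assoc, h, reassoc_of% w, zero_comp], ?_⟩
  exact hE.congr_iso hX _ (Iso.refl _) a b (by simp) h

theorem inflation_of_iso (hE : IsExactStructure E) {X Y X' Y' : 𝒞} {f : X ⟶ Y} {f' : X' ⟶ Y'}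
    (hf : IsInflation E f)
    (a : X ≅ X') (b : Y ≅ Y') (h : a.hom ≫ f' = f ≫ b.hom) : IsInflation E f' := by
  obtain ⟨Z, g, w, hZ⟩ := hf
  refine ⟨Z, b.inv ≫ g, ?_, ?_⟩
  · rw [← cancel_epi a.hom, reassoc_of% h, Iso.hom_inv_id_assoc, w, comp_zero]
  · exact hE.congr_iso hZ _ a b (Iso.refl _) h (by simp)

theorem deflation_of_isPullback (hE : IsExactStructure E) {Y Z Y' Z' : 𝒞} {p : Y ⟶ Z} {f : Z' ⟶ Z}
    {f' : Y' ⟶ Y}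
    {p' : Y' ⟶ Z'} (sq : IsPullback f' p' p f) (hp : IsDeflation E p) : IsDeflation E p' := by
  obtain ⟨Y₁, f₁, p₁, sq₁, h₁⟩ := hE.pullback p f hp
  exact hE.deflation_of_iso h₁ (sq₁.isoIsPullback _ _ sq) (Iso.refl _) (by simp)

theorem inflation_of_isPushout (hE : IsExactStructure E) {X Y X' Y' : 𝒞} {i : X ⟶ Y} {f : X ⟶ X'}
    {f' : Y ⟶ Y'}
    {i' : X' ⟶ Y'} (sq : IsPushout i f f' i') (hi : IsInflation E i) : IsInflation E i' := by
  obtain ⟨Y₁, f₁, i₁, sq₁, h₁⟩ := hE.pushout i f hi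
  exact hE.inflation_of_iso h₁ (Iso.refl _) (sq₁.isoIsPushout _ _ sq) (by simp)

theorem isoConflation (hE : IsExactStructure E) {X Y Z : 𝒞} (f : X ⟶ Y) (hf : IsIso f)
    (hZ : IsZero Z) (g : Y ⟶ Z)
    (w : f ≫ g = 0) : E (ShortComplex.mk f g w) := by
  have : Epi g := ⟨fun a b _ => hZ.eq_of_src a b⟩
  refine hE.of_isCokernel w ?_ fun t ht => ⟨0, ?_⟩
  · exact hE.inflation_of_iso (hE.id_inflation X) (Iso.refl _) (asIso f) (by simp)
  · rw [← cancel_epi f, ht, comp_zero, comp_zero]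

theorem zeroConflation (hE : IsExactStructure E) {X Y Z : 𝒞} (f : X ⟶ Y) (hX : IsZero X)
    (g : Y ⟶ Z) (hg : IsIso g)
    (w : f ≫ g = 0) : E (ShortComplex.mk f g w) := by
  have : Mono f := ⟨fun a b _ => hX.eq_of_tgt a b⟩
  refine hE.of_isKernel w ?_ fun t ht => ⟨0, ?_⟩
  · exact hE.deflation_of_iso (hE.id_deflation Y) (Iso.refl _) (asIso g) (by simp)
  · rw [← cancel_mono g, ht, zero_comp, zero_comp]

/-- A morphism with a kernel is a deflation if its composition with a split epimorphism is. -/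
theorem of_splitEpi_comp (hE : IsExactStructure E) {X Y Z W : 𝒞} {f : X ⟶ Y} {g : Y ⟶ Z}
    (w : f ≫ g = 0) [Mono f]
    (h : ∀ {T : 𝒞} (t : T ⟶ Y), t ≫ g = 0 → ∃ l : T ⟶ X, l ≫ f = t) (s : Y ⟶ W) (r : W ⟶ Y)
    (hsr : s ≫ r = 𝟙 Y) (hr : IsDeflation E (r ≫ g)) : E (ShortComplex.mk f g w) := by
  obtain ⟨N, k, hk, hN⟩ := hr
  obtain ⟨φ, hφ⟩ := h (k ≫ r) (by rw [Category.assoc, hk])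
  have hrepi : Epi r := ⟨fun a b hab => by
    rw [← Category.id_comp a, ← hsr, Category.assoc, hab, ← Category.assoc, hsr,
      Category.id_comp]⟩
  have hrgepi := hE.epi hN
  have hgepi : Epi g := epi_of_epi r g
  obtain ⟨l, hl⟩ := hE.lift hN (𝟙 W - r ≫ s) (by
    rw [Preadditive.sub_comp, Category.id_comp, Category.assoc, reassoc_of% hsr, sub_self])
  have hlφ : l ≫ φ = 0 := by
    rw [← cancel_mono f, Category.assoc, hφ, reassoc_of% hl, Preadditive.sub_comp,
      Category.id_comp, Category.assoc, hsr, Category.comp_id, sub_self, zero_comp]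
  obtain ⟨m, hm⟩ := hE.lift hN (f ≫ s) (by rw [Category.assoc, reassoc_of% hsr, w])
  have hmφ : m ≫ φ = 𝟙 X := by
    rw [← cancel_mono f, Category.assoc, hφ, reassoc_of% hm, hsr, Category.comp_id,
      Category.id_comp]
  -- A variant of Quillen's obscure axiom. The sections `l` and `m` make this square a pushout, so
  -- `f` is an inflation because `k` is one; it remains to see that `g` is its cokernel.
  have sq : IsPushout k φ r f := by
    refine ⟨⟨hφ.symm⟩, ⟨PushoutCocone.IsColimit.mk _ (fun c => s ≫ c.inl) ?_ ?_ ?_⟩⟩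
    · intro c
      have h1 : (𝟙 W - r ≫ s) ≫ c.inl = 0 := by
        rw [← hl, Category.assoc, c.condition, reassoc_of% hlφ, zero_comp]
      rw [Preadditive.sub_comp, Category.id_comp, sub_eq_zero, Category.assoc] at h1
      exact h1.symm
    · intro c
      rw [← reassoc_of% hm, c.condition, reassoc_of% hmφ]
    · intro c t h1 h2
      rw [← cancel_epi r, h1]
      have h3 : (𝟙 W - r ≫ s) ≫ c.inl = 0 := by
        rw [← hl, Category.assoc, c.condition, reassoc_of% hlφ, zero_comp]
      rw [Preadditive.sub_comp, Category.id_comp, sub_eq_zero, Category.assoc] at h3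
      exact h3
  refine hE.of_isCokernel w (hE.inflation_of_isPushout sq ⟨_, _, _, hN⟩) fun t ht => ?_
  obtain ⟨c, hc⟩ := hE.desc hN (r ≫ t) (by rw [← reassoc_of% hφ, ht, comp_zero])
  refine ⟨c, ?_⟩
  rw [← cancel_epi r, ← hc, Category.assoc]

theorem deflation_zero (hE : IsExactStructure E) (X Z : 𝒞) (hZ : IsZero Z) : IsDeflation E
    (0 : X ⟶ Z) :=
  ⟨X, 𝟙 X, comp_zero, hE.isoConflation _ inferInstance hZ _ _⟩

variable [HasFiniteBiproducts 𝒞]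

/-- The projection of a direct sum to a summand is a pullback of the deflation from the other
summand to zero. -/
theorem deflation_of_decomposition (hE : IsExactStructure E) {X Y Z : 𝒞} (s : Z ⟶ Y) (r : Y ⟶ Z)
    (hsr : s ≫ r = 𝟙 Z)
    (s' : X ⟶ Y) (r' : Y ⟶ X) (hsr' : s' ≫ r' = 𝟙 X) (h : r ≫ s + r' ≫ s' = 𝟙 Y)
    (h0 : s ≫ r' = 0) (h0' : s' ≫ r = 0) : IsDeflation E r := by
  obtain ⟨O, hO⟩ := (inferInstance : HasZeroObject 𝒞)
  have sq : IsPullback r' r (0 : X ⟶ O) (0 : Z ⟶ O) := by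
    refine ⟨⟨hO.eq_of_tgt _ _⟩, ⟨PullbackCone.IsLimit.mk _ (fun c => c.fst ≫ s' + c.snd ≫ s)
      ?_ ?_ ?_⟩⟩
    · intro c
      rw [Preadditive.add_comp, Category.assoc, Category.assoc, hsr', h0, comp_zero, add_zero,
        Category.comp_id]
    · intro c
      rw [Preadditive.add_comp, Category.assoc, Category.assoc, hsr, h0', comp_zero, zero_add,
        Category.comp_id]
    · intro c m h1 h2
      rw [← Category.comp_id m, ← h, Preadditive.comp_add, reassoc_of% h1, reassoc_of% h2,
        add_comm]
  exact hE.deflation_of_isPullback sq (hE.deflation_zero X O hO)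

theorem deflation_of_splitEpi (hE : IsExactStructure E) [IsIdempotentComplete 𝒞] {Y Z : 𝒞}
    (s : Z ⟶ Y) (r : Y ⟶ Z)
    (hsr : s ≫ r = 𝟙 Z) : IsDeflation E r := by
  obtain ⟨X, i, e, h1, h2⟩ := IsIdempotentComplete.idempotents_split Y (𝟙 Y - r ≫ s) (by
    simp [Preadditive.sub_comp, Preadditive.comp_sub, reassoc_of% hsr])
  have hs : s ≫ e = 0 := by
    have : (s ≫ e) ≫ i = 0 := by
      rw [Category.assoc, h2, Preadditive.comp_sub, reassoc_of% hsr, Category.comp_id, sub_self]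
    rw [← Category.comp_id (s ≫ e), ← h1, ← Category.assoc, this, zero_comp]
  have hi : i ≫ r = 0 := by
    have : e ≫ i ≫ r = 0 := by
      rw [reassoc_of% h2, Preadditive.sub_comp, Category.assoc, hsr, Category.id_comp,
        Category.comp_id, sub_self]
    rw [← Category.id_comp (i ≫ r), ← h1, Category.assoc, this, comp_zero]
  exact hE.deflation_of_decomposition s r hsr i e h1 (by rw [h2]; abel) hs hi

/-- Retracts of exact sequences are exact. -/
theorem of_retract (hE : IsExactStructure E) [IsIdempotentComplete 𝒞] {X Y Z X' Y' Z' : 𝒞}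
    {f : X ⟶ Y} {g : Y ⟶ Z}
    {w : f ≫ g = 0} (h : E (ShortComplex.mk f g w)) {f' : X' ⟶ Y'} {g' : Y' ⟶ Z'}
    (w' : f' ≫ g' = 0) (sX : X' ⟶ X) (rX : X ⟶ X') (hX : sX ≫ rX = 𝟙 X') (sY : Y' ⟶ Y)
    (rY : Y ⟶ Y') (hY : sY ≫ rY = 𝟙 Y') (sZ : Z' ⟶ Z) (rZ : Z ⟶ Z') (hZ : sZ ≫ rZ = 𝟙 Z')
    (hs : sX ≫ f = f' ≫ sY) (hr : rX ≫ f' = f ≫ rY) (hs' : sY ≫ g = g' ≫ sZ)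
    (hr' : rY ≫ g' = g ≫ rZ) : E (ShortComplex.mk f' g' w') := by
  have := hE.mono h
  have : Mono f' := ⟨fun a b hab => by
    have h1 : (a ≫ sX) ≫ f = (b ≫ sX) ≫ f := by
      rw [Category.assoc, Category.assoc, hs, reassoc_of% hab]
    rw [cancel_mono] at h1
    rw [← Category.comp_id a, ← Category.comp_id b, ← hX, reassoc_of% h1]⟩
  -- The composite of the retraction `rY` with `g'` equals `g` followed by a split epimorphism. Both
  -- are deflations, the latter because idempotents split.
  refine hE.of_splitEpi_comp w' (fun t ht => ?_) sY rY hY ?_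
  · obtain ⟨l, hl⟩ := hE.lift h (t ≫ sY) (by rw [Category.assoc, hs', reassoc_of% ht, zero_comp])
    refine ⟨l ≫ rX, ?_⟩
    rw [Category.assoc, hr, reassoc_of% hl, hY, Category.comp_id]
  · rw [hr']
    exact hE.comp_deflation _ _ ⟨_, _, _, h⟩ (hE.deflation_of_splitEpi sZ rZ hZ)

end IsExactStructure

end ExactStructure

attribute [local instance] hasBinaryBiproducts_of_finite_biproducts

/-! ### Detecting deflations -/

section Cover

variable {𝒞 : Type*} [Category 𝒞] [Preadditive 𝒞] {E : ShortComplex 𝒞 → Prop}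
  [HasFiniteBiproducts 𝒞]

namespace IsExactStructure

theorem deflation_map_id_left (hE : IsExactStructure E) (X : 𝒞) {Y Z : 𝒞} {f : Y ⟶ Z}
    (hf : IsDeflation E f) : IsDeflation E (biprod.map (𝟙 X) f) := by
  have sq : IsPullback (biprod.snd : X ⊞ Y ⟶ Y) (biprod.map (𝟙 X) f) f biprod.snd := by
    refine ⟨⟨(biprod.map_snd _ _).symm⟩, ⟨PullbackCone.IsLimit.mk _
      (fun c => biprod.lift (c.snd ≫ biprod.fst) c.fst) ?_ ?_ ?_⟩⟩
    · intro c
      exact biprod.lift_snd _ _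
    · intro c
      refine biprod.hom_ext _ _ ?_ ?_
      · rw [Category.assoc, biprod.map_fst, biprod.lift_fst_assoc, Category.comp_id]
      · rw [Category.assoc, biprod.map_snd, biprod.lift_snd_assoc, c.condition]
    · intro c m h1 h2
      refine biprod.hom_ext _ _ ?_ ?_
      · rw [biprod.lift_fst, ← h2, Category.assoc, biprod.map_fst, Category.comp_id]
      · rw [biprod.lift_snd, h1]
  exact hE.deflation_of_isPullback sq hf

/-- A morphism with a kernel is a deflation if it can be checked on a sub and a quotient. -/
theorem of_cover (hE : IsExactStructure E) {N P Q X M Y : 𝒞} {κ : N ⟶ P} {q : P ⟶ Q}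
    {w : κ ≫ q = 0} (hκ : E (ShortComplex.mk κ q w)) (θ : X ⟶ P) (hθ : IsDeflation E (θ ≫ q))
    (v : M ⟶ N) (hv : IsDeflation E v) (u : M ⟶ X) (hu : u ≫ θ = v ≫ κ) (f : Y ⟶ X) [Mono f]
    (wf : f ≫ θ = 0) (h : ∀ {T : 𝒞} (t : T ⟶ X), t ≫ θ = 0 → ∃ l : T ⟶ Y, l ≫ f = t) :
    E (ShortComplex.mk f θ wf) := by
  have hmono := hE.mono hκ
  -- The kernel of `q` is `N`, so the pullback of `θ ≫ q` along `q` is `X ⊞ N`. Hence `X ⊞ N` covers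
  -- `P`, and then so does `X ⊞ M`; since `M` already reaches `P` through `X`, this cover factors as
  -- a split epimorphism followed by `θ`.
  have sq : IsPullback biprod.fst (biprod.desc θ κ) (θ ≫ q) q := by
    have hw : (biprod.fst : X ⊞ N ⟶ X) ≫ θ ≫ q = biprod.desc θ κ ≫ q := by
      refine biprod.hom_ext' _ _ ?_ ?_
      · rw [biprod.inl_fst_assoc, biprod.inl_desc_assoc]
      · rw [biprod.inr_fst_assoc, zero_comp, biprod.inr_desc_assoc, w]
    have key : ∀ c : PullbackCone (θ ≫ q) q, ∃ l : c.pt ⟶ N, l ≫ κ = c.snd - c.fst ≫ θ :=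
      fun c => hE.lift hκ _ (by
        rw [Preadditive.sub_comp, ← c.condition, Category.assoc, sub_self])
    refine ⟨⟨hw⟩, ⟨PullbackCone.IsLimit.mk _ (fun c => biprod.lift c.fst (key c).choose)
      ?_ ?_ ?_⟩⟩
    · intro c
      exact biprod.lift_fst _ _
    · intro c
      rw [biprod.lift_desc, (key c).choose_spec]
      abel
    · intro c m h1 h2
      refine biprod.hom_ext _ _ ?_ ?_
      · rw [h1, biprod.lift_fst]
      · rw [biprod.lift_snd, ← cancel_mono κ, (key c).choose_spec, ← h1, ← h2, biprod.desc_eq]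
        simp
  have h1 : IsDeflation E (biprod.map (𝟙 X) v ≫ biprod.desc θ κ) :=
    hE.comp_deflation _ _ (hE.deflation_map_id_left X hv) (hE.deflation_of_isPullback sq hθ)
  have h2 : biprod.map (𝟙 X) v ≫ biprod.desc θ κ = biprod.desc (𝟙 X) u ≫ θ := by
    refine biprod.hom_ext' _ _ ?_ ?_
    · simp
    · simp [hu]
  rw [h2] at h1
  exact hE.of_splitEpi_comp wf h biprod.inl (biprod.desc (𝟙 X) u) (biprod.inl_desc _ _) h1

/-- Write `T` as `Y ⊞ X` by splitting the complementary idempotent. Then `Θ` is the deflation `s ≫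
Θ` on the summand `X`, followed by a split epimorphism onto `P`. -/
theorem deflation_of_splitMono_comp [IsIdempotentComplete 𝒞] (hE : IsExactStructure E)
    {X T P : 𝒞} (s : X ⟶ T) (r : T ⟶ X) (hsr : s ≫ r = 𝟙 X) (Θ : T ⟶ P)
    (h : IsDeflation E (s ≫ Θ)) : IsDeflation E Θ := by
  obtain ⟨Y, i, e, h1, h2⟩ := IsIdempotentComplete.idempotents_split T (𝟙 T - r ≫ s) (by
    simp [Preadditive.sub_comp, Preadditive.comp_sub, reassoc_of% hsr])
  have hs : s ≫ e = 0 := by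
    have : (s ≫ e) ≫ i = 0 := by
      rw [Category.assoc, h2, Preadditive.comp_sub, reassoc_of% hsr, Category.comp_id, sub_self]
    rw [← Category.comp_id (s ≫ e), ← h1, ← Category.assoc, this, zero_comp]
  have hi : i ≫ r = 0 := by
    have : e ≫ i ≫ r = 0 := by
      rw [reassoc_of% h2, Preadditive.sub_comp, Category.assoc, hsr, Category.id_comp,
        Category.comp_id, sub_self]
    rw [← Category.id_comp (i ≫ r), ← h1, Category.assoc, this, comp_zero]
  let φ : Y ⊞ X ≅ T :=
    { hom := biprod.desc i s
      inv := biprod.lift e r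
      hom_inv_id := by
        refine biprod.hom_ext' _ _ (biprod.hom_ext _ _ ?_ ?_) (biprod.hom_ext _ _ ?_ ?_) <;>
          simp [h1, hsr, hs, hi]
      inv_hom_id := by
        rw [biprod.lift_desc, h2]
        abel }
  have h3 : IsDeflation E (biprod.map (𝟙 Y) (s ≫ Θ) ≫ biprod.desc (i ≫ Θ) (𝟙 P)) :=
    hE.comp_deflation _ _ (hE.deflation_map_id_left Y h)
      (hE.deflation_of_splitEpi biprod.inr _ (biprod.inr_desc _ _))
  refine hE.deflation_of_iso h3 φ (Iso.refl _) ?_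
  refine biprod.hom_ext' _ _ ?_ ?_ <;> simp [φ]

end IsExactStructure

end Cover

/-! ### Tensor products of exact sequences -/

section Tensor

variable {𝒞 : Type*} [Category 𝒞] [Preadditive 𝒞] {E : ShortComplex 𝒞 → Prop}
  [MonoidalCategory 𝒞] [MonoidalPreadditive 𝒞]

theorem TensorExact.left (hT : TensorExact E) (X : 𝒞) {A B C : 𝒞} {f : A ⟶ B} {g : B ⟶ C}
    {w : f ≫ g = 0} (h : E (ShortComplex.mk f g w)) :
    E (ShortComplex.mk (X ◁ f) (X ◁ g) (by
      rw [← MonoidalCategory.whiskerLeft_comp, w, MonoidalPreadditive.whiskerLeft_zero])) :=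
  hT X _ h

variable [SymmetricCategory 𝒞]

theorem TensorExact.right (hT : TensorExact E) (hE : IsExactStructure E) {A B C : 𝒞} {f : A ⟶ B}
    {g : B ⟶ C} {w : f ≫ g = 0} (h : E (ShortComplex.mk f g w)) (X : 𝒞) :
    E (ShortComplex.mk (f ▷ X) (g ▷ X) (by
      rw [← comp_whiskerRight, w, MonoidalPreadditive.zero_whiskerRight])) :=
  hE.congr_iso (hT.left X h) _ (β_ X A) (β_ X B) (β_ X C)
    (BraidedCategory.braiding_naturality_right X f).symm
    (BraidedCategory.braiding_naturality_right X g).symm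

variable [HasFiniteBiproducts 𝒞]

/-- The tensor product of two exact sequences, in the form of a sequence from the tensor product
of the kernels to the fibre product of the mixed terms. -/
theorem tensor_conflation (hE : IsExactStructure E) (hT : TensorExact E) {A B C W U V P : 𝒞}
    {i : A ⟶ B} {d : B ⟶ C} {wi : i ≫ d = 0} (hi : E (ShortComplex.mk i d wi))
    {j : W ⟶ U} {p : U ⟶ V} {wj : j ≫ p = 0} (hj : E (ShortComplex.mk j p wj))
    {u : P ⟶ B ⊗ V} {v : P ⟶ C ⊗ U} (sq : IsPullback u v (d ▷ V) (C ◁ p))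
    {θ : B ⊗ U ⟶ P} (h₁ : θ ≫ u = B ◁ p) (h₂ : θ ≫ v = d ▷ U) (w : (i ⊗ₘ j) ≫ θ = 0) :
    E (ShortComplex.mk (i ⊗ₘ j) θ w) := by
  have m1 := hE.mono (hT.right hE hi W)
  have m2 := hE.mono (hT.left B hj)
  have m3 := hE.mono (hT.left C hj)
  have m4 := hE.mono (hT.right hE hi V)
  have : Mono (i ⊗ₘ j) := by
    rw [MonoidalCategory.tensorHom_def]
    exact mono_comp _ _
  have hv : IsDeflation E v := hE.deflation_of_isPullback sq ⟨_, _, _, hT.right hE hi V⟩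
  let κ : A ⊗ V ⟶ P := sq.lift (i ▷ V) 0 (by
    rw [← comp_whiskerRight, wi, MonoidalPreadditive.zero_whiskerRight, zero_comp])
  have κu : κ ≫ u = i ▷ V := sq.lift_fst _ _ _
  have κv : κ ≫ v = 0 := sq.lift_snd _ _ _
  have mκ : Mono κ := by
    have : Mono (κ ≫ u) := by rw [κu]; exact m4
    exact mono_of_mono κ u
  -- The base change of `d ▷ V` along `C ◁ p` has the same kernel `A ⊗ V`. Relative to this
  -- sequence, `θ` is checked on the quotient `C ⊗ U` by `d ▷ U` and on the kernel `A ⊗ V` by `A ◁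
  -- p`.
  have hκ : E (ShortComplex.mk κ v κv) := hE.of_isKernel κv hv fun t ht => by
    obtain ⟨l, hl⟩ := hE.lift (hT.right hE hi V) (t ≫ u) (by
      rw [Category.assoc, sq.w, reassoc_of% ht, zero_comp])
    refine ⟨l, sq.hom_ext ?_ ?_⟩
    · rw [Category.assoc, κu, hl]
    · rw [Category.assoc, κv, comp_zero, ht]
  refine hE.of_cover hκ θ ?_ (A ◁ p) ⟨_, _, _, hT.left A hj⟩ (i ▷ U) ?_ (i ⊗ₘ j) w ?_
  · rw [h₂]
    exact ⟨_, _, _, hT.right hE hi U⟩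
  · refine sq.hom_ext ?_ ?_
    · rw [Category.assoc, h₁, Category.assoc, κu, whisker_exchange]
    · rw [Category.assoc, h₂, Category.assoc, κv, comp_zero, ← comp_whiskerRight, wi,
        MonoidalPreadditive.zero_whiskerRight]
  · intro T t ht
    obtain ⟨b, hb⟩ := hE.lift (hT.left B hj) t (by rw [← h₁, reassoc_of% ht, zero_comp])
    obtain ⟨a, ha⟩ := hE.lift (hT.right hE hi W) b (by
      rw [← cancel_mono (C ◁ j), Category.assoc, ← whisker_exchange, reassoc_of% hb, ← h₂,
        reassoc_of% ht, zero_comp, zero_comp])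
    refine ⟨a, ?_⟩
    rw [MonoidalCategory.tensorHom_def, reassoc_of% ha, hb]

end Tensor

/-- The complex `R` is a resolution of `A` with augmentation `ε`. -/
def ResolvesVia {𝒞 : Type*} [Category 𝒞] [Preadditive 𝒞] (E : ShortComplex 𝒞 → Prop) {A : 𝒞}
    (R : CochainComplex 𝒞 ℕ) (ε : A ⟶ R.X 0) : Prop :=
  ∃ (Z : ℕ → 𝒞) (i : ∀ n, Z n ⟶ R.X n) (p : ∀ n, R.X n ⟶ Z (n + 1)) (w : ∀ n, i n ≫ p n = 0),
    (∃ e : A ≅ Z 0, e.hom ≫ i 0 = ε) ∧ (∀ n, E (ShortComplex.mk (i n) (p n) (w n))) ∧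
      ∀ n, R.d n (n + 1) = p n ≫ i (n + 1)

/-! ### Resolutions and their direct summands -/

section Resolution

variable {𝒞 : Type*} [Category 𝒞] [Preadditive 𝒞] {E : ShortComplex 𝒞 → Prop}

theorem resolvesVia_of_isIso (hE : IsExactStructure E) {A : 𝒞} {R : CochainComplex 𝒞 ℕ}
    (ε : A ⟶ R.X 0) [IsIso ε] (h : ∀ n, IsZero (R.X (n + 1))) : ResolvesVia E R ε :=
  ⟨R.X, fun _ => 𝟙 _, fun _ => 0, fun _ => comp_zero, ⟨asIso ε, Category.comp_id _⟩,
    fun n => hE.isoConflation _ inferInstance (h n) _ _, fun n => (h n).eq_of_tgt _ _⟩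

theorem ResolvesVia.of_splice {A : 𝒞} {R : CochainComplex 𝒞 ℕ} {ε : A ⟶ R.X 0} (P : ℕ → 𝒞)
    (k : ∀ n, P n ⟶ R.X (n + 1)) (q : ∀ n, R.X n ⟶ P n) (w0 : ε ≫ q 0 = 0)
    (w : ∀ n, k n ≫ q (n + 1) = 0) (h0 : E (ShortComplex.mk ε (q 0) w0))
    (h : ∀ n, E (ShortComplex.mk (k n) (q (n + 1)) (w n)))
    (hd : ∀ n, R.d n (n + 1) = q n ≫ k n) : ResolvesVia E R ε := by
  let Z : ℕ → 𝒞 := fun n => match n with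
    | 0 => A
    | n + 1 => P n
  let i : ∀ n, Z n ⟶ R.X n := fun n => match n with
    | 0 => ε
    | n + 1 => k n
  have wi : ∀ n, i n ≫ q n = 0 := by
    intro n
    match n with
    | 0 => exact w0
    | n + 1 => exact w n
  refine ⟨Z, i, q, wi, ⟨Iso.refl _, Category.id_comp _⟩, fun n => ?_, hd⟩
  match n with
  | 0 => exact h0
  | n + 1 => exact h n

/-- The image of an idempotent of a resolution is a resolution of the image. -/
theorem ResolvesVia.retract [HasFiniteBiproducts 𝒞] [IsIdempotentComplete 𝒞]
    (hE : IsExactStructure E) {A S : 𝒞}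
    {R T : CochainComplex 𝒞 ℕ} {ε : A ⟶ R.X 0} (hR : ResolvesVia E R ε) (r : S ⟶ A) (s : A ⟶ S)
    (hrs : r ≫ s = 𝟙 S) (r' : T ⟶ R) (s' : R ⟶ T) (hrs' : r' ≫ s' = 𝟙 T)
    (h : (s ≫ r) ≫ ε = ε ≫ (s' ≫ r').f 0) : IsResolution E S T := by
  obtain ⟨Z, i, p, w, ⟨e, he⟩, hexact, hd⟩ := hR
  set f := s' ≫ r' with hf
  have hff : ∀ n, f.f n ≫ f.f n = f.f n := fun n => by
    rw [← HomologicalComplex.comp_f, hf, Category.assoc, reassoc_of% hrs']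
  have hmono : ∀ n, Mono (i n) := fun n => hE.mono (hexact n)
  have hepi : ∀ n, Epi (p n) := fun n => hE.epi (hexact n)
  have hcomm : ∀ n, f.f n ≫ p n ≫ i (n + 1) = p n ≫ i (n + 1) ≫ f.f (n + 1) := fun n => by
    have := f.comm n (n + 1)
    rw [hd] at this
    rw [this, Category.assoc]
  -- The idempotent of the complex restricts to the cocycle objects, inductively: on `Z 0` it comes
  -- from the idempotent on `A`, and it passes to `Z (n + 1)` as the cokernel of `i n`.
  have hex : ∀ n, ∃ u : Z n ⟶ Z n, u ≫ i n = i n ≫ f.f n := by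
    intro n
    induction n with
    | zero =>
      refine ⟨e.inv ≫ (s ≫ r) ≫ e.hom, ?_⟩
      rw [Category.assoc, Category.assoc, he, h, ← he, Category.assoc, Iso.inv_hom_id_assoc]
    | succ n ih =>
      obtain ⟨u, hu⟩ := ih
      obtain ⟨v, hv⟩ := hE.desc (hexact n) (f.f n ≫ p n) (by
        rw [← reassoc_of% hu, w, comp_zero])
      refine ⟨v, ?_⟩
      rw [← cancel_epi (p n), reassoc_of% hv, hcomm]
  choose u hu using hex
  have hu' : ∀ n, p n ≫ u (n + 1) = f.f n ≫ p n := fun n => by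
    rw [← cancel_mono (i (n + 1)), Category.assoc, hu, Category.assoc, hcomm]
  have huu : ∀ n, u n ≫ u n = u n := fun n => by
    rw [← cancel_mono (i n), Category.assoc, hu, reassoc_of% (hu n), hff]
  have hu0 : u 0 = e.inv ≫ (s ≫ r) ≫ e.hom := by
    rw [← cancel_mono (i 0), hu, Category.assoc, Category.assoc, he, h, ← he, Category.assoc,
      Iso.inv_hom_id_assoc]
  choose Z' b a hba hab using fun n =>
    IsIdempotentComplete.idempotents_split (Z n) (u n) (huu n)
  have hrs'n : ∀ n, r'.f n ≫ s'.f n = 𝟙 _ := fun n => by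
    rw [← HomologicalComplex.comp_f, hrs', HomologicalComplex.id_f]
  have hfn : ∀ n, s'.f n ≫ r'.f n = f.f n := fun n => rfl
  have e1 : ∀ n, (b n ≫ i n ≫ s'.f n) ≫ r'.f n = b n ≫ i n := fun n => by
    rw [Category.assoc, Category.assoc, hfn, ← hu, ← hab, Category.assoc, reassoc_of% (hba n)]
  have e2 : ∀ n, a n ≫ b n ≫ i n ≫ s'.f n = i n ≫ s'.f n := fun n => by
    rw [reassoc_of% (hab n), reassoc_of% (hu n), ← hfn, Category.assoc, hrs'n, Category.comp_id]
  have e3 : ∀ n, s'.f n ≫ r'.f n ≫ p n ≫ a (n + 1) = p n ≫ a (n + 1) := fun n => by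
    rw [reassoc_of% (hfn n), ← reassoc_of% (hu' n), ← hab, Category.assoc, hba, Category.comp_id]
  have e4 : ∀ n, (r'.f n ≫ p n ≫ a (n + 1)) ≫ b (n + 1) = r'.f n ≫ p n := fun n => by
    rw [Category.assoc, Category.assoc, hab, hu', ← hfn, Category.assoc, reassoc_of% (hrs'n n)]
  have w' : ∀ n, (b n ≫ i n ≫ s'.f n) ≫ r'.f n ≫ p n ≫ a (n + 1) = 0 := fun n => by
    simp only [Category.assoc] at e1 ⊢
    rw [reassoc_of% (e1 n), reassoc_of% (w n), zero_comp, comp_zero]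
  refine ⟨Z', fun n => b n ≫ i n ≫ s'.f n, fun n => r'.f n ≫ p n ≫ a (n + 1), w', ?_, ?_, ?_⟩
  · have : IsSplitEpi s := ⟨⟨⟨r, hrs⟩⟩⟩
    have : IsSplitMono r := ⟨⟨⟨s, hrs⟩⟩⟩
    have : IsSplitEpi (a 0) := ⟨⟨⟨b 0, hba 0⟩⟩⟩
    have : IsSplitMono (b 0) := ⟨⟨⟨a 0, hba 0⟩⟩⟩
    refine nonempty_image_iso e (c := s ≫ r) (c' := u 0) ?_ s r rfl (a 0) (b 0) (hab 0)
    rw [hu0, Iso.hom_inv_id_assoc]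
  · intro n
    exact hE.of_retract (hexact n) (w' n) (b n) (a n) (hba n) (r'.f n) (s'.f n) (hrs'n n)
      (b (n + 1)) (a (n + 1)) (hba (n + 1)) (e1 n).symm (e2 n) (e4 n).symm (e3 n)
  · intro n
    have h1 := r'.comm n (n + 1)
    have : IsSplitMono (r'.f (n + 1)) := ⟨⟨⟨s'.f (n + 1), hrs'n (n + 1)⟩⟩⟩
    rw [hd] at h1
    rw [← Category.assoc, e4, Category.assoc, ← cancel_mono (r'.f (n + 1)), ← h1]
    simp only [Category.assoc]
    rw [hfn, ← hcomm, ← hfn, Category.assoc, reassoc_of% (hrs'n n)]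

end Resolution

/-! ### Tensoring a resolution with a two-term complex -/

section TensorResolution

variable {𝒞 : Type*} [Category 𝒞] [Preadditive 𝒞] [HasFiniteBiproducts 𝒞] [MonoidalCategory 𝒞]
  [MonoidalPreadditive 𝒞]

/-- The projection of the tensor product of complexes to a summand. -/
noncomputable def πT (K L : CochainComplex 𝒞 ℕ) (i j n : ℕ) :
    (K ⊗ L).X n ⟶ K.X i ⊗ L.X j :=
  HomologicalComplex.mapBifunctorDesc fun a b _ =>
    if h : a = i ∧ b = j then eqToHom (by rw [← h.1, ← h.2]; rfl) else 0

theorem ιT_πT (K L : CochainComplex 𝒞 ℕ) (i j n : ℕ) (h : i + j = n) :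
    ιT K L i j n h ≫ πT K L i j n = 𝟙 _ :=
  (HomologicalComplex.ι_mapBifunctorDesc _ _ _ _).trans (dif_pos ⟨rfl, rfl⟩)

theorem ιT_πT_ne (K L : CochainComplex 𝒞 ℕ) (a b i j n : ℕ) (h : a + b = n) (ha : a ≠ i) :
    ιT K L a b n h ≫ πT K L i j n = 0 :=
  (HomologicalComplex.ι_mapBifunctorDesc _ _ _ _).trans (dif_neg fun h => ha h.1)

theorem πT_total_zero (K L : CochainComplex 𝒞 ℕ) :
    πT K L 0 0 0 ≫ ιT K L 0 0 0 rfl = 𝟙 _ := by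
  apply ιT_ext
  intro i j h
  obtain ⟨rfl, rfl⟩ : i = 0 ∧ j = 0 := by omega
  rw [← Category.assoc, ιT_πT, Category.id_comp, Category.comp_id]

/-- Only degrees 0 and 1 of `K` contribute, so each positive degree of the tensor product has two
summands. -/
theorem πT_total_succ {K : CochainComplex 𝒞 ℕ} (hK : ∀ n, IsZero (K.X (n + 2)))
    (L : CochainComplex 𝒞 ℕ) (m : ℕ) :
    πT K L 0 (m + 1) (m + 1) ≫ ιT K L 0 (m + 1) (m + 1) (by omega) +
      πT K L 1 m (m + 1) ≫ ιT K L 1 m (m + 1) (by omega) = 𝟙 _ := by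
  apply ιT_ext
  intro i j h
  rw [Preadditive.comp_add, ← Category.assoc, ← Category.assoc, Category.comp_id]
  match i with
  | 0 =>
    obtain rfl : j = m + 1 := by omega
    rw [ιT_πT, ιT_πT_ne _ _ _ _ _ _ _ _ (by omega), Category.id_comp, zero_comp, add_zero]
  | 1 =>
    obtain rfl : j = m := by omega
    rw [ιT_πT, ιT_πT_ne _ _ _ _ _ _ _ _ (by omega), Category.id_comp, zero_comp, zero_add]
  | i + 2 => exact (isZero_tensor_left (hK i) _).eq_of_src _ _

variable [SymmetricCategory 𝒞]

theorem ιT_d_πT_zero (K L : CochainComplex 𝒞 ℕ) (n : ℕ) :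
    ιT K L 0 n n (by omega) ≫ (K ⊗ L).d n (n + 1) ≫ πT K L 0 (n + 1) (n + 1) =
      K.X 0 ◁ L.d n (n + 1) := by
  rw [← Category.assoc, ιT_d, Preadditive.add_comp, Category.assoc,
    ιT_πT_ne _ _ _ _ _ _ _ _ (by omega), comp_zero, zero_add, pow_zero, one_smul, Category.assoc,
    ιT_πT, Category.comp_id]

theorem ιT_d_πT_one (K L : CochainComplex 𝒞 ℕ) (n : ℕ) :
    ιT K L 0 n n (by omega) ≫ (K ⊗ L).d n (n + 1) ≫ πT K L 1 n (n + 1) =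
      K.d 0 1 ▷ L.X n := by
  rw [← Category.assoc, ιT_d, Preadditive.add_comp, Category.assoc, pow_zero, one_smul,
    Category.assoc, ιT_πT_ne K L 0 (n + 1) 1 n (n + 1) _ (by omega), comp_zero, add_zero,
    ιT_πT, Category.comp_id]

theorem ιT_one_d_πT_zero (K L : CochainComplex 𝒞 ℕ) (m : ℕ) :
    ιT K L 1 m (m + 1) (by omega) ≫ (K ⊗ L).d (m + 1) (m + 2) ≫ πT K L 0 (m + 2) (m + 2) = 0 := by
  rw [← Category.assoc, ιT_d, Preadditive.add_comp, Category.assoc, Linear.units_smul_comp,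
    Category.assoc, ιT_πT_ne _ _ _ _ _ _ _ _ (by omega), ιT_πT_ne _ _ _ _ _ _ _ _ (by omega),
    comp_zero, comp_zero, smul_zero, add_zero]

theorem ιT_one_d_πT_one (K L : CochainComplex 𝒞 ℕ) (m : ℕ) :
    ιT K L 1 m (m + 1) (by omega) ≫ (K ⊗ L).d (m + 1) (m + 2) ≫ πT K L 1 (m + 1) (m + 2) =
      - K.X 1 ◁ L.d m (m + 1) := by
  rw [← Category.assoc, ιT_d, Preadditive.add_comp, Category.assoc, Linear.units_smul_comp,
    Category.assoc, ιT_πT_ne _ _ _ _ _ _ _ _ (by omega), ιT_πT, comp_zero, zero_add, pow_one,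
    Units.neg_smul, one_smul, Category.comp_id]

variable {E : ShortComplex 𝒞 → Prop}

/-- The tensor product of a resolution with the two-term complex of an extension. -/
theorem ResolvesVia.tensor [IsIdempotentComplete 𝒞] (hE : IsExactStructure E)
    (hT : TensorExact E) {K : CochainComplex 𝒞 ℕ} (hK : ∀ n, IsZero (K.X (n + 2))) {A M : 𝒞}
    {i : A ⟶ K.X 0} {wi : i ≫ K.d 0 1 = 0} (hi : E (ShortComplex.mk i (K.d 0 1) wi))
    {R : CochainComplex 𝒞 ℕ} {ε : M ⟶ R.X 0} (hR : ResolvesVia E R ε) :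
    ResolvesVia E (K ⊗ R) ((i ⊗ₘ ε) ≫ ιT K R 0 0 0 rfl) := by
  obtain ⟨Z, j, p, wj, ⟨e, he⟩, hj, hd⟩ := hR
  -- `P n` plays the role of the cocycles in degree `n + 1`: pairs of a cocycle `x` of `R` with
  -- coefficients in `K.X 0` and an element `y` of `K.X 1 ⊗ R.X n`, such that `x` and `y` have the
  -- same image in `K.X 1 ⊗ Z (n + 1)`.
  choose P u v sq hv using fun n =>
    hE.pullback (K.d 0 1 ▷ Z (n + 1)) (K.X 1 ◁ p n) ⟨_, _, _, hT.right hE hi _⟩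
  have mj : ∀ n, Mono (j n) := fun n => hE.mono (hj n)
  have m1 : ∀ X n, Mono (X ◁ j n) := fun X n => hE.mono (hT.left X (hj n))
  have hjd : ∀ n, j n ≫ R.d n (n + 1) = 0 := fun n => by
    rw [hd, reassoc_of% (wj n), zero_comp]
  have hdp : ∀ n, R.d n (n + 1) ≫ p (n + 1) = 0 := fun n => by
    rw [hd, Category.assoc, wj, comp_zero]
  have hUex : ∀ n, ∃ U : (K ⊗ R).X n ⟶ K.X 0 ⊗ Z (n + 1),
      U ≫ K.X 0 ◁ j (n + 1) = (K ⊗ R).d n (n + 1) ≫ πT K R 0 (n + 1) (n + 1) := by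
    intro n
    refine ⟨πT K R 0 n n ≫ K.X 0 ◁ p n, ιT_ext fun a b hab => ?_⟩
    rw [Category.assoc, ← MonoidalCategory.whiskerLeft_comp, ← hd]
    match a with
    | 0 =>
      obtain rfl : b = n := by omega
      rw [ιT_d_πT_zero, ← Category.assoc, ιT_πT, Category.id_comp]
    | 1 =>
      obtain rfl : n = b + 1 := by omega
      rw [ιT_one_d_πT_zero, ← Category.assoc, ιT_πT_ne _ _ _ _ _ _ _ _ (by omega), zero_comp]
    | a + 2 => exact (isZero_tensor_left (hK a) _).eq_of_src _ _
  choose U hU using hUex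
  have hιU : ∀ n, ιT K R 0 n n (by omega) ≫ U n = K.X 0 ◁ p n := fun n => by
    rw [← cancel_mono (K.X 0 ◁ j (n + 1)), Category.assoc, hU, ιT_d_πT_zero, hd,
      MonoidalCategory.whiskerLeft_comp]
  have hιU' : ∀ m, ιT K R 1 m (m + 1) (by omega) ≫ U (m + 1) = 0 := fun m => by
    rw [← cancel_mono (K.X 0 ◁ j (m + 2)), Category.assoc, hU, ιT_one_d_πT_zero, zero_comp]
  let V : ∀ n, (K ⊗ R).X n ⟶ K.X 1 ⊗ R.X n := fun n => (K ⊗ R).d n (n + 1) ≫ πT K R 1 n (n + 1)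
  have hUV : ∀ n, U n ≫ K.d 0 1 ▷ Z (n + 1) = V n ≫ K.X 1 ◁ p n := by
    intro n
    refine ιT_ext fun a b hab => ?_
    match a with
    | 0 =>
      obtain rfl : b = n := by omega
      rw [← Category.assoc, hιU, ← Category.assoc (ιT _ _ _ _ _ _), ιT_d_πT_one, whisker_exchange]
    | 1 =>
      obtain rfl : n = b + 1 := by omega
      rw [← Category.assoc, hιU', ← Category.assoc (ιT _ _ _ _ _ _), ιT_one_d_πT_one, zero_comp,
        Preadditive.neg_comp, ← MonoidalCategory.whiskerLeft_comp, hdp,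
        MonoidalPreadditive.whiskerLeft_zero, neg_zero]
    | a + 2 => exact (isZero_tensor_left (hK a) _).eq_of_src _ _
  let q : ∀ n, (K ⊗ R).X n ⟶ P n := fun n => (sq n).lift (U n) (V n) (hUV n)
  have qu : ∀ n, q n ≫ u n = U n := fun n => (sq n).lift_fst _ _ _
  have qv : ∀ n, q n ≫ v n = V n := fun n => (sq n).lift_snd _ _ _
  have hθ : ∀ n, ∃ w : (i ⊗ₘ j n) ≫ ιT K R 0 n n (by omega) ≫ q n = 0,
      E (ShortComplex.mk (i ⊗ₘ j n) (ιT K R 0 n n (by omega) ≫ q n) w) := by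
    intro n
    have t1 : (ιT K R 0 n n (by omega) ≫ q n) ≫ u n = K.X 0 ◁ p n := by
      rw [Category.assoc, qu, hιU]
    have t2 : (ιT K R 0 n n (by omega) ≫ q n) ≫ v n = K.d 0 1 ▷ R.X n := by
      rw [Category.assoc, qv, ιT_d_πT_one]
    have w : (i ⊗ₘ j n) ≫ ιT K R 0 n n (by omega) ≫ q n = 0 := by
      refine (sq n).hom_ext ?_ ?_
      · rw [Category.assoc, t1, zero_comp, ← id_tensorHom,
          MonoidalCategory.tensorHom_comp_tensorHom, wj, MonoidalPreadditive.tensor_zero]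
      · rw [Category.assoc, t2, zero_comp, ← tensorHom_id,
          MonoidalCategory.tensorHom_comp_tensorHom, wi, MonoidalPreadditive.zero_tensor]
    exact ⟨w, tensor_conflation hE hT hi (hj n) (sq n) t1 t2 w⟩
  choose wθ hθ' using hθ
  -- Already the summand `K.X 0 ⊗ R.X n` maps onto the cocycles, by `tensor_conflation`; the other
  -- summand is not needed for this.
  have hq : ∀ n, IsDeflation E (q n) := fun n =>
    hE.deflation_of_splitMono_comp (ιT K R 0 n n (by omega)) (πT K R 0 n n) (ιT_πT _ _ _ _ _ _) _
      ⟨_, _, _, hθ' n⟩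
  let k : ∀ n, P n ⟶ (K ⊗ R).X (n + 1) := fun n =>
    (u n ≫ K.X 0 ◁ j (n + 1)) ≫ ιT K R 0 (n + 1) (n + 1) (by omega) +
      v n ≫ ιT K R 1 n (n + 1) (by omega)
  have hk0 : ∀ n, k n ≫ πT K R 0 (n + 1) (n + 1) = u n ≫ K.X 0 ◁ j (n + 1) := fun n => by
    rw [Preadditive.add_comp, Category.assoc, ιT_πT, Category.comp_id, Category.assoc,
      ιT_πT_ne _ _ _ _ _ _ _ _ (by omega), comp_zero, add_zero]
  have hk1 : ∀ n, k n ≫ πT K R 1 n (n + 1) = v n := fun n => by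
    rw [Preadditive.add_comp, Category.assoc, ιT_πT_ne _ _ _ _ _ _ _ _ (by omega), comp_zero,
      zero_add, Category.assoc, ιT_πT, Category.comp_id]
  have mk : ∀ n, Mono (k n) := fun n => ⟨fun a b hab => by
    have h0 := congrArg (fun f => f ≫ πT K R 0 (n + 1) (n + 1)) hab
    have h1 := congrArg (fun f => f ≫ πT K R 1 n (n + 1)) hab
    simp only [Category.assoc, hk0, hk1] at h0 h1
    refine (sq n).hom_ext ?_ h1
    rw [← cancel_mono (K.X 0 ◁ j (n + 1)), Category.assoc, Category.assoc, h0]⟩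
  have dk : ∀ n, (K ⊗ R).d n (n + 1) = q n ≫ k n := fun n => by
    simp only [k, Preadditive.comp_add, Category.assoc]
    rw [reassoc_of% (qu n), reassoc_of% (hU n), reassoc_of% (qv n)]
    simp only [V, Category.assoc]
    rw [← Preadditive.comp_add, πT_total_succ hK, Category.comp_id]
  have kq : ∀ n, k n ≫ q (n + 1) = 0 := fun n => by
    have : Epi (q n) := by
      obtain ⟨_, _, _, h⟩ := hq n
      exact hE.epi h
    rw [← cancel_epi (q n), comp_zero, ← cancel_mono (k (n + 1)), zero_comp, Category.assoc,
      Category.assoc, ← dk, ← Category.assoc, ← dk, HomologicalComplex.d_comp_d]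
  have mA : Mono (A ◁ j 0) := m1 A 0
  have hε : i ⊗ₘ ε = A ◁ e.hom ≫ (i ⊗ₘ j 0) := by
    rw [← id_tensorHom, MonoidalCategory.tensorHom_comp_tensorHom, he, Category.id_comp]
  have w0 : ((i ⊗ₘ ε) ≫ ιT K R 0 0 0 rfl) ≫ q 0 = 0 := by
    rw [hε, Category.assoc, Category.assoc, wθ, comp_zero]
  have : Mono ((i ⊗ₘ ε) ≫ ιT K R 0 0 0 rfl) := by
    have h1 := hE.mono (hθ' 0)
    have h2 : IsSplitMono (ιT K R 0 0 0 rfl) := ⟨⟨⟨πT K R 0 0 0, ιT_πT _ _ _ _ _ _⟩⟩⟩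
    rw [hε]
    exact mono_comp _ _
  refine ResolvesVia.of_splice P k q w0 kq (hE.of_isKernel w0 (hq 0) fun t ht => ?_)
    (fun n => hE.of_isKernel (kq n) (hq (n + 1)) fun t ht => ?_) dk
  · obtain ⟨l, hl⟩ := hE.lift (hθ' 0) (t ≫ πT K R 0 0 0) (by
      rw [Category.assoc, reassoc_of% (πT_total_zero K R), ht])
    refine ⟨l ≫ A ◁ e.inv, ?_⟩
    rw [hε]
    simp only [Category.assoc]
    rw [← MonoidalCategory.whiskerLeft_comp_assoc, Iso.inv_hom_id,
      MonoidalCategory.whiskerLeft_id, Category.id_comp, reassoc_of% hl, πT_total_zero,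
      Category.comp_id]
  · have ht0 : t ≫ U (n + 1) = 0 := by rw [← qu, reassoc_of% ht, zero_comp]
    have ht1 : t ≫ V (n + 1) = 0 := by rw [← qv, reassoc_of% ht, zero_comp]
    have htot : t = (t ≫ πT K R 0 (n + 1) (n + 1)) ≫ ιT K R 0 (n + 1) (n + 1) (by omega) +
        (t ≫ πT K R 1 n (n + 1)) ≫ ιT K R 1 n (n + 1) (by omega) := by
      rw [Category.assoc, Category.assoc, ← Preadditive.comp_add, πT_total_succ hK,
        Category.comp_id]
    -- Now `x` and `y` are the two components of a morphism `t` killed by the differential. The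
    -- condition on `x` lifts it to a cocycle `b`, and the other condition, with its Koszul sign,
    -- says that `b` and `y` form a point of `P n`.
    generalize t ≫ πT K R 0 (n + 1) (n + 1) = x at htot
    generalize t ≫ πT K R 1 n (n + 1) = y at htot
    rw [htot, Preadditive.add_comp, Category.assoc, Category.assoc, hιU, hιU', comp_zero,
      add_zero] at ht0
    rw [htot, Preadditive.add_comp, Category.assoc, Category.assoc, ιT_d_πT_one,
      ιT_one_d_πT_one, Preadditive.comp_neg, add_neg_eq_zero] at ht1
    obtain ⟨b, hb⟩ := hE.lift (hT.left (K.X 0) (hj (n + 1))) x ht0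
    have hby : b ≫ K.d 0 1 ▷ Z (n + 1) = y ≫ K.X 1 ◁ p n := by
      rw [← cancel_mono (K.X 1 ◁ j (n + 1)), Category.assoc, ← whisker_exchange,
        reassoc_of% hb, ht1, Category.assoc, ← MonoidalCategory.whiskerLeft_comp, hd]
    refine ⟨(sq n).lift b y hby, ?_⟩
    simp only [k, Preadditive.comp_add, Category.assoc, IsPullback.lift_fst_assoc,
      IsPullback.lift_snd_assoc]
    rw [reassoc_of% hb, ← htot]

end TensorResolution

/-! ### Equivariant augmentations of tensor powers -/

section Augmentation

variable {𝒞 : Type*} [Category 𝒞] [Preadditive 𝒞] [HasFiniteBiproducts 𝒞] [MonoidalCategory 𝒞]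
  [MonoidalPreadditive 𝒞]

/-- The tensor power of a morphism to the degree zero term of a complex. -/
noncomputable def powAug {K : CochainComplex 𝒞 ℕ} {A : 𝒞} (i : A ⟶ K.X 0) :
    ∀ m, tensorPow A m ⟶ (tensorPow K m).X 0
  | 0 => (HomologicalComplex.singleObjXSelf (ComplexShape.up ℕ) 0 (𝟙_ 𝒞)).inv
  | m + 1 => (i ⊗ₘ powAug i m) ≫ ιT K (tensorPow K m) 0 0 0 rfl

theorem whiskerRight_aug {K K' L : CochainComplex 𝒞 ℕ} {X X' Y : 𝒞} {a : X ⟶ K.X 0}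
    {a' : X' ⟶ K'.X 0} (b : Y ⟶ L.X 0) {f : K ⟶ K'} {g : X ⟶ X'}
    (h : a ≫ f.f 0 = g ≫ a') [SymmetricCategory 𝒞] :
    ((a ⊗ₘ b) ≫ ιT K L 0 0 0 rfl) ≫ (f ▷ L).f 0 =
      g ▷ Y ≫ (a' ⊗ₘ b) ≫ ιT K' L 0 0 0 rfl := by
  rw [Category.assoc, ιT_whiskerRight, ← tensorHom_id, ← tensorHom_id,
    MonoidalCategory.tensorHom_comp_tensorHom_assoc,
    MonoidalCategory.tensorHom_comp_tensorHom_assoc, h, Category.comp_id, Category.id_comp]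

theorem whiskerLeft_aug {K L L' : CochainComplex 𝒞 ℕ} {X Y Y' : 𝒞} (a : X ⟶ K.X 0)
    {b : Y ⟶ L.X 0} {b' : Y' ⟶ L'.X 0} {f : L ⟶ L'} {g : Y ⟶ Y'}
    (h : b ≫ f.f 0 = g ≫ b') [SymmetricCategory 𝒞] :
    ((a ⊗ₘ b) ≫ ιT K L 0 0 0 rfl) ≫ (K ◁ f).f 0 =
      X ◁ g ≫ (a ⊗ₘ b') ≫ ιT K L' 0 0 0 rfl := by
  rw [Category.assoc, ιT_whiskerLeft, ← id_tensorHom, ← id_tensorHom,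
    MonoidalCategory.tensorHom_comp_tensorHom_assoc,
    MonoidalCategory.tensorHom_comp_tensorHom_assoc, h, Category.comp_id, Category.id_comp]

variable [SymmetricCategory 𝒞]

theorem associator_aug {K L M : CochainComplex 𝒞 ℕ} {X Y Z : 𝒞} (a : X ⟶ K.X 0) (b : Y ⟶ L.X 0)
    (c : Z ⟶ M.X 0) :
    ((((a ⊗ₘ b) ≫ ιT K L 0 0 0 rfl) ⊗ₘ c) ≫ ιT (K ⊗ L) M 0 0 0 rfl) ≫ (α_ K L M).hom.f 0 =
      (α_ X Y Z).hom ≫ (a ⊗ₘ ((b ⊗ₘ c) ≫ ιT L M 0 0 0 rfl)) ≫ ιT K (L ⊗ M) 0 0 0 rfl := by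
  have s1 : ((a ⊗ₘ b) ≫ ιT K L 0 0 0 rfl) ⊗ₘ c =
      ((a ⊗ₘ b) ⊗ₘ c) ≫ ιT K L 0 0 0 rfl ▷ M.X 0 := by
    rw [← tensorHom_id, MonoidalCategory.tensorHom_comp_tensorHom, Category.comp_id]
  have s2 : a ⊗ₘ ((b ⊗ₘ c) ≫ ιT L M 0 0 0 rfl) =
      (a ⊗ₘ (b ⊗ₘ c)) ≫ K.X 0 ◁ ιT L M 0 0 0 rfl := by
    rw [← id_tensorHom, MonoidalCategory.tensorHom_comp_tensorHom, Category.comp_id]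
  have e := ιT_associator_hom K L M 0 0 0 0 0 0 rfl rfl rfl
  rw [s1, s2, Category.assoc, Category.assoc, e, Category.assoc,
    MonoidalCategory.associator_naturality_assoc]

/-- The Koszul sign in bidegree `(0, 0)` is 1. -/
theorem braiding_aug {K L : CochainComplex 𝒞 ℕ} {X Y : 𝒞} (a : X ⟶ K.X 0) (b : Y ⟶ L.X 0) :
    ((a ⊗ₘ b) ≫ ιT K L 0 0 0 rfl) ≫ (β_ K L).hom.f 0 =
      (β_ X Y).hom ≫ (b ⊗ₘ a) ≫ ιT L K 0 0 0 rfl := by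
  change _ ≫ koszulX K L 0 = _
  rw [Category.assoc, ιT_koszulX, mul_zero, pow_zero, one_smul,
    BraidedCategory.braiding_naturality_assoc]

theorem braidFront_aug {K L M : CochainComplex 𝒞 ℕ} {X Y Z : 𝒞} (a : X ⟶ K.X 0) (b : Y ⟶ L.X 0)
    (c : Z ⟶ M.X 0) :
    ((a ⊗ₘ ((b ⊗ₘ c) ≫ ιT L M 0 0 0 rfl)) ≫ ιT K (L ⊗ M) 0 0 0 rfl) ≫ (braidFront K L M).f 0 =
      braidFront X Y Z ≫ (b ⊗ₘ ((a ⊗ₘ c) ≫ ιT K M 0 0 0 rfl)) ≫ ιT L (K ⊗ M) 0 0 0 rfl := by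
  have e1 : ((a ⊗ₘ ((b ⊗ₘ c) ≫ ιT L M 0 0 0 rfl)) ≫ ιT K (L ⊗ M) 0 0 0 rfl) ≫
      (α_ K L M).inv.f 0 = (α_ X Y Z).inv ≫
        (((a ⊗ₘ b) ≫ ιT K L 0 0 0 rfl) ⊗ₘ c) ≫ ιT (K ⊗ L) M 0 0 0 rfl := by
    rw [Iso.eq_inv_comp, ← Category.assoc, ← associator_aug, Category.assoc,
      ← HomologicalComplex.comp_f, Iso.hom_inv_id, HomologicalComplex.id_f, Category.comp_id]
  simp only [braidFront, HomologicalComplex.comp_f]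
  rw [← Category.assoc, e1, Category.assoc,
    ← Category.assoc ((((a ⊗ₘ b) ≫ ιT K L 0 0 0 rfl) ⊗ₘ c) ≫ _),
    whiskerRight_aug c (braiding_aug a b), Category.assoc, associator_aug]
  simp only [Category.assoc]

theorem powAug_adjBraid {K : CochainComplex 𝒞 ℕ} {A : 𝒞} (i : A ⟶ K.X 0) (m k : ℕ) :
    powAug i m ≫ (adjBraid K m k : tensorPow K m ⟶ _).f 0 =
      (adjBraid A m k : tensorPow A m ⟶ _) ≫ powAug i m := by
  induction m generalizing k with
  | zero => exact (Category.comp_id _).trans (Category.id_comp _).symm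
  | succ m ih =>
    cases k with
    | zero =>
      cases m with
      | zero => exact (Category.comp_id _).trans (Category.id_comp _).symm
      | succ m => exact braidFront_aug i i (powAug i m)
    | succ k => exact whiskerLeft_aug i (ih k)

theorem powAug_permAction {K : CochainComplex 𝒞 ℕ} {A : 𝒞} (i : A ⟶ K.X 0) (m : ℕ)
    (σ : Equiv.Perm (Fin m)) :
    powAug i m ≫ (permAction K m σ : tensorPow K m ⟶ _).f 0 =
      (permAction A m σ : tensorPow A m ⟶ _) ≫ powAug i m := by
  induction σ using perm_induction with
  | h1 =>
    rw [map_one, map_one]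
    exact (Category.comp_id _).trans (Category.id_comp _).symm
  | hmul σ τ hσ hτ =>
    rw [map_mul, map_mul, End.mul_def, End.mul_def, HomologicalComplex.comp_f, ← Category.assoc,
      hτ, Category.assoc, hσ, Category.assoc]
  | hadj k hk =>
    rw [permAction_adjSwap _ _ _ hk, permAction_adjSwap _ _ _ hk, powAug_adjBraid]

theorem powAug_cellAction [Linear ℚ 𝒞] {K : CochainComplex 𝒞 ℕ} {A : 𝒞} (i : A ⟶ K.X 0)
    (D : Finset (ℕ × ℕ)) (x : MonoidAlgebra ℚ (Equiv.Perm D)) :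
    powAug i D.card ≫ (cellAction D K x : tensorPow K D.card ⟶ _).f 0 =
      (cellAction D A x : tensorPow A D.card ⟶ _) ≫ powAug i D.card := by
  induction x using MonoidAlgebra.induction_on with
  | of g => rw [cellAction_of, cellAction_of, powAug_permAction]
  | add x y hx hy =>
    rw [map_add, map_add]
    exact (Preadditive.comp_add _ _ _ _ _ _).trans
      ((congrArg₂ (· + ·) hx hy).trans (Preadditive.add_comp _ _ _ _ _ _).symm)
  | smul r x hx =>
    rw [map_smul, map_smul]
    exact (Linear.comp_smul _ _ _ _ _ _).trans
      ((congrArg (r • ·) hx).trans (Linear.smul_comp _ _ _ _ _ _).symm)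

variable {E : ShortComplex 𝒞 → Prop} [IsIdempotentComplete 𝒞]

theorem resolvesVia_powAug (hE : IsExactStructure E) (hT : TensorExact E)
    {K : CochainComplex 𝒞 ℕ} (hK : ∀ n, IsZero (K.X (n + 2))) {A : 𝒞} {i : A ⟶ K.X 0}
    {wi : i ≫ K.d 0 1 = 0} (hi : E (ShortComplex.mk i (K.d 0 1) wi)) (m : ℕ) :
    ResolvesVia E (tensorPow K m) (powAug i m) := by
  induction m with
  | zero =>
    exact resolvesVia_of_isIso hE
      (HomologicalComplex.singleObjXSelf (ComplexShape.up ℕ) 0 (𝟙_ 𝒞)).inv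
      fun n => HomologicalComplex.isZero_single_obj_X (ComplexShape.up ℕ) 0 (𝟙_ 𝒞) (n + 1)
        (Nat.succ_ne_zero n)
  | succ m ih => exact ih.tensor hE hT hK hi

end Augmentation

/-! ### Schur functors of resolutions -/

section SchurRetract

variable {𝒞 : Type*} [Category 𝒞] [Preadditive 𝒞] [Linear ℚ 𝒞] [MonoidalCategory 𝒞]
  [SymmetricCategory 𝒞]

/-- The idempotent `x * youngElt D` that cuts out the Schur functor lives in the group algebra and
is independent of `X`. Any equivariant map, such as the augmentation, is therefore compatible with
it. -/
theorem schur_retract (D : Finset (ℕ × ℕ)) {X Y : 𝒞} (p : tensorPow X D.card ⟶ Y)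
    (i : Y ⟶ tensorPow X D.card) [IsSplitEpi p] [IsSplitMono i] (h : p ≫ i = youngEnd D X)
    {x : MonoidAlgebra ℚ (Equiv.Perm D)} (hx : youngElt D * x * youngElt D = youngElt D) :
    (i ≫ (cellAction D X x : tensorPow X D.card ⟶ _)) ≫ p = 𝟙 Y ∧
      p ≫ i ≫ (cellAction D X x : tensorPow X D.card ⟶ _) =
        (cellAction D X (x * youngElt D) : tensorPow X D.card ⟶ _) := by
  have hc : p ≫ i = (cellAction D X (youngElt D) : tensorPow X D.card ⟶ _) := h
  constructor
  · have h1 := congrArg (cellAction D X) hx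
    rw [map_mul, map_mul, End.mul_def, End.mul_def, ← hc] at h1
    rw [← cancel_epi p, ← cancel_mono i, Category.comp_id, ← h1]
    simp only [Category.assoc]
  · rw [map_mul, End.mul_def, ← hc, Category.assoc]

theorem schurObj_spec [IsIdempotentComplete 𝒞] (D : Finset (ℕ × ℕ)) (X : 𝒞) :
    ∃ (p : tensorPow X D.card ⟶ schurObj D X) (i : schurObj D X ⟶ tensorPow X D.card),
      IsSplitEpi p ∧ IsSplitMono i ∧ p ≫ i = youngEnd D X :=
  (exists_schur D X).choose_spec

/-- The Schur functor of the two-term complex of an extension is a resolution. -/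
theorem isResolution_schurObj [HasFiniteBiproducts 𝒞] [MonoidalPreadditive 𝒞]
    [IsIdempotentComplete 𝒞] {E : ShortComplex 𝒞 → Prop} (hE : IsExactStructure E)
    (hT : TensorExact E) {K : CochainComplex 𝒞 ℕ} (hK : ∀ n, IsZero (K.X (n + 2))) {A : 𝒞}
    {i : A ⟶ K.X 0} {wi : i ≫ K.d 0 1 = 0} (hi : E (ShortComplex.mk i (K.d 0 1) wi))
    (D : Finset (ℕ × ℕ)) : IsResolution E (schurObj D A) (schurObj D K) := by
  obtain ⟨p, j, hp, hj, hpj⟩ := schurObj_spec D A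
  obtain ⟨p', j', hp', hj', hpj'⟩ := schurObj_spec D K
  obtain ⟨x, hx⟩ := exists_regular (youngElt D)
  obtain ⟨h1, h2⟩ := schur_retract D p j hpj hx
  obtain ⟨h1', h2'⟩ := schur_retract D p' j' hpj' hx
  refine (resolvesVia_powAug hE hT hK hi D.card).retract hE _ p h1 _ p' h1' ?_
  rw [h2, h2', powAug_cellAction]

end SchurRetract

/-! ### Stupid truncations -/

section Filtration

variable {𝒞 : Type*} [Category 𝒞] [Preadditive 𝒞]

/-- The stupid truncations of a complex. -/
theorem exists_stupidFiltration [HasZeroObject 𝒞] (R : CochainComplex 𝒞 ℕ) :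
    ∃ F : ℕ → Subobject R, Antitone F ∧
      ∀ k n, (k ≤ n → IsIso ((F k).arrow.f n)) ∧
        (n < k → IsZero ((F k : CochainComplex 𝒞 ℕ).X n)) := by
  obtain ⟨O, hO⟩ := (inferInstance : HasZeroObject 𝒞)
  -- Each term is `R.X n` or zero; recording it by a split inclusion avoids case distinctions in the
  -- types of the differentials.
  have hex : ∀ k n, ∃ (Y : 𝒞) (j : Y ⟶ R.X n) (q : R.X n ⟶ Y), j ≫ q = 𝟙 Y ∧
      (k ≤ n → q ≫ j = 𝟙 _) ∧ (n < k → IsZero Y) := by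
    intro k n
    by_cases h : k ≤ n
    · exact ⟨R.X n, 𝟙 _, 𝟙 _, Category.comp_id _, fun _ => Category.comp_id _,
        fun h' => absurd h (by omega)⟩
    · exact ⟨O, 0, 0, hO.eq_of_src _ _, fun h' => absurd h' h, fun _ => hO⟩
  choose Y j q hjq hqj hY using hex
  have hd : ∀ k n m, n + 1 = m → (j k n ≫ R.d n m ≫ q k m) ≫ j k m = j k n ≫ R.d n m := by
    intro k n m hnm
    by_cases h : k ≤ m
    · rw [Category.assoc, Category.assoc, hqj k m h, Category.comp_id]
    · exact (hY k n (by omega)).eq_of_src _ _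
  let T : ℕ → CochainComplex 𝒞 ℕ := fun k =>
    { X := Y k
      d := fun n m => j k n ≫ R.d n m ≫ q k m
      shape := fun n m h => by rw [R.shape n m h, zero_comp, comp_zero]
      d_comp_d' := fun n m l h _ => by
        rw [← Category.assoc, hd k n m h, Category.assoc, R.d_comp_d_assoc, zero_comp, comp_zero] }
  let t : ∀ k, T k ⟶ R := fun k =>
    { f := j k
      comm' := fun n m h => (hd k n m h).symm }
  have hmono' : ∀ k n, Mono ((t k).f n) := fun k n =>
    have : IsSplitMono ((t k).f n) := ⟨⟨⟨q k n, hjq k n⟩⟩⟩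
    inferInstance
  have hmono : ∀ k, Mono (t k) := fun k => HomologicalComplex.mono_of_mono_f _ (hmono' k)
  refine ⟨fun k => Subobject.mk (t k), fun k l hkl => ?_, fun k n => ⟨fun h => ?_, fun h => ?_⟩⟩
  · have hf : ∀ n, (j l n ≫ q k n) ≫ j k n = j l n := by
      intro n
      by_cases h : k ≤ n
      · rw [Category.assoc, hqj k n h, Category.comp_id]
      · exact (hY l n (by omega)).eq_of_src _ _
    let s : T l ⟶ T k :=
      { f := fun n => j l n ≫ q k n
        comm' := fun n m h => by
          have := hmono' k m
          rw [← cancel_mono ((t k).f m)]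
          change ((j l n ≫ q k n) ≫ j k n ≫ R.d n m ≫ q k m) ≫ j k m =
            ((j l n ≫ R.d n m ≫ q l m) ≫ j l m ≫ q k m) ≫ j k m
          rw [Category.assoc, hd k n m h, ← Category.assoc (j l n ≫ q k n), hf,
            Category.assoc (j l n ≫ _), hf, hd l n m h] }
    refine Subobject.mk_le_mk_of_comm s ?_
    ext n
    exact hf n
  · have : IsIso ((t k).f n) := ⟨⟨q k n, hjq k n, hqj k n h⟩⟩
    rw [← Subobject.underlyingIso_hom_comp_eq_mk, HomologicalComplex.comp_f]
    infer_instance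
  · exact (hY k n h).of_iso
      ((HomologicalComplex.eval 𝒞 (ComplexShape.up ℕ) n).mapIso (Subobject.underlyingIso (t k)))

variable {E : ShortComplex 𝒞 → Prop} [HasFiniteBiproducts 𝒞]

/-- The filtration of a complex by its stupid truncations. -/
theorem exists_filtration (hE : IsExactStructure E) (R : CochainComplex 𝒞 ℕ) (N : ℕ)
    (hR : ∀ n, N < n → IsZero (R.X n)) (G : ℕ → CochainComplex 𝒞 ℕ)
    (hG : ∀ k n, n ≠ k → IsZero ((G k).X n)) (e : ∀ k, Nonempty (R.X k ≅ (G k).X k)) :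
    ∃ (F : ℕ → Subobject R) (hF : Antitone F), F 0 = ⊤ ∧ F (N + 1) = ⊥ ∧
      ∀ k, ∃ (g : (F k : CochainComplex 𝒞 ℕ) ⟶ G k)
        (wg : Subobject.ofLE (F (k + 1)) (F k) (hF (Nat.le_succ k)) ≫ g = 0),
        DegreewiseExact E
          (ShortComplex.mk (Subobject.ofLE (F (k + 1)) (F k) (hF (Nat.le_succ k))) g wg) := by
  obtain ⟨F, hF, h⟩ := exists_stupidFiltration R
  refine ⟨F, hF, ?_, ?_, fun k => ?_⟩
  · have := fun n => (h 0 n).1 (Nat.zero_le n)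
    have := HomologicalComplex.Hom.isIso_of_components (F 0).arrow
    exact Subobject.eq_top_of_isIso_arrow _
  · rw [← Subobject.mk_arrow (F (N + 1)), Subobject.mk_eq_bot_iff_zero]
    ext n
    by_cases hn : n < N + 1
    · exact ((h (N + 1) n).2 hn).eq_of_src _ _
    · exact (hR n (by omega)).eq_of_tgt _ _
  · have hδ : ∀ n, ∃ δ : R.X n ⟶ (G k).X n, n = k → IsIso δ := by
      intro n
      by_cases hn : n = k
      · subst hn
        exact ⟨(e n).some.hom, fun _ => inferInstance⟩
      · exact ⟨0, fun h => absurd h hn⟩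
    choose δ hδ using hδ
    -- Compatibility with differentials is automatic: the target is nonzero only in degree `k`, and
    -- the source vanishes below it.
    let g : (F k : CochainComplex 𝒞 ℕ) ⟶ G k :=
      { f := fun n => (F k).arrow.f n ≫ δ n
        comm' := fun n m hnm => by
          by_cases hm : m = k
          · refine ((h k n).2 ?_).eq_of_src _ _
            change n + 1 = m at hnm
            omega
          · exact (hG k m hm).eq_of_tgt _ _ }
    have wg : Subobject.ofLE (F (k + 1)) (F k) (hF (Nat.le_succ k)) ≫ g = 0 := by
      ext n
      by_cases hn : n = k
      · exact ((h (k + 1) n).2 (by omega)).eq_of_src _ _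
      · exact (hG k n hn).eq_of_tgt _ _
    refine ⟨g, wg, fun n => ?_⟩
    -- In degree `k` the subcomplex vanishes and `g` is an isomorphism; in every other degree the
    -- quotient vanishes and the inclusion is an isomorphism.
    by_cases hn : n = k
    · have := hδ n hn
      have := (h k n).1 hn.ge
      exact hE.zeroConflation _ ((h (k + 1) n).2 (by omega)) _
        (inferInstanceAs (IsIso ((F k).arrow.f n ≫ δ n))) _
    · refine hE.isoConflation _ ?_ (hG k n hn) _ _
      rcases lt_or_gt_of_ne hn with hlt | hgt
      · exact ⟨0, ((h (k + 1) n).2 (by omega)).eq_of_src _ _, ((h k n).2 hlt).eq_of_src _ _⟩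
      · have h1 := (h k n).1 hgt.le
        have h2 := (h (k + 1) n).1 hgt
        have h3 : (Subobject.ofLE (F (k + 1)) (F k) (hF (Nat.le_succ k))).f n ≫ (F k).arrow.f n =
            (F (k + 1)).arrow.f n := by
          rw [← HomologicalComplex.comp_f, Subobject.ofLE_arrow]
        have h4 : IsIso ((Subobject.ofLE (F (k + 1)) (F k) (hF (Nat.le_succ k))).f n ≫
            (F k).arrow.f n) := by
          rw [h3]; exact h2
        exact @IsIso.of_isIso_comp_right _ _ _ _ _ _ _ h1 h4

end Filtration

/-! ### The two-term complex of an extension -/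

section TwoTerm

variable {𝒞 : Type*} [Category 𝒞] [Preadditive 𝒞] [HasZeroObject 𝒞]

/-- A morphism as a complex in degrees `0` and `1`. -/
theorem exists_twoTerm {B C : 𝒞} (p : B ⟶ C) :
    ∃ (K : CochainComplex 𝒞 ℕ) (e0 : K.X 0 ≅ B) (e1 : K.X 1 ≅ C),
      e0.hom ≫ p = K.d 0 1 ≫ e1.hom ∧ ∀ n, IsZero (K.X (n + 2)) := by
  obtain ⟨O, hO⟩ := (inferInstance : HasZeroObject 𝒞)
  let X : ℕ → 𝒞
    | 0 => B
    | 1 => C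
    | _ + 2 => O
  let d : ∀ n, X n ⟶ X (n + 1)
    | 0 => p
    | _ + 1 => 0
  have hd : ∀ n, d n ≫ d (n + 1) = 0 := fun n => hO.eq_of_tgt _ _
  refine ⟨CochainComplex.of X d hd, Iso.refl _, Iso.refl _, ?_, fun n => hO⟩
  have : (CochainComplex.of X d hd).d 0 1 = p := CochainComplex.of_d X d 0
  refine (Category.id_comp _).trans (Eq.trans ?_ (Category.comp_id _).symm)
  exact this.symm

end TwoTerm

end SchurExt

theorem mainTheorem10 {𝒜 : Type*} [Category 𝒜] [Preadditive 𝒜] [Linear ℚ 𝒜]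
    [HasFiniteBiproducts 𝒜] [IsIdempotentComplete 𝒜]
    [MonoidalCategory 𝒜] [MonoidalPreadditive 𝒜] [MonoidalLinear ℚ 𝒜] [SymmetricCategory 𝒜]
    (E : ShortComplex 𝒜 → Prop) (hE : SchurExt.IsExactStructure E) (hT : SchurExt.TensorExact E)
    {A B C : 𝒜} (i : A ⟶ B) (p : B ⟶ C) (w : i ≫ p = 0) (hABC : E (ShortComplex.mk i p w))
    (lam : YoungDiagram) :
    ∃ R : CochainComplex 𝒜 ℕ,
      SchurExt.IsResolution E (SchurExt.schurObj lam.cells A) R ∧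
      ∃ (F : ℕ → Subobject R) (hF : Antitone F), F 0 = ⊤ ∧ F (lam.card + 1) = ⊥ ∧
        ∀ k, k ≤ lam.card →
          ∃ (g : (F k : CochainComplex 𝒜 ℕ) ⟶ SchurExt.gradedPiece lam k B C)
            (wg : Subobject.ofLE (F (k + 1)) (F k) (hF (Nat.le_succ k)) ≫ g = 0),
            SchurExt.DegreewiseExact E
              (ShortComplex.mk (Subobject.ofLE (F (k + 1)) (F k) (hF (Nat.le_succ k))) g wg) := by
  obtain ⟨K, e0, e1, he, hK⟩ := SchurExt.exists_twoTerm p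
  have w' : (i ≫ e0.inv) ≫ K.d 0 1 = 0 := by
    rw [← cancel_mono e1.hom, Category.assoc, Category.assoc, ← he, Iso.inv_hom_id_assoc, w,
      zero_comp]
  have hi : E (ShortComplex.mk (i ≫ e0.inv) (K.d 0 1) w') :=
    hE.congr_iso hABC w' (Iso.refl A) e0.symm e1.symm (Category.id_comp _) (by
      rw [Iso.symm_hom, Iso.symm_hom, Iso.inv_comp_eq, ← Category.assoc, he, Category.assoc,
        Iso.hom_inv_id, Category.comp_id])
  -- A tensor power with `m` factors of a complex in degrees at most 1 lives in degrees at most `m`;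
  -- so the truncation at `lam.card + 1` is zero.
  have hbound : ∀ n, lam.card < n → IsZero ((SchurExt.schurObj lam.cells K).X n) := fun n hn =>
    SchurExt.isZero_schurObj_X (· ≤ 1) (fun m j => j ≤ m) le_rfl (fun m a b ha hb => by omega)
      (fun a ha => by
        obtain ⟨b, rfl⟩ : ∃ b, a = b + 2 := ⟨a - 2, by omega⟩
        exact hK b) lam.cells n (by
          change ¬ n ≤ lam.card
          omega)
  obtain ⟨F, hF, h0, h1, h⟩ := SchurExt.exists_filtration hE (SchurExt.schurObj lam.cells K)
    lam.card hbound (fun k => SchurExt.gradedPiece lam k B C)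
    (fun k n hn => SchurExt.isZero_gradedPiece_X lam B C hn)
    (fun k => SchurExt.nonempty_schurObj_X_iso lam e0 e1 hK k)
  exact ⟨_, SchurExt.isResolution_schurObj hE hT hK hi lam.cells, F, hF, h0, h1, fun k _ => h k⟩
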